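/- **Setting.** Fix a smooth dyadic partition of unity $\chi(\xi)+\sum_{j\ge0}\varphi(2^{-j}\xi)=1$ on $\mathbb R$ (with $\chi,\varphi$ smooth, even, $[0,1]$-valued, $\chi$ supported in $\{|\xi|\le 4/3\}$ and $\varphi$ in $\{3/4\le|\xi|\le 8/3\}$), and set $\phi_{-1}=\chi$, $\phi_j=\varphi(2^{-j}\cdot)$ for $j\ge 0$. For $\gamma\in\mathbb R$ let $C^\gamma$ be the space of tempered distributions $f$ on $\mathbb R$ with $\|f\|_{C^\gamma}:=\sup_{j\ge-1}2^{j\gamma}\|(\phi_j\hat f)^\vee\|_{L^\infty}<\infty$; for $\gamma>0$ its elements are identified with bounded continuous functions. For $T>0$, $C_TC^\gamma$ is the space of continuous maps $[0,T]\to C^\gamma$ with the supremum norm, and $C^{1/2}_TC^\gamma$ the space of $\frac12$-Hölder continuous maps $[0,T]\to C^\gamma$. Let $P_t$ be convolution with the heat kernel $p_t(z)=(2\pi t)^{-1/2}e^{-z^2/(2t)}$, extended to tempered distributions by duality, and $P_0=\mathrm{id}$. **Assumptions.** Let $T>0$, $\nu>0$, $0<\hat\beta<\beta<\frac12$ and $\beta-\hat\beta<\nu$.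 - $\rho_0\in C^{1+\nu}$ is a probability density on $\mathbb R$ with $\int x^2\rho_0(x)\,dx<\infty$. - $b\in C^{1/2}_TC^{-\hat\beta}$ is a real distribution-valued function. - $F:\mathbb R\to\mathbb R$ is bounded and differentiable and $F'$ is bounded and Lipschitz; $\tilde F(x):=xF(x)$ is differentiable and $\tilde F'$ is bounded and Lipschitz. For real $N\ge1$ put $b^N(t):=P_{1/N}b(t)$, and let $\rho^N$ be the mild solution of $\partial_t\rho^N=\frac12\partial_{xx}\rho^N-\partial_x[\tilde F(\rho^N)b^N]$, $\rho^N(0)=\rho_0$, that is, $\rho^N\in C_TC^\alpha$ for some $\alpha>\beta$ and $$\rho^N(t)=P_t\rho_0-\int_0^tP_{t-s}\big[\partial_x[\tilde F(\rho^N(s))\,b^N(s)]\big]\,ds,\qquad t\in[0,T].$$ **Lemma 5.4.** For every $t\in[0,T]$ the function $\rho^N(t)$ is differentiable in $x$, and $\rho^N_x\in L^\infty_TL^\infty=L^\infty([0,T];L^\infty(\mathbb R))$. Moreover, for every $\eta\in(0,\nu)$ and every $N\ge1$, $$\|\rho^N_x\|_{L^\infty_TL^\infty}\le c_7+c_8\,N^{\frac{\eta+\hat\beta}{2}},$$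 where $c_7,c_8\ge0$ are finite and do not depend on $N$: apart from the fixed partition of unity, $c_7$ depends only on $\nu$ and $\|\rho_0\|_{C^{1+\nu}}$, and $c_8$ depends only on $\beta,\hat\beta,F$ and on $\eta$, $T$, $\|\rho_0\|_{C^{\frac12\vee\eta}}$, $\sup_{M\ge1}\|b^M\|_{C_TC^{-\beta}}$ and $\|b\|_{C_TC^{-\hat\beta}}$. -/

import Mathlib

open MeasureTheory Filter Topology Set
open scoped ENNReal NNReal SchwartzMap FourierTransform ContDiff

/-! ### The heat semigroup on tempered distributions -/

/-- The heat kernel `p_t(z) = (2πt)^{-1/2} exp(-z²/(2t))`. -/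
noncomputable def heatKernel (t z : ℝ) : ℝ :=
  (2 * Real.pi * t) ^ (-(1 / 2) : ℝ) * Real.exp (-z ^ 2 / (2 * t))

theorem heatKernel_contDiff (t : ℝ) : ContDiff ℝ ∞ (fun x => (heatKernel t x : ℂ)) := by
  refine Complex.ofRealCLM.contDiff.comp (g := Complex.ofRealCLM) (f := heatKernel t) ?_
  unfold heatKernel
  refine contDiff_const.mul (Real.contDiff_exp.comp ?_)
  fun_prop

theorem heatKernel_iteratedDeriv (t : ℝ) (n : ℕ) : ∃ p : Polynomial ℝ,
    ∀ x, iteratedDeriv n (fun x => (heatKernel t x : ℂ)) x = ((p.eval x * heatKernel t x : ℝ) : ℂ) := by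
  induction n with
  | zero => exact ⟨1, fun x => by simp⟩
  | succ n ih =>
    obtain ⟨p, hp⟩ := ih
    refine ⟨p.derivative - p * (Polynomial.C t⁻¹ * Polynomial.X), fun x => ?_⟩
    rw [iteratedDeriv_succ, funext hp]
    refine HasDerivAt.deriv (HasDerivAt.ofReal_comp ?_)
    have h1 : HasDerivAt (heatKernel t) (-(t⁻¹ * x) * heatKernel t x) x := by
      have h2 : HasDerivAt (fun z : ℝ => -z ^ 2 / (2 * t)) (-(t⁻¹ * x)) x := by
        have h3 := ((hasDerivAt_pow 2 x).neg).div_const (2 * t)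
        refine h3.congr_deriv ?_
        rcases eq_or_ne t 0 with rfl | ht
        · simp
        · field_simp
          simp
      have h4 := (h2.exp).const_mul ((2 * Real.pi * t) ^ (-(1 / 2) : ℝ))
      refine h4.congr_deriv ?_
      unfold heatKernel
      ring
    refine ((p.hasDerivAt x).mul h1).congr_deriv ?_
    simp
    ring

theorem heatKernel_decay {t : ℝ} (ht : 0 < t) (p : Polynomial ℝ) :
    ∀ k : ℕ, ∃ C : ℝ, ∀ x : ℝ, |x| ^ k * |p.eval x * heatKernel t x| ≤ C := by
  induction p using Polynomial.induction_on' with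
  | add p q hp hq =>
    intro k
    obtain ⟨C, hC⟩ := hp k
    obtain ⟨D, hD⟩ := hq k
    refine ⟨C + D, fun x => ?_⟩
    rw [Polynomial.eval_add, add_mul]
    calc _ ≤ |x| ^ k * (|p.eval x * heatKernel t x| + |q.eval x * heatKernel t x|) := by
          gcongr
          exact abs_add_le _ _
      _ ≤ C + D := by rw [mul_add]; exact add_le_add (hC x) (hD x)
  | monomial n a =>
    intro k
    set c : ℝ := (2 * Real.pi * t) ^ (-(1 / 2) : ℝ)
    have hc : 0 ≤ c := by positivity
    refine ⟨|a| * c * (1 + (n + k).factorial * (2 * t) ^ (n + k)), fun x => ?_⟩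
    set y : ℝ := x ^ 2 / (2 * t) with hy
    have hy0 : 0 ≤ y := by positivity
    have h1 := Real.pow_div_factorial_le_exp y hy0 (n + k)
    have hx2 : x ^ 2 = y * (2 * t) := by rw [hy]; field_simp
    have h2 : |x| ^ (n + k) ≤ 1 + (x ^ 2) ^ (n + k) := by
      have := sq_nonneg (|x| ^ (n + k) - 1)
      have h3 : (x ^ 2) ^ (n + k) = (|x| ^ (n + k)) ^ 2 := by
        rw [← sq_abs, ← pow_mul, ← pow_mul, mul_comm]
      rw [h3]
      nlinarith [sq_nonneg (|x| ^ (n + k))]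
    have h4 : y ^ (n + k) * Real.exp (-y) ≤ (n + k).factorial := by
      rw [div_le_iff₀ (by positivity)] at h1
      calc _ ≤ (Real.exp y * (n + k).factorial) * Real.exp (-y) := by gcongr
        _ = (n + k).factorial * (Real.exp y * Real.exp (-y)) := by ring
        _ = _ := by rw [← Real.exp_add]; simp
    have h5 : Real.exp (-y) ≤ 1 := Real.exp_le_one_iff.mpr (by linarith)
    have h6 : |x| ^ k * |(Polynomial.monomial n a).eval x * heatKernel t x|
        = |a| * c * (|x| ^ (n + k) * Real.exp (-y)) := by
      rw [Polynomial.eval_monomial, heatKernel, neg_div, ← hy, abs_mul, abs_mul, abs_mul,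
        abs_of_nonneg hc, abs_of_pos (Real.exp_pos _), abs_pow, pow_add]
      ring
    rw [h6]
    refine mul_le_mul_of_nonneg_left ?_ (by positivity)
    calc _ ≤ (1 + (x ^ 2) ^ (n + k)) * Real.exp (-y) := by gcongr
      _ = Real.exp (-y) + (2 * t) ^ (n + k) * (y ^ (n + k) * Real.exp (-y)) := by
        rw [hx2, mul_pow]; ring
      _ ≤ 1 + (2 * t) ^ (n + k) * (n + k).factorial := by gcongr
      _ = _ := by ring

/-- The heat kernel at a time `t > 0` as a Schwartz function. -/
noncomputable def heatKernelSchwartz (t : ℝ) (ht : 0 < t) : 𝓢(ℝ, ℂ) where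
  toFun x := (heatKernel t x : ℂ)
  smooth' := heatKernel_contDiff t
  decay' k n := by
    obtain ⟨p, hp⟩ := heatKernel_iteratedDeriv t n
    obtain ⟨C, hC⟩ := heatKernel_decay ht p k
    refine ⟨C, fun x => ?_⟩
    rw [norm_iteratedFDeriv_eq_norm_iteratedDeriv, hp x, Complex.norm_real, Real.norm_eq_abs,
      Real.norm_eq_abs]
    exact hC x

/-- `P_t` on Schwartz functions, `P_t f = p_t ⋆ f` for `t > 0`, and `P_0 = id`
(times `t < 0` are never used). -/
noncomputable def heatSchwartz (t : ℝ) : 𝓢(ℝ, ℂ) →L[ℂ] 𝓢(ℝ, ℂ) :=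
  if ht : 0 < t then
    SchwartzMap.convolution (ContinuousLinearMap.lsmul ℂ ℂ) (heatKernelSchwartz t ht)
  else ContinuousLinearMap.id ℂ _

theorem heatSchwartz_apply {t : ℝ} (ht : 0 < t) (f : 𝓢(ℝ, ℂ)) (x : ℝ) :
    heatSchwartz t f x = ∫ z, (heatKernel t (x - z) : ℂ) * f z := by
  rw [heatSchwartz, dif_pos ht, SchwartzMap.convolution_apply, convolution_eq_swap]
  rfl

/-- `P_t` on tempered distributions, by duality: `⟨P_t u, f⟩ = ⟨u, P_t f⟩`. -/
noncomputable def heatSemigroup (t : ℝ) : 𝓢'(ℝ, ℂ) →L[ℂ] 𝓢'(ℝ, ℂ) :=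
  PointwiseConvergenceCLM.precomp ℂ (heatSchwartz t)

theorem heatSemigroup_apply (t : ℝ) (u : 𝓢'(ℝ, ℂ)) (f : 𝓢(ℝ, ℂ)) :
    heatSemigroup t u f = u (heatSchwartz t f) := rfl

/-! ### Bounded functions as distributions -/

open Classical in
/-- The tempered distribution `φ ↦ ∫ φ f` of a real function `f ∈ L^∞(ℝ)`
(by convention `0` if `f` is not in `L^∞(ℝ)`, a case that is never used). -/
noncomputable def funDist (f : ℝ → ℝ) : 𝓢'(ℝ, ℂ) :=
  if h : MemLp (fun x => (f x : ℂ)) ∞ (volume : Measure ℝ) then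
    ((h.toLp _ : Lp ℂ ∞ (volume : Measure ℝ)) : 𝓢'(ℝ, ℂ))
  else 0

theorem funDist_apply {f : ℝ → ℝ} (hf : MemLp f ∞ (volume : Measure ℝ)) (φ : 𝓢(ℝ, ℂ)) :
    funDist f φ = ∫ x, φ x * (f x : ℂ) := by
  have h : MemLp (fun x => (f x : ℂ)) ∞ (volume : Measure ℝ) := hf.ofReal
  rw [funDist, dif_pos h, Lp.toTemperedDistribution_apply]
  refine integral_congr_ae ?_
  filter_upwards [h.coeFn_toLp] with x hx
  rw [hx, smul_eq_mul]

/-- The distribution `u` is the bounded continuous real function `f`. -/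
structure IsBoundedFun (u : 𝓢'(ℝ, ℂ)) (f : ℝ → ℝ) : Prop where
  cont : Continuous f
  bdd : MemLp f ∞ (volume : Measure ℝ)
  eq : funDist f = u

/-! ### Hölder–Besov spaces -/

/-- A smooth dyadic partition of unity `χ(ξ) + ∑_{j ≥ 0} φ(2^{-j} ξ) = 1` on the Fourier side. -/
structure DyadicPartition where
  χ : ℝ → ℝ
  φ : ℝ → ℝ
  χ_smooth : ContDiff ℝ ∞ χ
  φ_smooth : ContDiff ℝ ∞ φ
  χ_even : ∀ ξ, χ (-ξ) = χ ξ
  φ_even : ∀ ξ, φ (-ξ) = φ ξ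
  χ_mem : ∀ ξ, χ ξ ∈ Icc (0 : ℝ) 1
  φ_mem : ∀ ξ, φ ξ ∈ Icc (0 : ℝ) 1
  χ_support : ∀ ξ, χ ξ ≠ 0 → |ξ| ≤ 4 / 3
  φ_support : ∀ ξ, φ ξ ≠ 0 → 3 / 4 ≤ |ξ| ∧ |ξ| ≤ 8 / 3
  sum_one : ∀ ξ, HasSum (fun j : ℕ => φ (ξ / 2 ^ j)) (1 - χ ξ)

/-- Dyadic partitions of unity exist. -/
theorem DyadicPartition.nonempty : Nonempty DyadicPartition := by
  set θ : ℝ → ℝ := fun ξ => 1 - Real.smoothTransition ((ξ ^ 2 - 9 / 16) / (16 / 9 - 9 / 16)) with hθ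
  have hsm : ContDiff ℝ ∞ θ := by
    refine contDiff_const.sub (Real.smoothTransition.contDiff.comp ?_)
    fun_prop
  have heven : ∀ ξ, θ (-ξ) = θ ξ := fun ξ => by simp [hθ]
  have h0 : ∀ ξ, 0 ≤ θ ξ := fun ξ => by
    simpa [hθ] using Real.smoothTransition.le_one _
  have h1 : ∀ ξ, θ ξ ≤ 1 := fun ξ => by
    simpa [hθ] using Real.smoothTransition.nonneg _
  have hout : ∀ ξ, θ ξ ≠ 0 → |ξ| ≤ 4 / 3 := fun ξ h => by
    by_contra! hc
    refine h ?_
    have : 16 / 9 ≤ ξ ^ 2 := by rw [← sq_abs]; nlinarith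
    simp only [hθ]
    rw [Real.smoothTransition.one_of_one_le, sub_self]
    rw [one_le_div (by norm_num)]
    linarith
  have hin : ∀ ξ, |ξ| ≤ 3 / 4 → θ ξ = 1 := fun ξ h => by
    have : ξ ^ 2 ≤ 9 / 16 := by rw [← sq_abs]; nlinarith [abs_nonneg ξ]
    simp only [hθ]
    rw [Real.smoothTransition.zero_of_nonpos, sub_zero]
    exact div_nonpos_of_nonpos_of_nonneg (by linarith) (by norm_num)
  have hmono : ∀ ξ, θ ξ ≤ θ (ξ / 2) := fun ξ => by
    simp only [hθ]
    refine sub_le_sub_left (Real.smoothTransition.monotone ?_) _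
    refine div_le_div_of_nonneg_right ?_ (by norm_num)
    nlinarith [sq_nonneg ξ]
  refine ⟨⟨θ, fun ξ => θ (ξ / 2) - θ ξ, hsm, ?_, heven, ?_, fun ξ => ⟨h0 ξ, h1 ξ⟩, ?_, hout, ?_, ?_⟩⟩
  · exact (hsm.comp (by fun_prop)).sub hsm
  · intro ξ
    rw [neg_div, heven, heven]
  · intro ξ
    exact ⟨by linarith [hmono ξ], by linarith [h1 (ξ / 2), h0 ξ]⟩
  · intro ξ h
    constructor
    · by_contra! hc
      refine h ?_
      rw [hin ξ hc.le, hin (ξ / 2) (by rw [abs_div, abs_two]; linarith [abs_nonneg ξ]), sub_self]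
    · by_contra! hc
      refine h ?_
      have e1 : θ ξ = 0 := by
        by_contra hne
        linarith [hout ξ hne]
      have e2 : θ (ξ / 2) = 0 := by
        by_contra hne
        have := hout _ hne
        rw [abs_div, abs_two] at this
        linarith
      rw [e1, e2, sub_self]
  · intro ξ
    rw [hasSum_iff_tendsto_nat_of_nonneg]
    · have hs : ∀ n : ℕ, ∑ j ∈ Finset.range n, (θ (ξ / 2 ^ j / 2) - θ (ξ / 2 ^ j))
          = θ (ξ / 2 ^ n) - θ ξ := fun n => by
        have := Finset.sum_range_sub (fun j : ℕ => θ (ξ / 2 ^ j)) n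
        simp only [pow_succ, ← div_div, pow_zero, div_one] at this
        exact this
      simp only [hs]
      refine Tendsto.sub_const ?_ _
      refine tendsto_const_nhds.congr' ?_
      have hz : Tendsto (fun n : ℕ => |ξ / 2 ^ n|) atTop (𝓝 0) := by
        have := (tendsto_pow_atTop_nhds_zero_of_lt_one (r := (1 / 2 : ℝ))
          (by norm_num) (by norm_num)).const_mul ξ
        rw [mul_zero] at this
        simpa [div_eq_mul_inv] using this.abs
      filter_upwards [hz.eventually (ge_mem_nhds (show (0 : ℝ) < 3 / 4 by norm_num))] with n hn
      exact (hin _ hn).symm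
    · intro j
      linarith [hmono (ξ / 2 ^ j)]

/-- The `L^∞` norm of a tempered distribution; `∞` if it is not a bounded function. -/
noncomputable def linftyNorm (u : 𝓢'(ℝ, ℂ)) : ℝ≥0∞ :=
  ⨅ (f : Lp ℂ ∞ (volume : Measure ℝ)) (_ : (f : 𝓢'(ℝ, ℂ)) = u), ‖f‖ₑ

/-- The norm of `C^γ = B^γ_{∞,∞}(ℝ)`: the supremum over `j ≥ -1` of
`2^{jγ} ‖(φ_j û)^∨‖_{L^∞}`, with `φ_{-1} = χ` and `φ_j = φ(2^{-j} ·)` for `j ≥ 0`. -/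
noncomputable def besovNorm (Φ : DyadicPartition) (γ : ℝ) (u : 𝓢'(ℝ, ℂ)) : ℝ≥0∞ :=
  max
    (ENNReal.ofReal ((2 : ℝ) ^ (-γ)) *
      linftyNorm (TemperedDistribution.fourierMultiplierCLM ℂ (fun ξ : ℝ => (Φ.χ ξ : ℂ)) u))
    (⨆ j : ℕ, ENNReal.ofReal ((2 : ℝ) ^ ((j : ℝ) * γ)) *
      linftyNorm (TemperedDistribution.fourierMultiplierCLM ℂ
        (fun ξ : ℝ => (Φ.φ (ξ / 2 ^ j) : ℂ)) u))

/-- The norm of `C_T C^γ`. -/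
noncomputable def normCT (Φ : DyadicPartition) (T γ : ℝ) (u : ℝ → 𝓢'(ℝ, ℂ)) : ℝ≥0∞ :=
  ⨆ t ∈ Icc (0 : ℝ) T, besovNorm Φ γ (u t)

/-- `u ∈ C_T C^γ`, i.e. `u` is continuous from `[0,T]` to `C^γ`. -/
structure MemCT (Φ : DyadicPartition) (T γ : ℝ) (u : ℝ → 𝓢'(ℝ, ℂ)) : Prop where
  finite : ∀ t ∈ Icc (0 : ℝ) T, besovNorm Φ γ (u t) < ⊤
  cont : ∀ t ∈ Icc (0 : ℝ) T,
    Tendsto (fun s => besovNorm Φ γ (u s - u t)) (𝓝[Icc (0 : ℝ) T] t) (𝓝 0)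

/-- `u ∈ C^κ_T C^γ`, i.e. `u` is `κ`-Hölder continuous from `[0,T]` to `C^γ`. -/
structure MemHolderT (Φ : DyadicPartition) (T κ γ : ℝ) (u : ℝ → 𝓢'(ℝ, ℂ)) : Prop where
  finite : ∀ t ∈ Icc (0 : ℝ) T, besovNorm Φ γ (u t) < ⊤
  holder : ∃ K : ℝ≥0, ∀ t ∈ Icc (0 : ℝ) T, ∀ s ∈ Icc (0 : ℝ) T,
    besovNorm Φ γ (u t - u s) ≤ K * ENNReal.ofReal (|t - s| ^ κ)

/-! ### The data and the regularised Fokker–Planck equation -/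

/-- `g` is differentiable with a bounded and Lipschitz continuous derivative. -/
structure HasBoundedLipschitzDeriv (g : ℝ → ℝ) : Prop where
  diff : Differentiable ℝ g
  bdd : ∃ C : ℝ, ∀ x, |deriv g x| ≤ C
  lip : ∃ K : ℝ≥0, LipschitzWith K (deriv g)

/-- The conditions on the nonlinearity `F`, with `F̃(x) = x F(x)`. -/
structure IsAdmissibleNonlinearity (F : ℝ → ℝ) : Prop where
  bdd : ∃ C : ℝ, ∀ x, |F x| ≤ C
  reg : HasBoundedLipschitzDeriv F
  reg_tilde : HasBoundedLipschitzDeriv (fun x => x * F x)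

/-- `ρ₀` is a probability density of class `C^{1+ν}` with a finite second moment. -/
structure IsAdmissibleDensity (Φ : DyadicPartition) (ν : ℝ) (ρ₀ : ℝ → ℝ) : Prop where
  nonneg : ∀ x, 0 ≤ ρ₀ x
  integrable : Integrable ρ₀
  integral_eq_one : ∫ x, ρ₀ x = 1
  second_moment : Integrable (fun x => x ^ 2 * ρ₀ x)
  cont : Continuous ρ₀
  bdd : MemLp ρ₀ ∞ (volume : Measure ℝ)
  reg : besovNorm Φ (1 + ν) (funDist ρ₀) < ⊤

/-- `ρ` is a mild solution on `[0,T]` of `∂_t ρ = ½ ρ_xx - ∂_x [F̃(ρ) d]`, `ρ(0) = ρ₀`, for a drift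
`d` that is a bounded function: `ρ ∈ C_T C^α` for some `α > β`, and
`ρ(t) = P_t ρ₀ - ∫_0^t P_{t-s} ∂_x [F̃(ρ(s)) d(s)] ds` for all `t ∈ [0,T]`, the integral being
taken in the space of tempered distributions (that is, against every test function).
Elements of `C^α`, `α > 0`, are identified with bounded continuous functions. -/
structure IsMildSolution (Φ : DyadicPartition) (T β : ℝ) (F ρ₀ : ℝ → ℝ) (d : ℝ → ℝ → ℝ)
    (ρ : ℝ → ℝ → ℝ) : Prop where
  cont : ∀ t ∈ Icc (0 : ℝ) T, Continuous (ρ t)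
  bdd : ∀ t ∈ Icc (0 : ℝ) T, MemLp (ρ t) ∞ (volume : Measure ℝ)
  mem : ∃ α : ℝ, β < α ∧ MemCT Φ T α (fun t => funDist (ρ t))
  integrable : ∀ t ∈ Icc (0 : ℝ) T, ∀ f : 𝓢(ℝ, ℂ),
    IntervalIntegrable (fun s => heatSemigroup (t - s) (TemperedDistribution.derivCLM ℂ
      (funDist (fun x => (ρ s x * F (ρ s x)) * d s x))) f) volume 0 t
  mild : ∀ t ∈ Icc (0 : ℝ) T, ∀ f : 𝓢(ℝ, ℂ),
    funDist (ρ t) f = heatSemigroup t (funDist ρ₀) f -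
      ∫ s in (0 : ℝ)..t, heatSemigroup (t - s) (TemperedDistribution.derivCLM ℂ
        (funDist (fun x => (ρ s x * F (ρ s x)) * d s x))) f

/-- The regularised drift `b^N = P_{1/N} b`. -/
noncomputable def regDrift (b : ℝ → 𝓢'(ℝ, ℂ)) (N t : ℝ) : 𝓢'(ℝ, ℂ) :=
  heatSemigroup (1 / N) (b t)

/-!
All norms are translated into statements about the heat semigroup acting on bounded functions, and
the estimate is then proved there.

*Regularity.* A Littlewood–Paley block of a distribution in `C^γ` is reproduced by convolution with a
Schwartz kernel, which gives Bernstein's inequalities (`exists_isBlockDecomposition`). Summing the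
blocks, a function in `C^γ`, `γ > 0`, is Hölder continuous of every order below `γ`
(`exists_holder_bound`), a function in `C^{1+ν}` is differentiable with a bounded derivative
(`exists_deriv_bound`), and for `βhat < c` the drift `d = P_{1/N} b` satisfies
`‖P_s d‖_∞ ≲ s^{-c/2}` uniformly in `N`, while its supremum and Lipschitz norms are at most
`N^{c/2}` and `N^{(c+1)/2}`, up to constants (`exists_regularised_bound`).

*Products.* `P_h` is the expectation of a Gaussian of variance `h`, so that `P_h (f d) - P_h f P_h d`
is a covariance, of size `h` times the Lipschitz constants of the factors. Comparing the times
`r, r/2, r/4, …`, the bound `‖P_r (f d)‖_∞ ≲ ‖f‖ ‖d‖ r^{-c/2}` holds when `f` is Hölder continuous of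
an order above `c` (`norm_heat_mul_le`); it replaces the paraproduct estimate.

*A priori bound.* The weak mild formulation tested against heat kernels is the Duhamel formula
`ρ(t) = P_t ρ₀ - ∫_0^t ∂_x P_{t-s} (F̃(ρ(s)) d(s)) ds` (`IsMildSolution.duhamel`). Its kernel has an
integrable singularity in the `β`-Hölder norm because `β < 1/2`, so an exponential weight in time
bounds that norm of `ρ(t)` by the one of `ρ₀`, uniformly in `N` (`exists_holder_apriori`).

*Derivative.* With this bound the source `F̃(ρ(s)) d(s)` is Hölder continuous of a small order `δ`
with a constant of order `N^{(c+δ)/2}`, which is all that the space derivative of the Duhamel term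
needs (`exists_hasDerivAt_duhamel`). For `c = βhat + δ` and `2δ ≤ η` the power of `N` is at most
`N^{(η+βhat)/2}`. The derivative of `P_t ρ₀` is bounded by that of `ρ₀`, which is the term `c₇`.
-/

/-! ### Convolution of an integrable kernel with a bounded function -/

/-- The convolution `x ↦ ∫ k(x - y) f(y) dy` of two complex functions on the line. -/
noncomputable def kconv (k f : ℝ → ℂ) (x : ℝ) : ℂ := ∫ y, k (x - y) * f y

/-- `f` is measurable and bounded by `M` almost everywhere. -/
structure EssBdd (f : ℝ → ℂ) (M : ℝ) : Prop where
  meas : AEStronglyMeasurable f (volume : Measure ℝ)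
  bdd : ∀ᵐ x, ‖f x‖ ≤ M

theorem EssBdd.of_continuous {f : ℝ → ℂ} {M : ℝ} (hf : Continuous f) (h : ∀ x, ‖f x‖ ≤ M) :
    EssBdd f M := ⟨hf.aestronglyMeasurable, Eventually.of_forall h⟩

theorem EssBdd.nonneg {f : ℝ → ℂ} {M : ℝ} (h : EssBdd f M) : 0 ≤ M := by
  obtain ⟨x, hx⟩ := h.bdd.exists
  exact (norm_nonneg _).trans hx

theorem EssBdd.integrable_mul {f k : ℝ → ℂ} {M : ℝ} (h : EssBdd f M) (hk : Integrable k) :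
    Integrable (fun y => k y * f y) :=
  hk.mul_bdd h.meas h.bdd

theorem kconv_eq_integral (k f : ℝ → ℂ) (x : ℝ) : kconv k f x = ∫ z, k z * f (x - z) := by
  rw [kconv, ← integral_sub_left_eq_self (fun z => k z * f (x - z)) volume x]
  simp

theorem kconv_comm (k f : ℝ → ℂ) : kconv k f = kconv f k := by
  ext x
  rw [kconv_eq_integral, kconv]
  simp only [mul_comm]

theorem norm_kconv_le {k f : ℝ → ℂ} {M : ℝ} (hf : EssBdd f M) (hk : Integrable k) (x : ℝ) :
    ‖kconv k f x‖ ≤ (∫ z, ‖k z‖) * M := by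
  have hk' : Integrable (fun y => k (x - y)) := hk.comp_sub_left x
  calc ‖kconv k f x‖ ≤ ∫ y, ‖k (x - y)‖ * M := by
        refine norm_integral_le_of_norm_le (hk'.norm.mul_const M) ?_
        filter_upwards [hf.bdd] with y hy
        rw [norm_mul]
        gcongr
    _ = (∫ z, ‖k z‖) * M := by
        rw [integral_mul_const, integral_sub_left_eq_self (fun z => ‖k z‖) volume x]

theorem SchwartzMap.exists_norm_le_inv_one_add_sq (k : 𝓢(ℝ, ℂ)) :
    ∃ C : ℝ, 0 ≤ C ∧ ∀ z, ‖k z‖ ≤ C * (1 + z ^ 2)⁻¹ := by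
  refine ⟨SchwartzMap.seminorm ℝ 0 0 k + SchwartzMap.seminorm ℝ 2 0 k, by positivity, fun z => ?_⟩
  have h0 := SchwartzMap.norm_le_seminorm ℝ k z
  have h2 := SchwartzMap.norm_pow_mul_le_seminorm ℝ k 2 z
  rw [Real.norm_eq_abs, sq_abs] at h2
  rw [← div_eq_mul_inv, le_div_iff₀ (by positivity)]
  linarith

theorem SchwartzMap.integrable_deriv (k : 𝓢(ℝ, ℂ)) : Integrable (deriv k) := by
  have e : deriv k = SchwartzMap.derivCLM ℂ ℂ k := by
    ext x
    simp
  rw [e]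
  exact (SchwartzMap.derivCLM ℂ ℂ k).integrable

/-- A convolution with a Schwartz kernel is differentiated by differentiating the kernel. -/
theorem kconv_hasDerivAt (k : 𝓢(ℝ, ℂ)) {f : ℝ → ℂ} {M : ℝ} (hf : EssBdd f M) (x : ℝ) :
    HasDerivAt (kconv k f) (kconv (deriv k) f x) x := by
  obtain ⟨C, hC0, hC⟩ := (SchwartzMap.derivCLM ℂ ℂ k).exists_norm_le_inv_one_add_sq
  simp only [SchwartzMap.derivCLM_apply] at hC
  have hM := hf.nonneg
  have hint : ∀ y : ℝ, Integrable (fun z => k (y - z) * f z) := fun y =>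
    hf.integrable_mul (k.integrable.comp_sub_left y)
  have hd := k.integrable_deriv
  refine (hasDerivAt_integral_of_dominated_loc_of_deriv_le
    (bound := fun z => 4 * C * (1 + (x - z) ^ 2)⁻¹ * M)
    (F' := fun y z => deriv k (y - z) * f z) (Metric.ball_mem_nhds x one_pos)
    (Eventually.of_forall fun y => (hint y).aestronglyMeasurable) (hint x)
    (hf.integrable_mul (hd.comp_sub_left x)).aestronglyMeasurable ?_ ?_ ?_).2
  · filter_upwards [hf.bdd] with z hz y hy
    rw [norm_mul]
    refine mul_le_mul ((hC _).trans ?_) hz (norm_nonneg _) (by positivity)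
    rw [mul_comm 4 C, mul_assoc]
    refine mul_le_mul_of_nonneg_left ?_ hC0
    rw [← div_eq_mul_inv, inv_eq_one_div, div_le_div_iff₀ (by positivity) (by positivity)]
    rw [Metric.mem_ball, Real.dist_eq, abs_lt] at hy
    nlinarith [sq_nonneg ((y - z) - (x - y)), sq_nonneg (y - z)]
  · exact ((integrable_inv_one_add_sq.comp_sub_left x).const_mul (4 * C)).mul_const M
  · refine Eventually.of_forall fun z y _ => HasDerivAt.mul_const ?_ _
    exact (k.hasDerivAt (y - z)).comp_sub_const y z

theorem kconv_continuous (k : 𝓢(ℝ, ℂ)) {f : ℝ → ℂ} {M : ℝ} (hf : EssBdd f M) :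
    Continuous (kconv k f) :=
  continuous_iff_continuousAt.2 fun x => (kconv_hasDerivAt k hf x).continuousAt

/-- A convolution with an integrable kernel is differentiated by differentiating the other factor,
if its derivative is bounded. -/
theorem kconv_hasDerivAt_right {k g g' : ℝ → ℂ} {M M' : ℝ} (hk : Integrable k) (hg : EssBdd g M)
    (hd : ∀ x, HasDerivAt g (g' x) x) (hM' : ∀ x, ‖g' x‖ ≤ M') (x : ℝ) :
    HasDerivAt (kconv k g) (kconv k g' x) x := by
  have e : kconv k g = fun x => ∫ z, k z * g (x - z) := funext fun x => kconv_eq_integral k g x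
  have hg' : g' = deriv g := funext fun x => (hd x).deriv.symm
  have hm : Measurable g' := hg' ▸ measurable_deriv g
  have hint : ∀ y : ℝ, Integrable (fun z => k z * g (y - z)) := fun y => by
    simpa using (hg.integrable_mul (hk.comp_sub_left y)).comp_sub_left y
  rw [e, kconv_eq_integral]
  refine (hasDerivAt_integral_of_dominated_loc_of_deriv_le
    (bound := fun z => ‖k z‖ * M')
    (F' := fun y z => k z * g' (y - z)) (Metric.ball_mem_nhds x one_pos)
    (Eventually.of_forall fun y => (hint y).aestronglyMeasurable) (hint x)
    (hk.aestronglyMeasurable.mul (hm.comp (measurable_const.sub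
      measurable_id)).aestronglyMeasurable) ?_ (hk.norm.mul_const M') ?_).2
  · refine Eventually.of_forall fun z y _ => ?_
    rw [norm_mul]
    gcongr
    exact hM' _
  · refine Eventually.of_forall fun z y _ => HasDerivAt.const_mul _ ?_
    exact (hd (y - z)).comp_sub_const y z

theorem kconv_assoc {k l f : ℝ → ℂ} {M : ℝ} (hk : Integrable k) (hl : Integrable l)
    (hf : EssBdd f M) (x : ℝ) : kconv k (kconv l f) x = kconv (kconv k l) f x := by
  have hfx : AEStronglyMeasurable (fun w => f (x - w)) (volume : Measure ℝ) :=
    hf.meas.comp_quasiMeasurePreserving (quasiMeasurePreserving_sub_left volume x)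
  have hfb : ∀ᵐ w, ‖f (x - w)‖ ≤ M :=
    (quasiMeasurePreserving_sub_left volume x).ae hf.bdd
  have hI := (hk.convolution_integrand (ContinuousLinearMap.mul ℂ ℂ) hl).mul_bdd
    (g := fun p : ℝ × ℝ => f (x - p.1)) (c := M) (hfx.comp_fst)
    (Measure.quasiMeasurePreserving_fst.ae hfb)
  rw [kconv_eq_integral, kconv_eq_integral (kconv k l)]
  simp only [kconv_eq_integral l f, kconv_eq_integral k l, ← integral_mul_const,
    ← integral_const_mul]
  simp only [ContinuousLinearMap.mul_apply'] at hI
  rw [integral_integral_swap (f := fun w z => k z * l (w - z) * f (x - w)) hI]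
  refine integral_congr_ae (Eventually.of_forall fun y => ?_)
  dsimp only
  rw [← integral_sub_right_eq_self (fun z => k y * (l z * f (x - y - z))) y]
  refine integral_congr_ae (Eventually.of_forall fun w => ?_)
  dsimp only
  rw [mul_assoc, show x - y - (w - y) = x - w by ring]

/-- Convolution with an even kernel is symmetric. -/
theorem integral_mul_kconv {k h f : ℝ → ℂ} {M : ℝ} (hk : Integrable k) (hev : ∀ z, k (-z) = k z)
    (hh : Integrable h) (hf : EssBdd f M) :
    ∫ x, h x * kconv k f x = ∫ y, kconv k h y * f y := by
  have hI := (hh.convolution_integrand (ContinuousLinearMap.mul ℂ ℂ) hk).mul_bdd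
    (g := fun p : ℝ × ℝ => f p.1) (c := M) (hf.meas.comp_fst)
    (Measure.quasiMeasurePreserving_fst.ae hf.bdd)
  simp only [ContinuousLinearMap.mul_apply'] at hI
  simp only [kconv, ← integral_mul_const, ← integral_const_mul]
  refine Eq.trans ?_
    (integral_integral_swap (f := fun y x => h x * k (y - x) * f y) hI).symm |>.trans ?_
  · refine integral_congr_ae (Eventually.of_forall fun x => ?_)
    refine integral_congr_ae (Eventually.of_forall fun w => ?_)
    dsimp only
    rw [← hev, neg_sub]
    ring
  · refine integral_congr_ae (Eventually.of_forall fun x => ?_)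
    refine integral_congr_ae (Eventually.of_forall fun w => ?_)
    dsimp only
    ring

/-! ### The heat semigroup on bounded functions -/

/-- `P_t f`, as a function, for `t > 0`. -/
noncomputable def heat (t : ℝ) (f : ℝ → ℂ) : ℝ → ℂ := kconv (fun z => (heatKernel t z : ℂ)) f

/-- `∂_x P_t f`, as a function, for `t > 0`. -/
noncomputable def heatD (t : ℝ) (f : ℝ → ℂ) : ℝ → ℂ :=
  kconv (deriv fun z => (heatKernel t z : ℂ)) f

/-- `f` is Hölder continuous of exponent `a` with constant `H`. -/
def HolderBd (a H : ℝ) (f : ℝ → ℂ) : Prop := ∀ x y, ‖f x - f y‖ ≤ H * |x - y| ^ a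

theorem heatKernel_pos {t : ℝ} (ht : 0 < t) (z : ℝ) : 0 < heatKernel t z := by
  unfold heatKernel
  positivity

theorem heatKernel_neg (t z : ℝ) : heatKernel t (-z) = heatKernel t z := by
  simp [heatKernel]

theorem heatKernel_eq_gaussianPDFReal {t : ℝ} (ht : 0 < t) :
    heatKernel t = ProbabilityTheory.gaussianPDFReal 0 t.toNNReal := by
  ext z
  simp only [ProbabilityTheory.gaussianPDFReal_def]
  rw [heatKernel, Real.coe_toNNReal _ ht.le, sub_zero,
    Real.rpow_neg (by positivity), ← Real.sqrt_eq_rpow]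

theorem integrable_heatKernel {t : ℝ} (ht : 0 < t) : Integrable (heatKernel t) := by
  rw [heatKernel_eq_gaussianPDFReal ht]
  exact ProbabilityTheory.integrable_gaussianPDFReal _ _

theorem integral_heatKernel {t : ℝ} (ht : 0 < t) : ∫ z, heatKernel t z = 1 := by
  rw [heatKernel_eq_gaussianPDFReal ht]
  exact ProbabilityTheory.integral_gaussianPDFReal_eq_one 0 (by simpa using ht)

theorem integrable_ofReal_heatKernel {t : ℝ} (ht : 0 < t) :
    Integrable (fun z => (heatKernel t z : ℂ)) :=
  (integrable_heatKernel ht).ofReal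

theorem integral_ofReal_heatKernel {t : ℝ} (ht : 0 < t) : ∫ z, (heatKernel t z : ℂ) = 1 := by
  rw [integral_complex_ofReal, integral_heatKernel ht, Complex.ofReal_one]

theorem integrable_sq_mul_heatKernel {t : ℝ} (ht : 0 < t) :
    Integrable (fun z => z ^ 2 * heatKernel t z) := by
  have h := (heatKernelSchwartz t ht).integrable_pow_mul volume 2
  refine h.congr (Eventually.of_forall fun z => ?_)
  change ‖z‖ ^ 2 * ‖(heatKernel t z : ℂ)‖ = _
  rw [Complex.norm_real, Real.norm_eq_abs, Real.norm_eq_abs, sq_abs,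
    abs_of_pos (heatKernel_pos ht z)]

theorem integral_sq_mul_heatKernel {t : ℝ} (ht : 0 < t) : ∫ z, z ^ 2 * heatKernel t z = t := by
  have hv := ProbabilityTheory.variance_fun_id_gaussianReal (μ := 0) (v := t.toNNReal)
  rw [ProbabilityTheory.variance_eq_integral (by fun_prop),
    ProbabilityTheory.integral_id_gaussianReal,
    ProbabilityTheory.integral_gaussianReal_eq_integral_smul (by simpa using ht),
    ← heatKernel_eq_gaussianPDFReal ht, Real.coe_toNNReal _ ht.le] at hv
  simpa [mul_comm] using hv

theorem rpow_le_one_add_sq {u s : ℝ} (hu : 0 ≤ u) (hs : 0 ≤ s) (hs2 : s ≤ 2) :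
    u ^ s ≤ 1 + u ^ 2 := by
  rcases le_total u 1 with h | h
  · exact (Real.rpow_le_one hu h hs).trans (by nlinarith [sq_nonneg u])
  · have := Real.rpow_le_rpow_of_exponent_le h hs2
    rw [Real.rpow_two] at this
    linarith

/-- The absolute moments of the heat kernel of order `s ≤ 2`. -/
theorem integral_rpow_mul_heatKernel_le {t s : ℝ} (ht : 0 < t) (hs : 0 ≤ s) (hs2 : s ≤ 2) :
    Integrable (fun z => |z| ^ s * heatKernel t z) ∧
      ∫ z, |z| ^ s * heatKernel t z ≤ 2 * t ^ (s / 2) := by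
  have hb : ∀ z : ℝ, |z| ^ s * heatKernel t z ≤
      t ^ (s / 2) * (heatKernel t z + t⁻¹ * (z ^ 2 * heatKernel t z)) := fun z => by
    have h1 := rpow_le_one_add_sq (u := |z| / √t) (by positivity) hs hs2
    rw [Real.div_rpow (by positivity) (by positivity), div_pow, sq_abs, Real.sq_sqrt ht.le,
      Real.sqrt_eq_rpow, ← Real.rpow_mul ht.le, div_le_iff₀ (by positivity)] at h1
    have := mul_le_mul_of_nonneg_right h1 (heatKernel_pos ht z).le
    refine this.trans (le_of_eq ?_)
    rw [show 1 / 2 * s = s / 2 by ring, div_eq_inv_mul]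
    ring
  have hi : Integrable
      (fun z => t ^ (s / 2) * (heatKernel t z + t⁻¹ * (z ^ 2 * heatKernel t z))) :=
    ((integrable_heatKernel ht).add ((integrable_sq_mul_heatKernel ht).const_mul _)).const_mul _
  have h0 : ∀ z : ℝ, 0 ≤ |z| ^ s * heatKernel t z := fun z => by
    have := heatKernel_pos ht z
    positivity
  have hI : Integrable (fun z => |z| ^ s * heatKernel t z) := by
    refine hi.mono' ?_ (Eventually.of_forall fun z => ?_)
    · exact (Measurable.aestronglyMeasurable (by fun_prop)).mul
        (integrable_heatKernel ht).aestronglyMeasurable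
    · rw [Real.norm_eq_abs, abs_of_nonneg (h0 z)]
      exact hb z
  refine ⟨hI, (integral_mono hI hi hb).trans (le_of_eq ?_)⟩
  rw [integral_const_mul, integral_add (integrable_heatKernel ht)
    ((integrable_sq_mul_heatKernel ht).const_mul _), integral_const_mul, integral_heatKernel ht,
    integral_sq_mul_heatKernel ht, inv_mul_cancel₀ ht.ne']
  ring

theorem deriv_ofReal_heatKernel (t z : ℝ) :
    deriv (fun z => (heatKernel t z : ℂ)) z = ((-(t⁻¹ * z) * heatKernel t z : ℝ) : ℂ) := by
  refine HasDerivAt.deriv (HasDerivAt.ofReal_comp ?_)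
  have h2 : HasDerivAt (fun z : ℝ => -z ^ 2 / (2 * t)) (-(t⁻¹ * z)) z := by
    refine (((hasDerivAt_pow 2 z).neg).div_const (2 * t)).congr_deriv ?_
    rcases eq_or_ne t 0 with rfl | ht
    · simp
    · field_simp
      simp
  refine ((h2.exp).const_mul ((2 * Real.pi * t) ^ (-(1 / 2) : ℝ))).congr_deriv ?_
  unfold heatKernel
  ring

theorem norm_deriv_ofReal_heatKernel {t : ℝ} (ht : 0 < t) (z : ℝ) :
    ‖deriv (fun z => (heatKernel t z : ℂ)) z‖ = t⁻¹ * (|z| * heatKernel t z) := by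
  rw [deriv_ofReal_heatKernel, Complex.norm_real, Real.norm_eq_abs, abs_mul, abs_neg, abs_mul,
    abs_of_pos (heatKernel_pos ht z), abs_of_pos (inv_pos.2 ht), mul_assoc]

theorem integrable_deriv_heatKernel {t : ℝ} (ht : 0 < t) :
    Integrable (deriv fun z => (heatKernel t z : ℂ)) :=
  (heatKernelSchwartz t ht).integrable_deriv

theorem integral_norm_deriv_heatKernel_le {t : ℝ} (ht : 0 < t) :
    ∫ z, ‖deriv (fun z => (heatKernel t z : ℂ)) z‖ ≤ 2 * t ^ (-(1 / 2) : ℝ) := by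
  simp only [norm_deriv_ofReal_heatKernel ht]
  rw [integral_const_mul]
  have h := (integral_rpow_mul_heatKernel_le ht (s := 1) (by norm_num) (by norm_num)).2
  simp only [Real.rpow_one] at h
  calc _ ≤ t⁻¹ * (2 * t ^ (1 / 2 : ℝ)) := by gcongr
    _ = 2 * (t ^ (-1 : ℝ) * t ^ (1 / 2 : ℝ)) := by rw [Real.rpow_neg_one]; ring
    _ = _ := by rw [← Real.rpow_add ht]; norm_num

theorem integral_deriv_heatKernel (t : ℝ) :
    ∫ z, deriv (fun z => (heatKernel t z : ℂ)) z = 0 := by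
  have h := integral_neg_eq_self (fun z => deriv (fun z => (heatKernel t z : ℂ)) z) volume
  have e : ∀ z, deriv (fun z => (heatKernel t z : ℂ)) (-z) =
      -deriv (fun z => (heatKernel t z : ℂ)) z := fun z => by
    rw [deriv_ofReal_heatKernel, deriv_ofReal_heatKernel, heatKernel_neg]
    push_cast
    ring
  simp only [e, integral_neg] at h
  exact self_eq_neg.1 h.symm

/-- The semigroup property of the heat kernel, by completing the square. -/
theorem kconv_heatKernel {s t : ℝ} (hs : 0 < s) (ht : 0 < t) :
    kconv (fun z => (heatKernel s z : ℂ)) (fun z => (heatKernel t z : ℂ)) =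
      fun z => (heatKernel (s + t) z : ℂ) := by
  ext z
  have hst : 0 < s + t := add_pos hs ht
  set q : ℝ := s * t / (s + t) with hq
  have hq0 : 0 < q := by positivity
  have key : ∀ u, heatKernel s (z - u) * heatKernel t u =
      heatKernel (s + t) z * heatKernel q (u - t * z / (s + t)) := fun u => by
    unfold heatKernel
    rw [mul_mul_mul_comm, mul_mul_mul_comm (_ ^ _) _ (_ ^ _), ← Real.exp_add, ← Real.exp_add,
      ← Real.mul_rpow (by positivity) (by positivity),
      ← Real.mul_rpow (by positivity) (by positivity)]
    congr 2
    · rw [hq]; field_simp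
    · rw [hq]; field_simp; ring
  unfold kconv
  simp only [← Complex.ofReal_mul, key]
  rw [integral_complex_ofReal, integral_const_mul,
    integral_sub_right_eq_self (fun u => heatKernel q u), integral_heatKernel hq0, mul_one]

theorem norm_heat_le {t M : ℝ} {f : ℝ → ℂ} (ht : 0 < t) (hf : EssBdd f M) (x : ℝ) :
    ‖heat t f x‖ ≤ M := by
  refine (norm_kconv_le hf (integrable_ofReal_heatKernel ht) x).trans (le_of_eq ?_)
  have : ∀ z, ‖(heatKernel t z : ℂ)‖ = heatKernel t z := fun z => by
    rw [Complex.norm_real, Real.norm_eq_abs, abs_of_pos (heatKernel_pos ht z)]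
  simp only [this]
  rw [integral_heatKernel ht, one_mul]

theorem norm_heatD_le {t M : ℝ} {f : ℝ → ℂ} (ht : 0 < t) (hf : EssBdd f M) (x : ℝ) :
    ‖heatD t f x‖ ≤ 2 * M * t ^ (-(1 / 2) : ℝ) := by
  refine (norm_kconv_le hf (integrable_deriv_heatKernel ht) x).trans ?_
  have := mul_le_mul_of_nonneg_right (integral_norm_deriv_heatKernel_le ht) hf.nonneg
  linarith

theorem hasDerivAt_heat {t M : ℝ} {f : ℝ → ℂ} (ht : 0 < t) (hf : EssBdd f M) (x : ℝ) :
    HasDerivAt (heat t f) (heatD t f x) x :=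
  kconv_hasDerivAt (heatKernelSchwartz t ht) hf x

theorem continuous_heat {t M : ℝ} {f : ℝ → ℂ} (ht : 0 < t) (hf : EssBdd f M) :
    Continuous (heat t f) :=
  kconv_continuous (heatKernelSchwartz t ht) hf

theorem essBdd_heat {t M : ℝ} {f : ℝ → ℂ} (ht : 0 < t) (hf : EssBdd f M) :
    EssBdd (heat t f) M :=
  .of_continuous (continuous_heat ht hf) (norm_heat_le ht hf)

theorem continuous_heatD {t M : ℝ} {f : ℝ → ℂ} (ht : 0 < t) (hf : EssBdd f M) :
    Continuous (heatD t f) := by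
  have e : deriv (fun z => (heatKernel t z : ℂ)) =
      SchwartzMap.derivCLM ℂ ℂ (heatKernelSchwartz t ht) := by
    ext z
    rw [SchwartzMap.derivCLM_apply]
    rfl
  unfold heatD
  rw [e]
  exact kconv_continuous _ hf

theorem essBdd_heatD {t M : ℝ} {f : ℝ → ℂ} (ht : 0 < t) (hf : EssBdd f M) :
    EssBdd (heatD t f) (2 * M * t ^ (-(1 / 2) : ℝ)) :=
  .of_continuous (continuous_heatD ht hf) (norm_heatD_le ht hf)

theorem heat_heat {s t M : ℝ} {f : ℝ → ℂ} (hs : 0 < s) (ht : 0 < t) (hf : EssBdd f M) :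
    heat s (heat t f) = heat (s + t) f := by
  ext x
  unfold heat
  rw [kconv_assoc (integrable_ofReal_heatKernel hs) (integrable_ofReal_heatKernel ht) hf,
    kconv_heatKernel hs ht]

theorem heatD_heat {s t M : ℝ} {f : ℝ → ℂ} (hs : 0 < s) (ht : 0 < t) (hf : EssBdd f M) :
    heatD s (heat t f) = heatD (s + t) f := by
  ext x
  have h := hasDerivAt_heat hs (essBdd_heat ht hf) x
  rw [heat_heat hs ht hf] at h
  exact h.unique (hasDerivAt_heat (add_pos hs ht) hf x)

theorem hasDerivAt_heat_right {t M M' : ℝ} {g g' : ℝ → ℂ} (ht : 0 < t) (hg : EssBdd g M)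
    (hd : ∀ x, HasDerivAt g (g' x) x) (hM' : ∀ x, ‖g' x‖ ≤ M') (x : ℝ) :
    HasDerivAt (heat t g) (heat t g' x) x :=
  kconv_hasDerivAt_right (integrable_ofReal_heatKernel ht) hg hd hM' x

theorem heat_heatD {s t M : ℝ} {f : ℝ → ℂ} (hs : 0 < s) (ht : 0 < t) (hf : EssBdd f M) :
    heat s (heatD t f) = heatD (s + t) f := by
  ext x
  have h := hasDerivAt_heat_right hs (essBdd_heat ht hf) (hasDerivAt_heat ht hf)
    (norm_heatD_le ht hf) x
  rw [heat_heat hs ht hf] at h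
  exact h.unique (hasDerivAt_heat (add_pos hs ht) hf x)

theorem heat_sub {t M M' : ℝ} {f g : ℝ → ℂ} (ht : 0 < t) (hf : EssBdd f M) (hg : EssBdd g M')
    (x : ℝ) : heat t (fun y => f y - g y) x = heat t f x - heat t g x := by
  have hk := (integrable_ofReal_heatKernel ht).comp_sub_left x
  simp only [heat, kconv, mul_sub]
  exact integral_sub (hf.integrable_mul hk) (hg.integrable_mul hk)

/-! ### Heat semigroup estimates for Hölder functions -/

theorem HolderBd.heat {t a H M : ℝ} {f : ℝ → ℂ} (ht : 0 < t) (hf : EssBdd f M)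
    (hH : HolderBd a H f) : HolderBd a H (heat t f) := by
  intro x y
  have hk := integrable_ofReal_heatKernel ht
  have hi : ∀ x : ℝ, Integrable fun z => (heatKernel t z : ℂ) * f (x - z) := fun x => by
    simpa using (hf.integrable_mul (hk.comp_sub_left x)).comp_sub_left x
  rw [_root_.heat, kconv_eq_integral, kconv_eq_integral, ← integral_sub (hi x) (hi y)]
  have : H * |x - y| ^ a = ∫ z, heatKernel t z * (H * |x - y| ^ a) := by
    rw [integral_mul_const, integral_heatKernel ht, one_mul]
  rw [this]
  refine norm_integral_le_of_norm_le ((integrable_heatKernel ht).mul_const _)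
    (Eventually.of_forall fun z => ?_)
  rw [← mul_sub, norm_mul, Complex.norm_real, Real.norm_eq_abs, abs_of_pos (heatKernel_pos ht z)]
  have h := hH (x - z) (y - z)
  rw [sub_sub_sub_cancel_right] at h
  exact mul_le_mul_of_nonneg_left h (heatKernel_pos ht z).le

theorem norm_heat_sub_self_le {t a H M : ℝ} {f : ℝ → ℂ} (ht : 0 < t) (ha : 0 ≤ a) (ha2 : a ≤ 2)
    (hf : EssBdd f M) (hH : HolderBd a H f) (x : ℝ) :
    ‖heat t f x - f x‖ ≤ 2 * H * t ^ (a / 2) := by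
  have hk := integrable_ofReal_heatKernel ht
  have hi : Integrable fun z => (heatKernel t z : ℂ) * f (x - z) := by
    simpa using (hf.integrable_mul (hk.comp_sub_left x)).comp_sub_left x
  obtain ⟨h1, h2⟩ := integral_rpow_mul_heatKernel_le ht ha ha2
  have hH0 : 0 ≤ H := by
    have := (norm_nonneg _).trans (hH 1 0)
    simpa using this
  have e : heat t f x - f x = ∫ z, (heatKernel t z : ℂ) * (f (x - z) - f x) := by
    simp only [mul_sub]
    rw [integral_sub hi (hk.mul_const _), integral_mul_const, integral_ofReal_heatKernel ht,
      one_mul, heat, kconv_eq_integral]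
  rw [e]
  calc _ ≤ ∫ z, H * (|z| ^ a * heatKernel t z) := by
        refine norm_integral_le_of_norm_le (h1.const_mul _) (Eventually.of_forall fun z => ?_)
        rw [norm_mul, Complex.norm_real, Real.norm_eq_abs, abs_of_pos (heatKernel_pos ht z)]
        have h := mul_le_mul_of_nonneg_left (hH (x - z) x) (heatKernel_pos ht z).le
        rw [sub_sub_cancel_left, abs_neg] at h
        linarith
    _ ≤ _ := by
        rw [integral_const_mul]
        have := mul_le_mul_of_nonneg_left h2 hH0
        linarith

theorem norm_heatD_le_of_holder {t a H M : ℝ} {f : ℝ → ℂ} (ht : 0 < t) (ha : 0 ≤ a) (ha1 : a ≤ 1)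
    (hf : EssBdd f M) (hH : HolderBd a H f) (x : ℝ) :
    ‖heatD t f x‖ ≤ 2 * H * t ^ ((a - 1) / 2) := by
  have hk := integrable_deriv_heatKernel ht
  have hi : Integrable fun z => deriv (fun z => (heatKernel t z : ℂ)) z * f (x - z) := by
    simpa using (hf.integrable_mul (hk.comp_sub_left x)).comp_sub_left x
  obtain ⟨h1, h2⟩ := integral_rpow_mul_heatKernel_le ht (s := 1 + a) (by linarith) (by linarith)
  have hH0 : 0 ≤ H := by
    have := (norm_nonneg _).trans (hH 1 0)
    simpa using this
  have e : heatD t f x =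
      ∫ z, deriv (fun z => (heatKernel t z : ℂ)) z * (f (x - z) - f x) := by
    simp only [mul_sub]
    rw [integral_sub hi (hk.mul_const _), integral_mul_const, integral_deriv_heatKernel,
      zero_mul, sub_zero, heatD, kconv_eq_integral]
  rw [e]
  calc _ ≤ ∫ z, H * t⁻¹ * (|z| ^ (1 + a) * heatKernel t z) := by
        refine norm_integral_le_of_norm_le (h1.const_mul _) (Eventually.of_forall fun z => ?_)
        rw [norm_mul, norm_deriv_ofReal_heatKernel ht]
        have hp := heatKernel_pos ht z
        have h := mul_le_mul_of_nonneg_left (hH (x - z) x)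
          (show 0 ≤ t⁻¹ * (|z| * heatKernel t z) by positivity)
        rw [sub_sub_cancel_left, abs_neg] at h
        refine h.trans (le_of_eq ?_)
        rcases eq_or_ne z 0 with rfl | hz
        · simp [Real.zero_rpow (show 1 + a ≠ 0 by linarith)]
        · rw [Real.rpow_add (abs_pos.2 hz), Real.rpow_one]
          ring
    _ ≤ H * t⁻¹ * (2 * t ^ ((1 + a) / 2)) := by
        rw [integral_const_mul]
        gcongr
    _ = 2 * H * (t ^ (-1 : ℝ) * t ^ ((1 + a) / 2)) := by rw [Real.rpow_neg_one]; ring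
    _ = _ := by rw [← Real.rpow_add ht]; ring_nf

theorem HolderBd.of_hasDerivAt {f f' : ℝ → ℂ} {C : ℝ} (h : ∀ x, HasDerivAt f (f' x) x)
    (hC : ∀ x, ‖f' x‖ ≤ C) : HolderBd 1 C f := by
  intro x y
  rw [Real.rpow_one, ← Real.norm_eq_abs]
  exact Convex.norm_image_sub_le_of_norm_hasDerivWithin_le (s := Set.univ)
    (fun x _ => (h x).hasDerivWithinAt) (fun x _ => hC x) convex_univ (mem_univ _) (mem_univ _)

/-- Interpolation between a bound of the increments and a Lipschitz bound. -/
theorem min_le_interp {a b A B θ : ℝ} (hθ0 : 0 ≤ θ) (hθ1 : θ ≤ 1) (hA : 0 ≤ A)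
    (ha0 : 0 ≤ a) (ha : a ≤ A) (hb : a ≤ B * b) (hB : 0 ≤ B) (hb0 : 0 ≤ b) :
    a ≤ A ^ (1 - θ) * B ^ θ * b ^ θ := by
  calc a = a ^ (1 - θ) * a ^ θ := by
        rcases eq_or_lt_of_le ha0 with rfl | h
        · rcases eq_or_ne θ 0 with rfl | h0
          · simp
          · simp [Real.zero_rpow h0]
        · rw [← Real.rpow_add h]; simp
    _ ≤ A ^ (1 - θ) * (B * b) ^ θ :=
        mul_le_mul (Real.rpow_le_rpow ha0 ha (by linarith)) (Real.rpow_le_rpow ha0 hb hθ0)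
          (by positivity) (by positivity)
    _ = _ := by rw [Real.mul_rpow hB hb0]; ring

theorem HolderBd.interp {f : ℝ → ℂ} {A B θ : ℝ} (hθ0 : 0 ≤ θ) (hθ1 : θ ≤ 1)
    (hA : ∀ x, ‖f x‖ ≤ A) (hB : HolderBd 1 B f) :
    HolderBd θ ((2 * A) ^ (1 - θ) * B ^ θ) f := by
  intro x y
  have hA0 : 0 ≤ A := (norm_nonneg _).trans (hA 0)
  have hB0 : 0 ≤ B := by simpa using (norm_nonneg _).trans (hB 1 0)
  refine min_le_interp hθ0 hθ1 (by linarith) (norm_nonneg _) ?_ (by simpa using hB x y) hB0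
    (abs_nonneg _)
  exact (norm_sub_le _ _).trans (by linarith [hA x, hA y])

theorem HolderBd.nonneg {f : ℝ → ℂ} {a H : ℝ} (h : HolderBd a H f) : 0 ≤ H := by
  simpa using (norm_nonneg _).trans (h 1 0)

theorem HolderBd.mul {f g : ℝ → ℂ} {a H H' M M' : ℝ} (hf : ∀ x, ‖f x‖ ≤ M) (hg : ∀ x, ‖g x‖ ≤ M')
    (hfH : HolderBd a H f) (hgH : HolderBd a H' g) :
    HolderBd a (M * H' + H * M') (fun x => f x * g x) := by
  intro x y
  have e : f x * g x - f y * g y = f x * (g x - g y) + (f x - f y) * g y := by ring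
  have h0 : 0 ≤ |x - y| ^ a := by positivity
  dsimp only
  rw [e]
  calc _ ≤ ‖f x‖ * ‖g x - g y‖ + ‖f x - f y‖ * ‖g y‖ := by
        refine (norm_add_le _ _).trans ?_
        rw [norm_mul, norm_mul]
    _ ≤ M * (H' * |x - y| ^ a) + H * |x - y| ^ a * M' := by
        have := hfH.nonneg
        have := (norm_nonneg _).trans (hf 0)
        gcongr
        exacts [hf x, hgH x y, hfH x y, hg y]
    _ = _ := by ring

/-- For Lipschitz functions the heat semigroup at time `h` is multiplicative up to `O(h)`: it is
the expectation of a Gaussian of variance `h`, and the error is a covariance. -/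
theorem norm_heat_mul_sub_le {h A B M M' : ℝ} {f g : ℝ → ℂ} (hh : 0 < h) (hf : EssBdd f M)
    (hg : EssBdd g M') (hA : HolderBd 1 A f) (hB : HolderBd 1 B g) (x : ℝ) :
    ‖heat h (fun y => f y * g y) x - heat h f x * heat h g x‖ ≤ 6 * h * A * B := by
  have hk := integrable_ofReal_heatKernel hh
  have hi : ∀ {f : ℝ → ℂ} {M : ℝ}, EssBdd f M →
      Integrable fun z => (heatKernel h z : ℂ) * f (x - z) := fun hf => by
    simpa using (hf.integrable_mul (hk.comp_sub_left x)).comp_sub_left x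
  have hfg : EssBdd (fun y => f y * g y) (M * M') := by
    refine ⟨hf.meas.mul hg.meas, ?_⟩
    filter_upwards [hf.bdd, hg.bdd] with y h1 h2
    rw [norm_mul]
    exact mul_le_mul h1 h2 (norm_nonneg _) hf.nonneg
  have e : heat h (fun y => f y * g y) x - heat h f x * heat h g x =
      (∫ z, (heatKernel h z : ℂ) * ((f (x - z) - f x) * (g (x - z) - g x))) -
        (heat h f x - f x) * (heat h g x - g x) := by
    have e1 : ∀ z, (heatKernel h z : ℂ) * ((f (x - z) - f x) * (g (x - z) - g x)) =
        (heatKernel h z : ℂ) * (f (x - z) * g (x - z)) - (heatKernel h z : ℂ) * f (x - z) * g x -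
        (heatKernel h z : ℂ) * g (x - z) * f x + (heatKernel h z : ℂ) * (f x * g x) := fun z => by
      ring
    simp only [e1]
    have i1 := hi hfg
    have i2 := (hi hf).mul_const (g x)
    have i3 := (hi hg).mul_const (f x)
    have i12 : Integrable fun z => (heatKernel h z : ℂ) * (f (x - z) * g (x - z)) -
        (heatKernel h z : ℂ) * f (x - z) * g x := i1.sub i2
    have i123 : Integrable fun z => (heatKernel h z : ℂ) * (f (x - z) * g (x - z)) -
        (heatKernel h z : ℂ) * f (x - z) * g x - (heatKernel h z : ℂ) * g (x - z) * f x :=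
      i12.sub i3
    rw [integral_add i123 (hk.mul_const _), integral_sub i12 i3,
      integral_sub i1 i2, integral_mul_const, integral_mul_const,
      integral_mul_const, integral_ofReal_heatKernel hh]
    simp only [heat, kconv_eq_integral]
    ring
  have h1 := norm_heat_sub_self_le hh zero_le_one one_le_two hf hA x
  have h2 := norm_heat_sub_self_le hh zero_le_one one_le_two hg hB x
  have hA0 := hA.nonneg
  have hB0 := hB.nonneg
  have h3 : ‖∫ z, (heatKernel h z : ℂ) * ((f (x - z) - f x) * (g (x - z) - g x))‖ ≤
      A * B * h := by
    rw [← integral_sq_mul_heatKernel hh, ← integral_const_mul]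
    rw [integral_sq_mul_heatKernel hh]
    refine norm_integral_le_of_norm_le ((integrable_sq_mul_heatKernel hh).const_mul _)
      (Eventually.of_forall fun z => ?_)
    rw [norm_mul, norm_mul, Complex.norm_real, Real.norm_eq_abs, abs_of_pos (heatKernel_pos hh z)]
    have ha := hA (x - z) x
    have hb := hB (x - z) x
    rw [sub_sub_cancel_left, abs_neg, Real.rpow_one] at ha hb
    have := mul_le_mul ha hb (norm_nonneg _) (by positivity)
    have := mul_le_mul_of_nonneg_left this (heatKernel_pos hh z).le
    refine this.trans (le_of_eq ?_)
    rw [← sq_abs]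
    ring
  have h4 : ‖(heat h f x - f x) * (heat h g x - g x)‖ ≤ 4 * h * A * B := by
    rw [norm_mul]
    refine (mul_le_mul h1 h2 (norm_nonneg _) (by positivity)).trans (le_of_eq ?_)
    have : h ^ (1 / 2 : ℝ) * h ^ (1 / 2 : ℝ) = h := by
      rw [← Real.rpow_add hh]
      norm_num
    linear_combination (4 * A * B) * this
  rw [e]
  refine (norm_sub_le _ _).trans ?_
  have : 0 ≤ h * A * B := by positivity
  linarith

theorem EssBdd.mul {f g : ℝ → ℂ} {M M' : ℝ} (hf : EssBdd f M) (hg : EssBdd g M') :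
    EssBdd (fun y => f y * g y) (M * M') := by
  refine ⟨hf.meas.mul hg.meas, ?_⟩
  filter_upwards [hf.bdd, hg.bdd] with y h1 h2
  rw [norm_mul]
  exact mul_le_mul h1 h2 (norm_nonneg _) hf.nonneg

theorem half_rpow_neg_le {r p k : ℝ} (hr : 0 < r) (hp : p ≤ k) :
    (r / 2) ^ (-p) ≤ 2 ^ k * r ^ (-p) := by
  rw [Real.div_rpow hr.le (by norm_num), Real.rpow_neg (by norm_num : (0 : ℝ) ≤ 2), div_inv_eq_mul,
    mul_comm]
  gcongr
  norm_num

theorem mul_rpow_interp {A r p q θ : ℝ} (hA : 0 ≤ A) (hr : 0 < r) (h0 : 0 ≤ θ) (h1 : θ ≤ 1) :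
    (A * r ^ p) ^ (1 - θ) * (A * r ^ q) ^ θ = A * r ^ (p * (1 - θ) + q * θ) := by
  have e : A = A ^ (1 - θ) * A ^ θ := by
    rw [← Real.rpow_add_of_nonneg hA (by linarith) h0, sub_add_cancel, Real.rpow_one]
  rw [Real.mul_rpow hA (by positivity), Real.mul_rpow hA (by positivity), ← Real.rpow_mul hr.le,
    ← Real.rpow_mul hr.le, Real.rpow_add hr]
  nth_rw 3 [e]
  ring

/-! ### The product of a Hölder function and a distribution of negative regularity

The negative regularity `-c` of a bounded function `d` is measured by the size of `P_s d` for small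
`s`. -/

/-- Half of the time is spent on the regularity of `g`, half on the derivative. -/
theorem heatD_le_of_heat_le {T c P M : ℝ} {g : ℝ → ℂ} (hg : EssBdd g M) (hc1 : c ≤ 1)
    (hP : ∀ s ∈ Ioc 0 T, ∀ x, ‖heat s g x‖ ≤ P * s ^ (-(c / 2))) {r : ℝ} (hr : r ∈ Ioc 0 T)
    (x : ℝ) : ‖heatD r g x‖ ≤ 4 * P * r ^ (-((c + 1) / 2)) := by
  obtain ⟨hr0, hrT⟩ := hr
  have h2 : 0 < r / 2 := by linarith
  have hb : EssBdd (heat (r / 2) g) (P * (r / 2) ^ (-(c / 2))) :=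
    .of_continuous (continuous_heat h2 hg) (hP _ ⟨h2, by linarith⟩)
  have h := norm_heatD_le h2 hb x
  rw [heatD_heat h2 h2 hg, add_halves] at h
  have hP0 : 0 ≤ P := by
    have := hb.nonneg
    exact nonneg_of_mul_nonneg_left this (by positivity)
  refine h.trans ?_
  have e : (r / 2) ^ (-(c / 2)) * (r / 2) ^ (-(1 / 2) : ℝ) = (r / 2) ^ (-((c + 1) / 2)) := by
    rw [← Real.rpow_add h2]
    ring_nf
  have h3 := half_rpow_neg_le (k := 1) hr0 (show (c + 1) / 2 ≤ 1 by linarith)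
  rw [Real.rpow_one] at h3
  calc _ = 2 * P * ((r / 2) ^ (-(c / 2)) * (r / 2) ^ (-(1 / 2) : ℝ)) := by ring
    _ ≤ 2 * P * (2 * r ^ (-((c + 1) / 2))) := by rw [e]; gcongr
    _ = _ := by ring

theorem heatD_holder_of_heat_le {T a c P M : ℝ} {g : ℝ → ℂ} (hg : EssBdd g M) (hc1 : c ≤ 1)
    (ha0 : 0 ≤ a) (ha1 : a ≤ 1)
    (hP : ∀ s ∈ Ioc 0 T, ∀ x, ‖heat s g x‖ ≤ P * s ^ (-(c / 2))) {r : ℝ} (hr : r ∈ Ioc 0 T) :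
    HolderBd a (32 * P * r ^ (-((1 + a + c) / 2))) (heatD r g) := by
  have hb := heatD_le_of_heat_le hg hc1 hP hr
  obtain ⟨hr0, hrT⟩ := hr
  have h2 : 0 < r / 2 := by linarith
  have hP0 : 0 ≤ P := nonneg_of_mul_nonneg_left
    ((norm_nonneg _).trans (hP r ⟨hr0, hrT⟩ 0)) (by positivity)
  have hb2 : EssBdd (heatD (r / 2) g) (4 * P * (r / 2) ^ (-((c + 1) / 2))) :=
    .of_continuous (continuous_heatD h2 hg) (heatD_le_of_heat_le hg hc1 hP ⟨h2, by linarith⟩)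
  have hlip : HolderBd 1 (32 * P * r ^ (-((c + 2) / 2))) (heatD r g) := by
    have e : heatD r g = heat (r / 2) (heatD (r / 2) g) := by
      rw [heat_heatD h2 h2 hg, add_halves]
    rw [e]
    refine HolderBd.of_hasDerivAt (hasDerivAt_heat h2 hb2) fun x =>
      (norm_heatD_le h2 hb2 x).trans ?_
    have e : (r / 2) ^ (-((c + 1) / 2)) * (r / 2) ^ (-(1 / 2) : ℝ) = (r / 2) ^ (-((c + 2) / 2)) := by
      rw [← Real.rpow_add h2]
      ring_nf
    have h3 := half_rpow_neg_le (k := 2) hr0 (show (c + 2) / 2 ≤ 2 by linarith)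
    rw [show (2 : ℝ) ^ (2 : ℝ) = 4 by norm_num] at h3
    calc _ = 8 * P * ((r / 2) ^ (-((c + 1) / 2)) * (r / 2) ^ (-(1 / 2) : ℝ)) := by ring
      _ ≤ 8 * P * (4 * r ^ (-((c + 2) / 2))) := by rw [e]; gcongr
      _ = _ := by ring
  intro x y
  refine (HolderBd.interp ha0 ha1 hb hlip x y).trans ?_
  refine mul_le_mul_of_nonneg_right ?_ (by positivity)
  calc _ ≤ (32 * P * r ^ (-((c + 1) / 2))) ^ (1 - a) * (32 * P * r ^ (-((c + 2) / 2))) ^ a := by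
        refine mul_le_mul_of_nonneg_right (Real.rpow_le_rpow (by positivity) ?_ (by linarith))
          (by positivity)
        have : 0 ≤ P * r ^ (-((c + 1) / 2)) := by positivity
        linarith
    _ = _ := by
        rw [mul_rpow_interp (by positivity) hr0 ha0 ha1]
        ring_nf

/-- The product estimate. Up to the covariance errors of the scales `r/2, r/4, …`, which are
summable because `a > c`, the function `P_r (f d)` equals `P_r f · P_r d`. -/
theorem norm_heat_mul_le {T a c : ℝ} (hT : 0 < T) (hc : 0 < c) (hca : c < a) (ha1 : a ≤ 1) :
    ∃ C : ℝ, 0 ≤ C ∧ ∀ (f d : ℝ → ℂ) (m K M Λ : ℝ), Continuous f → (∀ x, ‖f x‖ ≤ m) →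
      HolderBd a m f → Continuous d → (∀ x, ‖d x‖ ≤ M) → HolderBd 1 Λ d →
      (∀ s ∈ Ioc 0 T, ∀ x, ‖heat s d x‖ ≤ K * s ^ (-(c / 2))) →
      ∀ r ∈ Ioc 0 T, ∀ x, ‖heat r (fun y => f y * d y) x‖ ≤ C * m * K * r ^ (-(c / 2)) := by
  set κ : ℝ := (a - c) / 2 with hκ
  have hκ0 : 0 < κ := by rw [hκ]; linarith
  set q : ℝ := 2 ^ (-κ) with hq
  have hq0 : 0 < q := by positivity
  have hq1 : q < 1 := Real.rpow_lt_one_of_one_lt_of_neg one_lt_two (by linarith)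
  have hq1' : 0 < 1 - q := by linarith
  refine ⟨48 * (q / (1 - q)) * T ^ (a / 2) + 1, by positivity, ?_⟩
  intro f d m K M Λ hf hfm hfH hd hdM hdL hK
  have hm0 : 0 ≤ m := hfH.nonneg
  have hK0 : 0 ≤ K := nonneg_of_mul_nonneg_left
    ((norm_nonneg _).trans (hK T ⟨hT, le_rfl⟩ 0)) (by positivity)
  have hM0 : 0 ≤ M := (norm_nonneg _).trans (hdM 0)
  have hfE : EssBdd f m := .of_continuous hf hfm
  have hdE : EssBdd d M := .of_continuous hd hdM
  have hfdE := hfE.mul hdE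
  -- a qualitative bound, with `Q` depending on the smoothness of `d`; it starts the recursion below
  obtain ⟨Q, hQ⟩ : ∃ Q : ℝ, ∀ r, 0 < r → ∀ x,
      ‖heat r (fun y => f y * d y) x - heat r f x * heat r d x‖ ≤ Q * r ^ (a / 2) := by
    have hdH := hdL.interp (θ := a) (by linarith) ha1 hdM
    set Λ' := (2 * M) ^ (1 - a) * Λ ^ a
    have hfdH := HolderBd.mul hfm hdM hfH hdH
    refine ⟨2 * (m * Λ' + m * M) + m * (2 * Λ') + (2 * m) * M, fun r hr x => ?_⟩
    have h1 := norm_heat_sub_self_le hr (by linarith) (by linarith) hfdE hfdH x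
    have h2 := norm_heat_sub_self_le hr (by linarith) (by linarith) hfE hfH x
    have h3 := norm_heat_sub_self_le hr (by linarith) (by linarith) hdE hdH x
    have e : heat r (fun y => f y * d y) x - heat r f x * heat r d x =
        (heat r (fun y => f y * d y) x - f x * d x) - heat r f x * (heat r d x - d x)
          - (heat r f x - f x) * d x := by ring
    rw [e]
    have h4 : ‖heat r f x * (heat r d x - d x)‖ ≤ m * (2 * Λ' * r ^ (a / 2)) := by
      rw [norm_mul]
      exact mul_le_mul (norm_heat_le hr hfE x) h3 (norm_nonneg _) hm0
    have h5 : ‖(heat r f x - f x) * d x‖ ≤ 2 * m * r ^ (a / 2) * M := by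
      rw [norm_mul]
      exact mul_le_mul h2 (hdM x) (norm_nonneg _) (by positivity)
    refine (norm_sub_le _ _).trans ?_
    refine (add_le_add_left (norm_sub_le _ _) _).trans ?_
    linarith
  -- passing from the scale `h` to the scale `2h`
  have hstep : ∀ (h B : ℝ), 0 < h → h ≤ T →
      (∀ x, ‖heat h (fun y => f y * d y) x - heat h f x * heat h d x‖ ≤ B) →
      ∀ x, ‖heat (h + h) (fun y => f y * d y) x - heat (h + h) f x * heat (h + h) d x‖ ≤
        B + 48 * m * K * h ^ κ := by
    intro h B hh hhT hB x
    have hF := essBdd_heat hh hfE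
    have hG := essBdd_heat hh hdE
    have hFL : HolderBd 1 (2 * m * h ^ ((a - 1) / 2)) (heat h f) :=
      HolderBd.of_hasDerivAt (hasDerivAt_heat hh hfE)
        (norm_heatD_le_of_holder hh (by linarith) ha1 hfE hfH)
    have hGL : HolderBd 1 (4 * K * h ^ (-((c + 1) / 2))) (heat h d) :=
      HolderBd.of_hasDerivAt (hasDerivAt_heat hh hdE)
        (heatD_le_of_heat_le hdE (by linarith) hK ⟨hh, hhT⟩)
    have h1 := norm_heat_mul_sub_le hh hF hG hFL hGL x
    have hE : EssBdd (fun y => heat h (fun y => f y * d y) y - heat h f y * heat h d y) B :=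
      .of_continuous ((continuous_heat hh hfdE).sub
        ((continuous_heat hh hfE).mul (continuous_heat hh hdE))) hB
    have h2 := norm_heat_le hh hE x
    rw [heat_sub hh (essBdd_heat hh hfdE) (hF.mul hG) x, heat_heat hh hh hfdE] at h2
    rw [heat_heat hh hh hfE, heat_heat hh hh hdE] at h1
    have e : 6 * h * (2 * m * h ^ ((a - 1) / 2)) * (4 * K * h ^ (-((c + 1) / 2))) =
        48 * m * K * h ^ κ := by
      have : h ^ (1 : ℝ) * h ^ ((a - 1) / 2) * h ^ (-((c + 1) / 2)) = h ^ κ := by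
        rw [← Real.rpow_add hh, ← Real.rpow_add hh, hκ]
        ring_nf
      rw [Real.rpow_one] at this
      linear_combination (48 * m * K) * this
    rw [e] at h1
    have := norm_add_le (heat (h + h) (fun y => f y * d y) x -
      heat h (fun y => heat h f y * heat h d y) x)
      (heat h (fun y => heat h f y * heat h d y) x - heat (h + h) f x * heat (h + h) d x)
    rw [sub_add_sub_cancel] at this
    linarith
  -- `B` sums the errors of the scales below `r`; the contribution of `Q` disappears as `n → ∞`
  set B : ℝ := 48 * m * K * (q / (1 - q)) with hB
  have hind : ∀ n : ℕ, ∀ r ∈ Ioc 0 T, ∀ x,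
      ‖heat r (fun y => f y * d y) x - heat r f x * heat r d x‖ ≤
        B * r ^ κ + Q * (r / 2 ^ n) ^ (a / 2) := by
    intro n
    induction n with
    | zero =>
      intro r hr x
      have := hQ r hr.1 x
      have h0 : 0 ≤ B * r ^ κ := by have := hr.1; positivity
      simpa using this.trans (le_add_of_nonneg_left h0)
    | succ n ih =>
      intro r hr x
      have hr2 : 0 < r / 2 := half_pos hr.1
      have := hstep (r / 2) _ hr2 (by linarith [hr.2]) (ih (r / 2) ⟨hr2, by linarith [hr.2]⟩) x
      rw [add_halves] at this
      refine this.trans (le_of_eq ?_)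
      have e1 : r / 2 / 2 ^ n = r / 2 ^ (n + 1) := by rw [pow_succ]; field_simp
      have e2 : (r / 2) ^ κ = q * r ^ κ := by
        rw [Real.div_rpow hr.1.le (by norm_num), hq, Real.rpow_neg (by norm_num)]
        ring
      rw [e1, e2, hB]
      field_simp
      ring
  intro r hr x
  have hlim : ‖heat r (fun y => f y * d y) x - heat r f x * heat r d x‖ ≤ B * r ^ κ := by
    have hz : Tendsto (fun n : ℕ => r / 2 ^ n) atTop (𝓝 0) :=
      tendsto_const_nhds.div_atTop (tendsto_pow_atTop_atTop_of_one_lt one_lt_two)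
    have hz2 := hz.rpow_const (p := a / 2) (Or.inr (by linarith))
    rw [Real.zero_rpow (by linarith)] at hz2
    have := (hz2.const_mul Q).const_add (B * r ^ κ)
    rw [mul_zero, add_zero] at this
    exact ge_of_tendsto' this fun n => hind n r hr x
  have hr0 := hr.1
  have h1 : r ^ κ ≤ T ^ (a / 2) * r ^ (-(c / 2)) := by
    have : r ^ κ = r ^ (a / 2) * r ^ (-(c / 2)) := by
      rw [← Real.rpow_add hr0, hκ]; ring_nf
    rw [this]
    gcongr
    · linarith
    · exact hr.2
  have h2 : ‖heat r f x * heat r d x‖ ≤ m * (K * r ^ (-(c / 2))) := by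
    rw [norm_mul]
    exact mul_le_mul (norm_heat_le hr0 hfE x) (hK r hr x) (norm_nonneg _) hm0
  have h3 := norm_add_le (heat r (fun y => f y * d y) x - heat r f x * heat r d x)
    (heat r f x * heat r d x)
  rw [sub_add_cancel] at h3
  have h4 : B * r ^ κ ≤ B * (T ^ (a / 2) * r ^ (-(c / 2))) := by gcongr
  calc _ ≤ B * (T ^ (a / 2) * r ^ (-(c / 2))) + m * (K * r ^ (-(c / 2))) := by linarith
    _ = _ := by rw [hB]; ring

/-! ### The a priori Hölder bound for the Duhamel formula -/

theorem intervalIntegrable_sub_rpow {θ : ℝ} (hθ : θ < 1) (t : ℝ) :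
    IntervalIntegrable (fun s => (t - s) ^ (-θ)) volume 0 t := by
  have h := (intervalIntegral.intervalIntegrable_rpow' (a := 0) (b := t)
    (show (-1 : ℝ) < -θ by linarith)).comp_sub_left t
  simpa using h.symm

/-- The weight `e^{λs}` with a large `λ` absorbs an integrable singularity. -/
theorem exists_exp_weight {θ C : ℝ} (hθ : θ < 1) (hC : 0 ≤ C) :
    ∃ l : ℝ, 0 < l ∧ ∀ t : ℝ, 0 ≤ t →
      C * ∫ s in (0 : ℝ)..t, Real.exp (l * s) * (t - s) ^ (-θ) ≤ Real.exp (l * t) / 2 := by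
  have hp : 0 < 1 - θ := by linarith
  have hG := Real.Gamma_pos_of_pos hp
  have hlim : Tendsto (fun l : ℝ => C * (l ^ (-(1 - θ)) * Real.Gamma (1 - θ))) atTop (𝓝 0) := by
    have := ((tendsto_rpow_neg_atTop hp).mul_const (Real.Gamma (1 - θ))).const_mul C
    simpa using this
  obtain ⟨l, hl, hl0⟩ := ((hlim.eventually (ge_mem_nhds (show (0 : ℝ) < 1 / 2 by norm_num))).and
    (eventually_gt_atTop 0)).exists
  refine ⟨l, hl0, fun t ht => ?_⟩
  have hval := Real.integral_rpow_mul_exp_neg_mul_Ioi hp hl0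
  have hint : IntegrableOn (fun u : ℝ => u ^ (1 - θ - 1) * Real.exp (-(l * u))) (Ioi 0) := by
    refine Integrable.of_integral_ne_zero ?_
    rw [hval]
    positivity
  have h1 : ∫ s in (0 : ℝ)..t, Real.exp (l * s) * (t - s) ^ (-θ) =
      Real.exp (l * t) * ∫ u in (0 : ℝ)..t, u ^ (1 - θ - 1) * Real.exp (-(l * u)) := by
    have := intervalIntegral.integral_comp_sub_left (a := 0) (b := t)
      (fun u => Real.exp (l * t) * (u ^ (1 - θ - 1) * Real.exp (-(l * u)))) t
    rw [sub_self, sub_zero] at this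
    rw [← intervalIntegral.integral_const_mul, ← this]
    refine intervalIntegral.integral_congr fun s _ => ?_
    rw [mul_left_comm, ← Real.exp_add, mul_comm, show 1 - θ - 1 = -θ by ring]
    congr 2
    ring
  have h2 : ∫ u in (0 : ℝ)..t, u ^ (1 - θ - 1) * Real.exp (-(l * u)) ≤
      l ^ (-(1 - θ)) * Real.Gamma (1 - θ) := by
    have e : l ^ (-(1 - θ)) = (1 / l) ^ (1 - θ) := by
      rw [one_div, Real.inv_rpow hl0.le, Real.rpow_neg hl0.le]
    rw [intervalIntegral.integral_of_le ht, e, ← hval]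
    refine setIntegral_mono_set hint ?_ Ioc_subset_Ioi_self.eventuallyLE
    filter_upwards [ae_restrict_mem measurableSet_Ioi] with u hu
    have : (0 : ℝ) < u := hu
    change 0 ≤ u ^ (1 - θ - 1) * Real.exp (-(l * u))
    positivity
  rw [h1]
  calc _ ≤ Real.exp (l * t) * (C * (l ^ (-(1 - θ)) * Real.Gamma (1 - θ))) := by
        rw [mul_left_comm]
        gcongr
    _ ≤ Real.exp (l * t) * (1 / 2) := by gcongr
    _ = _ := by ring

/-- The a priori bound: if `r` solves the Duhamel equation with the source `f d`, where `f` is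
controlled by `r` and `d` is of negative regularity `-c > -a`, then the `a`-Hölder norm of `r` is
controlled by that of the initial value. The constant depends on `d` only through its negative
regularity. -/
theorem exists_holder_apriori {T a c L K : ℝ} (hT : 0 < T) (hc : 0 < c) (hca : c < a)
    (ha : a < 1 / 2) (hL : 0 ≤ L) (hK0 : 0 ≤ K) :
    ∃ C : ℝ, 0 ≤ C ∧ ∀ (r f d : ℝ → ℝ → ℂ) (R M Λ m₀ : ℝ),
      (∀ x, ‖r 0 x‖ ≤ R) → HolderBd a R (r 0) → Continuous (r 0) →
      (∀ t ∈ Icc 0 T, Continuous (f t)) →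
      (∀ t ∈ Icc 0 T, ∀ x, ‖f t x‖ ≤ L * ‖r t x‖) →
      (∀ t ∈ Icc 0 T, ∀ x y, ‖f t x - f t y‖ ≤ L * ‖r t x - r t y‖) →
      (∀ t ∈ Icc 0 T, Continuous (d t)) → (∀ t ∈ Icc 0 T, ∀ x, ‖d t x‖ ≤ M) →
      (∀ t ∈ Icc 0 T, HolderBd 1 Λ (d t)) →
      (∀ t ∈ Icc 0 T, ∀ s ∈ Ioc 0 T, ∀ x, ‖heat s (d t) x‖ ≤ K * s ^ (-(c / 2))) →
      (∀ t ∈ Icc 0 T, (∀ x, ‖r t x‖ ≤ m₀) ∧ HolderBd a m₀ (r t)) →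
      (∀ t ∈ Ioc 0 T, ∀ x,
        IntervalIntegrable (fun s => heatD (t - s) (fun y => f s y * d s y) x) volume 0 t) →
      (∀ t ∈ Ioc 0 T, ∀ x,
        r t x = heat t (r 0) x - ∫ s in (0 : ℝ)..t, heatD (t - s) (fun y => f s y * d s y) x) →
      ∀ t ∈ Icc 0 T, (∀ x, ‖r t x‖ ≤ C * R) ∧ HolderBd a (C * R) (r t) := by
  obtain ⟨C₁, hC₁, hprod⟩ := norm_heat_mul_le hT hc hca (by linarith)
  set θ : ℝ := (1 + a + c) / 2 with hθ
  have hθ1 : θ < 1 := by rw [hθ]; linarith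
  set C₂ : ℝ := C₁ * L * K * (4 * T ^ (a / 2) + 32) with hC₂
  have hC₂0 : 0 ≤ C₂ := by positivity
  obtain ⟨l, hl, hw⟩ := exists_exp_weight hθ1 hC₂0
  refine ⟨2 * Real.exp (l * T), by positivity, ?_⟩
  intro r f d R M Λ m₀ hr0 hr0H hr0c hf hfr hfr' hd hdM hdL hdK hm₀ hint heq
  have hR : 0 ≤ R := hr0H.nonneg
  have hM0 : 0 ≤ M := (norm_nonneg _).trans (hdM 0 ⟨le_rfl, hT.le⟩ 0)
  have hm₀' : 0 ≤ m₀ := (hm₀ 0 ⟨le_rfl, hT.le⟩).2.nonneg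
  -- one application of the Duhamel formula improves a bound `m e^{lt}` to `(R + m/2) e^{lt}`
  have hstep : ∀ m : ℝ, 0 ≤ m →
      (∀ t ∈ Icc 0 T, (∀ x, ‖r t x‖ ≤ m * Real.exp (l * t)) ∧
        HolderBd a (m * Real.exp (l * t)) (r t)) →
      ∀ t ∈ Icc 0 T, (∀ x, ‖r t x‖ ≤ (R + m / 2) * Real.exp (l * t)) ∧
        HolderBd a ((R + m / 2) * Real.exp (l * t)) (r t) := by
    intro m hm hb t ht
    have hexp : 1 ≤ Real.exp (l * t) := Real.one_le_exp (mul_nonneg hl.le ht.1)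
    rcases eq_or_lt_of_le ht.1 with h0 | h0
    · have hle : R ≤ (R + m / 2) * Real.exp (l * t) := by nlinarith
      rw [← h0] at hle ⊢
      refine ⟨fun x => (hr0 x).trans hle, fun x y => (hr0H x y).trans ?_⟩
      gcongr
    have ht' : t ∈ Ioc 0 T := ⟨h0, ht.2⟩
    have hsrc : ∀ s ∈ Ioo 0 t,
        (∀ x, ‖heatD (t - s) (fun y => f s y * d s y) x‖ ≤
          C₂ * m * (Real.exp (l * s) * (t - s) ^ (-θ))) ∧
        HolderBd a (C₂ * m * (Real.exp (l * s) * (t - s) ^ (-θ)))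
          (heatD (t - s) (fun y => f s y * d s y)) := by
      intro s hs
      have hsT : s ∈ Icc 0 T := ⟨hs.1.le, hs.2.le.trans ht.2⟩
      have hts : t - s ∈ Ioc 0 T := ⟨by linarith [hs.2], by linarith [hs.1, ht.2]⟩
      obtain ⟨hb1, hb2⟩ := hb s hsT
      have hfm : ∀ x, ‖f s x‖ ≤ L * (m * Real.exp (l * s)) := fun x =>
        (hfr s hsT x).trans (by gcongr; exact hb1 x)
      have hfH : HolderBd a (L * (m * Real.exp (l * s))) (f s) := fun x y =>
        (hfr' s hsT x y).trans (by rw [mul_assoc]; gcongr; exact hb2 x y)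
      have hE : EssBdd (fun y => f s y * d s y) (L * (m * Real.exp (l * s)) * M) :=
        .mul (.of_continuous (hf s hsT) hfm) (.of_continuous (hd s hsT) (hdM s hsT))
      have hP := hprod (f s) (d s) _ K M Λ (hf s hsT) hfm hfH (hd s hsT) (hdM s hsT) (hdL s hsT)
        (hdK s hsT)
      have hD1 := heatD_le_of_heat_le hE (by linarith) hP hts
      have hD2 := heatD_holder_of_heat_le hE (by linarith) (hc.le.trans hca.le) (by linarith) hP hts
      have hts0 := hts.1
      have e0 : 0 ≤ C₁ * L * K * m * Real.exp (l * s) * (t - s) ^ (-θ) := by positivity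
      constructor
      · intro x
        refine (hD1 x).trans ?_
        have h1 : (t - s) ^ (-((c + 1) / 2)) ≤ T ^ (a / 2) * (t - s) ^ (-θ) := by
          have : (t - s) ^ (-((c + 1) / 2)) = (t - s) ^ (a / 2) * (t - s) ^ (-θ) := by
            rw [← Real.rpow_add hts0, hθ]; ring_nf
          rw [this]
          gcongr
          · linarith
          · exact hts.2
        calc _ ≤ 4 * (C₁ * (L * (m * Real.exp (l * s))) * K) *
              (T ^ (a / 2) * (t - s) ^ (-θ)) := by gcongr
          _ = C₁ * L * K * (4 * T ^ (a / 2)) * m * (Real.exp (l * s) * (t - s) ^ (-θ)) := by ring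
          _ ≤ _ := by
            rw [hC₂]
            linarith
      · intro x y
        refine (hD2 x y).trans ?_
        refine mul_le_mul_of_nonneg_right ?_ (by positivity)
        rw [hC₂, ← hθ]
        have : 0 ≤ C₁ * L * K * (4 * T ^ (a / 2)) * m * (Real.exp (l * s) * (t - s) ^ (-θ)) := by
          positivity
        linarith
    have hbint : IntervalIntegrable
        (fun s => C₂ * m * (Real.exp (l * s) * (t - s) ^ (-θ))) volume 0 t :=
      ((intervalIntegrable_sub_rpow hθ1 t).continuousOn_mul (by fun_prop)).const_mul _
    have hbval : ∫ s in (0 : ℝ)..t, C₂ * m * (Real.exp (l * s) * (t - s) ^ (-θ)) ≤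
        m / 2 * Real.exp (l * t) := by
      rw [intervalIntegral.integral_const_mul]
      have := mul_le_mul_of_nonneg_left (hw t ht.1) hm
      linarith
    have hae : ∀ {p : ℝ → Prop}, (∀ s ∈ Ioo 0 t, p s) → ∀ᵐ s, s ∈ Ioc 0 t → p s := by
      intro p hp
      filter_upwards [compl_mem_ae_iff.2 (measure_singleton t)] with s hs hs'
      exact hp s ⟨hs'.1, lt_of_le_of_ne hs'.2 hs⟩
    have hr0E : EssBdd (r 0) R := .of_continuous hr0c hr0
    constructor
    · intro x
      have h1 : ‖∫ s in (0 : ℝ)..t, heatD (t - s) (fun y => f s y * d s y) x‖ ≤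
          m / 2 * Real.exp (l * t) :=
        (intervalIntegral.norm_integral_le_of_norm_le h0.le
          (hae fun s hs => (hsrc s hs).1 x) hbint).trans hbval
      rw [heq t ht' x]
      refine (norm_sub_le _ _).trans ?_
      have := norm_heat_le h0 hr0E x
      nlinarith
    · intro x y
      have hxy : 0 ≤ |x - y| ^ a := by positivity
      have h1 : ‖∫ s in (0 : ℝ)..t, (heatD (t - s) (fun y => f s y * d s y) x -
          heatD (t - s) (fun y => f s y * d s y) y)‖ ≤ m / 2 * Real.exp (l * t) * |x - y| ^ a := by
        refine (intervalIntegral.norm_integral_le_of_norm_le h0.le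
          (hae fun s hs => (hsrc s hs).2 x y) (hbint.mul_const _)).trans ?_
        rw [intervalIntegral.integral_mul_const]
        gcongr
      rw [intervalIntegral.integral_sub (hint t ht' x) (hint t ht' y)] at h1
      rw [heq t ht' x, heq t ht' y, sub_sub_sub_comm]
      refine (norm_sub_le _ _).trans ?_
      have h2 := hr0H.heat h0 hr0E x y
      have h3 : R * |x - y| ^ a ≤ R * Real.exp (l * t) * |x - y| ^ a := by
        gcongr
        nlinarith
      linarith
  -- the fixed point of `m ↦ R + m/2` is `2R`
  have hiter : ∀ n : ℕ, ∀ t ∈ Icc 0 T,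
      (∀ x, ‖r t x‖ ≤ (2 * R + m₀ / 2 ^ n) * Real.exp (l * t)) ∧
        HolderBd a ((2 * R + m₀ / 2 ^ n) * Real.exp (l * t)) (r t) := by
    intro n
    induction n with
    | zero =>
      intro t ht
      have hexp : 1 ≤ Real.exp (l * t) := Real.one_le_exp (mul_nonneg hl.le ht.1)
      have hle : m₀ ≤ (2 * R + m₀ / 2 ^ 0) * Real.exp (l * t) := by
        rw [pow_zero, div_one]
        nlinarith
      refine ⟨fun x => ((hm₀ t ht).1 x).trans hle, fun x y => ((hm₀ t ht).2 x y).trans ?_⟩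
      gcongr
    | succ n ih =>
      have := hstep _ (by positivity) ih
      have e : R + (2 * R + m₀ / 2 ^ n) / 2 = 2 * R + m₀ / 2 ^ (n + 1) := by
        rw [pow_succ]; field_simp; ring
      rwa [e] at this
  intro t ht
  have hz : Tendsto (fun n : ℕ => (2 * R + m₀ / 2 ^ n) * Real.exp (l * t)) atTop
      (𝓝 ((2 * R + 0) * Real.exp (l * t))) :=
    ((tendsto_const_nhds.div_atTop
      (tendsto_pow_atTop_atTop_of_one_lt one_lt_two)).const_add _).mul_const _
  have hle : (2 * R + 0) * Real.exp (l * t) ≤ 2 * Real.exp (l * T) * R := by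
    rw [add_zero, mul_right_comm]
    gcongr
    exact ht.2
  refine ⟨fun x => (ge_of_tendsto' hz fun n => (hiter n t ht).1 x).trans hle, fun x y => ?_⟩
  refine (ge_of_tendsto' (hz.mul_const (|x - y| ^ a)) fun n => (hiter n t ht).2 x y).trans ?_
  gcongr

/-! ### The space derivative of the Duhamel term -/

/-- `∂_x² P_t f`, as a function, for `t > 0`. -/
noncomputable def heatDD (t : ℝ) (f : ℝ → ℂ) : ℝ → ℂ := heatD (t / 2) (heatD (t / 2) f)

theorem hasDerivAt_heatD {t M : ℝ} {f : ℝ → ℂ} (ht : 0 < t) (hf : EssBdd f M) (x : ℝ) :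
    HasDerivAt (heatD t f) (heatDD t f x) x := by
  have h2 : 0 < t / 2 := half_pos ht
  have h := hasDerivAt_heat h2 (essBdd_heatD h2 hf) x
  rwa [heat_heatD h2 h2 hf, add_halves] at h

theorem essBdd_heatD_of_holder {t e G M : ℝ} {f : ℝ → ℂ} (ht : 0 < t) (he : 0 ≤ e) (he1 : e ≤ 1)
    (hf : EssBdd f M) (hH : HolderBd e G f) :
    EssBdd (heatD t f) (2 * G * t ^ ((e - 1) / 2)) :=
  .of_continuous (continuous_heatD ht hf) (norm_heatD_le_of_holder ht he he1 hf hH)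

theorem norm_heatDD_le {t e G M : ℝ} {f : ℝ → ℂ} (ht : 0 < t) (he : 0 ≤ e) (he1 : e ≤ 1)
    (hf : EssBdd f M) (hH : HolderBd e G f) (x : ℝ) :
    ‖heatDD t f x‖ ≤ 8 * G * t ^ (-(1 - e / 2)) := by
  have h2 : 0 < t / 2 := half_pos ht
  have hG := hH.nonneg
  refine (norm_heatD_le h2 (essBdd_heatD_of_holder h2 he he1 hf hH) x).trans ?_
  have h3 := half_rpow_neg_le (k := 1) ht (show 1 - e / 2 ≤ 1 by linarith)
  rw [Real.rpow_one] at h3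
  have h4 : (t / 2) ^ ((e - 1) / 2) * (t / 2) ^ (-(1 / 2) : ℝ) = (t / 2) ^ (-(1 - e / 2)) := by
    rw [← Real.rpow_add h2]
    ring_nf
  calc _ = 4 * G * ((t / 2) ^ ((e - 1) / 2) * (t / 2) ^ (-(1 / 2) : ℝ)) := by ring
    _ ≤ 4 * G * (2 * t ^ (-(1 - e / 2))) := by rw [h4]; gcongr
    _ = _ := by ring

theorem heatDD_holder {t e G M : ℝ} {f : ℝ → ℂ} (ht : 0 < t) (he : 0 ≤ e) (he1 : e ≤ 1)
    (hf : EssBdd f M) (hH : HolderBd e G f) :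
    HolderBd (e / 2) (64 * G * t ^ (-(1 - e / 4))) (heatDD t f) := by
  have h2 : 0 < t / 2 := half_pos ht
  have h4 : 0 < t / 2 / 2 := half_pos h2
  have hG := hH.nonneg
  have hb := essBdd_heatD_of_holder h2 he he1 hf hH
  have hlip : HolderBd 1 (64 * G * t ^ (-((3 - e) / 2))) (heatDD t f) := by
    refine HolderBd.of_hasDerivAt (hasDerivAt_heatD h2 hb) fun x => ?_
    refine (norm_heatD_le h4 (essBdd_heatD h4 hb) x).trans ?_
    have e1 : t / 2 / 2 = t / 4 := by ring
    have e2 : (t / 4) ^ (-(1 / 2) : ℝ) * (t / 4) ^ (-(1 / 2) : ℝ) = 4 * t ^ (-1 : ℝ) := by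
      rw [← Real.rpow_add (by positivity)]
      rw [show (-(1 / 2) + -(1 / 2) : ℝ) = -1 by norm_num, Real.rpow_neg_one, Real.rpow_neg_one,
        inv_div]
      rfl
    have e3 : (t / 2) ^ ((e - 1) / 2) ≤ 2 * t ^ ((e - 1) / 2) := by
      have := half_rpow_neg_le (k := 1) ht (show (1 - e) / 2 ≤ 1 by linarith)
      rwa [Real.rpow_one, show -((1 - e) / 2) = (e - 1) / 2 by ring] at this
    have e4 : t ^ ((e - 1) / 2) * t ^ (-1 : ℝ) = t ^ (-((3 - e) / 2)) := by
      rw [← Real.rpow_add ht]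
      ring_nf
    rw [e1]
    calc _ = 8 * G * ((t / 4) ^ (-(1 / 2) : ℝ) * (t / 4) ^ (-(1 / 2) : ℝ)) *
          (t / 2) ^ ((e - 1) / 2) := by ring
      _ ≤ 8 * G * (4 * t ^ (-1 : ℝ)) * (2 * t ^ ((e - 1) / 2)) := by rw [e2]; gcongr
      _ = 64 * G * (t ^ ((e - 1) / 2) * t ^ (-1 : ℝ)) := by ring
      _ = _ := by rw [e4]
  intro x y
  refine (HolderBd.interp (θ := e / 2) (by linarith) (by linarith)
    (norm_heatDD_le ht he he1 hf hH) hlip x y).trans ?_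
  refine mul_le_mul_of_nonneg_right ?_ (by positivity)
  calc _ ≤ (64 * G * t ^ (-(1 - e / 2))) ^ (1 - e / 2) *
        (64 * G * t ^ (-((3 - e) / 2))) ^ (e / 2) := by
        refine mul_le_mul_of_nonneg_right (Real.rpow_le_rpow (by positivity) ?_ (by linarith))
          (by positivity)
        have : 0 ≤ G * t ^ (-(1 - e / 2)) := by positivity
        linarith
    _ = _ := by
        rw [mul_rpow_interp (by positivity) ht (by linarith) (by linarith)]
        ring_nf

/-- The Duhamel term of an `e`-Hölder source has a bounded, Hölder continuous space derivative. -/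
theorem exists_hasDerivAt_duhamel {e G M t : ℝ} (he : 0 < e) (he1 : e ≤ 1) (ht : 0 < t)
    {g : ℝ → ℝ → ℂ} (hg : ∀ s ∈ Ioo 0 t, EssBdd (g s) M) (hgH : ∀ s ∈ Ioo 0 t, HolderBd e G (g s))
    (hint : ∀ x, IntervalIntegrable (fun s => heatD (t - s) (g s) x) volume 0 t) :
    ∃ (D : ℝ → ℂ) (H : ℝ),
      (∀ x, HasDerivAt (fun x => ∫ s in (0 : ℝ)..t, heatD (t - s) (g s) x) (D x) x) ∧
      (∀ x, ‖D x‖ ≤ 16 / e * G * t ^ (e / 2)) ∧ HolderBd (e / 2) H D := by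
  have hae : ∀ {p : ℝ → Prop}, (∀ s ∈ Ioo 0 t, p s) → ∀ᵐ s, s ∈ Ioc 0 t → p s := by
    intro p hp
    filter_upwards [compl_mem_ae_iff.2 (measure_singleton t)] with s hs hs'
    exact hp s ⟨hs'.1, lt_of_le_of_ne hs'.2 hs⟩
  have hae' : ∀ {p : ℝ → Prop}, (∀ s ∈ Ioo 0 t, p s) → ∀ᵐ s ∂(volume.restrict (uIoc 0 t)), p s := by
    intro p hp
    rw [uIoc_of_le ht.le]
    exact (ae_restrict_iff' measurableSet_Ioc).2 (hae hp)
  have hd : ∀ s ∈ Ioo 0 t, ∀ x, HasDerivAt (heatD (t - s) (g s)) (heatDD (t - s) (g s) x) x :=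
    fun s hs => hasDerivAt_heatD (by linarith [hs.2]) (hg s hs)
  have hb : ∀ s ∈ Ioo 0 t, ∀ x, ‖heatDD (t - s) (g s) x‖ ≤ 8 * G * (t - s) ^ (-(1 - e / 2)) :=
    fun s hs => norm_heatDD_le (by linarith [hs.2]) he.le he1 (hg s hs) (hgH s hs)
  have hbint : IntervalIntegrable (fun s => 8 * G * (t - s) ^ (-(1 - e / 2))) volume 0 t :=
    (intervalIntegrable_sub_rpow (by linarith) t).const_mul _
  -- the second derivative is a limit of difference quotients, hence measurable in time
  have hmeas : ∀ x, AEStronglyMeasurable (fun s => heatDD (t - s) (g s) x)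
      (volume.restrict (uIoc 0 t)) := fun x => by
    refine aestronglyMeasurable_of_tendsto_ae (u := atTop)
      (f := fun (n : ℕ) s => ((n : ℝ) + 1) •
        (heatD (t - s) (g s) (x + ((n : ℝ) + 1)⁻¹) - heatD (t - s) (g s) x)) ?_ ?_
    · intro n
      rw [uIoc_of_le ht.le]
      have h1 := (hint (x + ((n : ℝ) + 1)⁻¹)).1.aestronglyMeasurable
      exact (h1.sub (hint x).1.aestronglyMeasurable).const_smul ((n : ℝ) + 1)
    · refine hae' fun s hs => ?_
      have h := (hd s hs x).tendsto_slope_zero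
      have hn : Tendsto (fun n : ℕ => ((n : ℝ) + 1)⁻¹) atTop (𝓝[≠] 0) := by
        refine tendsto_nhdsWithin_iff.2 ⟨?_, Eventually.of_forall fun n => ?_⟩
        · simpa using tendsto_one_div_add_atTop_nhds_zero_nat (𝕜 := ℝ)
        · have : (0 : ℝ) < (n : ℝ) + 1 := by positivity
          exact (inv_pos.2 this).ne'
      simpa [Function.comp_def] using h.comp hn
  have hder : ∀ x, IntervalIntegrable (fun s => heatDD (t - s) (g s) x) volume 0 t ∧
      HasDerivAt (fun x => ∫ s in (0 : ℝ)..t, heatD (t - s) (g s) x)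
        (∫ s in (0 : ℝ)..t, heatDD (t - s) (g s) x) x := fun x => by
    refine intervalIntegral.hasDerivAt_integral_of_dominated_loc_of_deriv_le
      (bound := fun s => 8 * G * (t - s) ^ (-(1 - e / 2)))
      (F := fun x s => heatD (t - s) (g s) x) (F' := fun x s => heatDD (t - s) (g s) x)
      (Metric.ball_mem_nhds x one_pos) (Eventually.of_forall fun y => ?_) (hint x) (hmeas x)
      ?_ hbint ?_
    · rw [uIoc_of_le ht.le]
      exact (hint y).1.aestronglyMeasurable
    · rw [uIoc_of_le ht.le]
      exact hae fun s hs y _ => hb s hs y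
    · rw [uIoc_of_le ht.le]
      exact hae fun s hs y _ => hd s hs y
  have hval : ∀ p : ℝ, 0 < p → ∫ s in (0 : ℝ)..t, (t - s) ^ (-(1 - p)) = t ^ p / p := fun p hp => by
    rw [intervalIntegral.integral_comp_sub_left (fun s => s ^ (-(1 - p))) t, sub_self, sub_zero,
      integral_rpow (Or.inl (by linarith)), show -(1 - p) + 1 = p by ring,
      Real.zero_rpow hp.ne', sub_zero]
  refine ⟨fun x => ∫ s in (0 : ℝ)..t, heatDD (t - s) (g s) x,
    64 * G * (t ^ (e / 4) / (e / 4)), fun x => (hder x).2, fun x => ?_, fun x y => ?_⟩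
  · refine (intervalIntegral.norm_integral_le_of_norm_le ht.le (hae fun s hs => hb s hs x)
      hbint).trans (le_of_eq ?_)
    rw [intervalIntegral.integral_const_mul, hval _ (by linarith)]
    field_simp
    ring
  · dsimp only
    rw [← intervalIntegral.integral_sub (hder x).1 (hder y).1]
    refine (intervalIntegral.norm_integral_le_of_norm_le ht.le (hae fun s hs =>
      heatDD_holder (by linarith [hs.2]) he.le he1 (hg s hs) (hgH s hs) x y)
      (((intervalIntegrable_sub_rpow (by linarith) t).const_mul _).mul_const _)).trans (le_of_eq ?_)
    rw [intervalIntegral.integral_mul_const, intervalIntegral.integral_const_mul,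
      hval _ (by linarith)]

/-! ### Fourier multipliers as convolutions -/

/-- The `L¹`-normalised dilation `x ↦ ρ k(ρ x)` of a Schwartz function. -/
noncomputable def SchwartzMap.dilate (ρ : ℝ) (hρ : 0 < ρ) (k : 𝓢(ℝ, ℂ)) : 𝓢(ℝ, ℂ) :=
  (ρ : ℂ) • SchwartzMap.compCLMOfContinuousLinearEquiv ℂ
    (ContinuousLinearEquiv.smulLeft (Units.mk0 ρ hρ.ne') : ℝ ≃L[ℝ] ℝ) k

theorem SchwartzMap.dilate_apply {ρ : ℝ} (hρ : 0 < ρ) (k : 𝓢(ℝ, ℂ)) (x : ℝ) :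
    k.dilate ρ hρ x = ρ * k (ρ * x) := rfl

theorem SchwartzMap.integral_norm_dilate {ρ : ℝ} (hρ : 0 < ρ) (k : 𝓢(ℝ, ℂ)) :
    ∫ x, ‖k.dilate ρ hρ x‖ = ∫ x, ‖k x‖ := by
  simp only [dilate_apply, norm_mul, Complex.norm_real, Real.norm_eq_abs, abs_of_pos hρ]
  rw [integral_const_mul, Measure.integral_comp_mul_left (fun x => ‖k x‖), smul_eq_mul,
    abs_of_pos (inv_pos.2 hρ), mul_inv_cancel_left₀ hρ.ne']

theorem SchwartzMap.deriv_dilate {ρ : ℝ} (hρ : 0 < ρ) (k : 𝓢(ℝ, ℂ)) (x : ℝ) :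
    deriv (k.dilate ρ hρ) x = ρ * (SchwartzMap.derivCLM ℂ ℂ k).dilate ρ hρ x := by
  have h1 : HasDerivAt (fun x : ℝ => ρ * x) ρ x := by
    simpa using (hasDerivAt_id x).const_mul ρ
  have h2 := ((k.hasDerivAt (ρ * x)).scomp x h1).const_mul (ρ : ℂ)
  have e : (k.dilate ρ hρ : ℝ → ℂ) = fun x => (ρ : ℂ) * (k ∘ fun x => ρ * x) x := rfl
  rw [e, h2.deriv, dilate_apply, SchwartzMap.derivCLM_apply, Complex.real_smul]

theorem SchwartzMap.temperate_comp_div (G : 𝓢(ℝ, ℂ)) {ρ : ℝ} (hρ : 0 < ρ) :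
    Function.HasTemperateGrowth (fun ξ => G (ξ / ρ)) := by
  have e : (fun ξ => G (ξ / ρ)) = SchwartzMap.compCLMOfContinuousLinearEquiv ℂ
      (ContinuousLinearEquiv.smulLeft (Units.mk0 ρ hρ.ne')⁻¹ : ℝ ≃L[ℝ] ℝ) G := by
    ext ξ
    change _ = G (ρ⁻¹ * ξ)
    rw [div_eq_inv_mul]
  rw [e]
  exact SchwartzMap.hasTemperateGrowth _

theorem SchwartzMap.fourier_apply_eq_integral (f : 𝓢(ℝ, ℂ)) (x : ℝ) :
    𝓕 f x = ∫ ξ : ℝ, Complex.exp ((-2 * Real.pi * x * ξ : ℝ) * Complex.I) * f ξ := by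
  rw [SchwartzMap.fourier_coe, Real.fourier_eq']
  refine integral_congr_ae (Eventually.of_forall fun ξ => ?_)
  simp only [smul_eq_mul, RCLike.inner_apply, conj_trivial]
  congr 3
  ring_nf

theorem SchwartzMap.fourierInv_apply_eq_integral (f : 𝓢(ℝ, ℂ)) (x : ℝ) :
    𝓕⁻ f x = ∫ ξ : ℝ, Complex.exp ((2 * Real.pi * x * ξ : ℝ) * Complex.I) * f ξ := by
  rw [SchwartzMap.fourierInv_coe, Real.fourierInv_eq']
  refine integral_congr_ae (Eventually.of_forall fun ξ => ?_)
  simp only [smul_eq_mul, RCLike.inner_apply, conj_trivial]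
  congr 3
  ring_nf

/-- The Fourier multiplier with symbol `G(ξ/ρ)` is the convolution with the dilated Fourier
transform of `G`. -/
theorem fourier_smul_fourierInv (G h : 𝓢(ℝ, ℂ)) {ρ : ℝ} (hρ : 0 < ρ) (x : ℝ) :
    𝓕 (SchwartzMap.smulLeftCLM ℂ (fun ξ => G (ξ / ρ)) (𝓕⁻ h)) x =
      kconv ((𝓕 G).dilate ρ hρ) h x := by
  have hG : Integrable (fun ξ => G (ξ / ρ)) := by
    simpa [div_eq_inv_mul] using G.integrable.comp_mul_left' (inv_pos.2 hρ).ne'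
  have hexp : ∀ t : ℝ, ‖Complex.exp ((t : ℝ) * Complex.I)‖ = 1 := Complex.norm_exp_ofReal_mul_I
  have hI : Integrable (fun p : ℝ × ℝ =>
      Complex.exp ((-2 * Real.pi * (x - p.2) * p.1 : ℝ) * Complex.I) * (G (p.1 / ρ) * h p.2))
      (volume.prod volume) := by
    refine (hG.mul_prod h.integrable).bdd_mul (c := 1) ?_ (Eventually.of_forall fun p => ?_)
    · exact Continuous.aestronglyMeasurable (by fun_prop)
    · rw [hexp]
  have e1 : 𝓕 (SchwartzMap.smulLeftCLM ℂ (fun ξ => G (ξ / ρ)) (𝓕⁻ h)) x =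
      ∫ ξ : ℝ, ∫ y : ℝ, Complex.exp ((-2 * Real.pi * (x - y) * ξ : ℝ) * Complex.I) *
        (G (ξ / ρ) * h y) := by
    rw [SchwartzMap.fourier_apply_eq_integral]
    refine integral_congr_ae (Eventually.of_forall fun ξ => ?_)
    dsimp only
    rw [SchwartzMap.smulLeftCLM_apply_apply (G.temperate_comp_div hρ),
      SchwartzMap.fourierInv_apply_eq_integral, smul_eq_mul, ← integral_const_mul,
      ← integral_const_mul]
    refine integral_congr_ae (Eventually.of_forall fun y => ?_)
    dsimp only
    have : Complex.exp ((-2 * Real.pi * (x - y) * ξ : ℝ) * Complex.I) =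
        Complex.exp ((-2 * Real.pi * x * ξ : ℝ) * Complex.I) *
          Complex.exp ((2 * Real.pi * ξ * y : ℝ) * Complex.I) := by
      rw [← Complex.exp_add]
      push_cast
      ring_nf
    rw [this]
    ring
  rw [e1, integral_integral_swap (f := fun ξ y =>
    Complex.exp ((-2 * Real.pi * (x - y) * ξ : ℝ) * Complex.I) * (G (ξ / ρ) * h y)) hI, kconv]
  refine integral_congr_ae (Eventually.of_forall fun y => ?_)
  dsimp only
  rw [SchwartzMap.dilate_apply, SchwartzMap.fourier_apply_eq_integral]
  simp only [← mul_assoc (Complex.exp _)]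
  rw [integral_mul_const]
  congr 1
  have := Measure.integral_comp_div (fun ξ =>
    Complex.exp ((-2 * Real.pi * (ρ * (x - y)) * ξ : ℝ) * Complex.I) * G ξ) ρ
  rw [abs_of_pos hρ, Complex.real_smul] at this
  rw [← this]
  refine integral_congr_ae (Eventually.of_forall fun ξ => ?_)
  dsimp only
  congr 4
  field_simp

theorem SchwartzMap.fourier_neg_of_even {G : 𝓢(ℝ, ℂ)} (hG : ∀ ξ, G (-ξ) = G ξ) (x : ℝ) :
    𝓕 G (-x) = 𝓕 G x := by
  rw [fourier_apply_eq_integral, fourier_apply_eq_integral, ← integral_neg_eq_self]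
  refine integral_congr_ae (Eventually.of_forall fun ξ => ?_)
  dsimp only
  rw [hG]
  congr 4
  ring

/-- The Fourier transform of a Schwartz function that vanishes near the origin is the derivative
of a Schwartz function. -/
theorem exists_deriv_eq_fourier {G : 𝓢(ℝ, ℂ)} {δ : ℝ} (hδ : 0 < δ)
    (h0 : ∀ ξ, |ξ| < δ → G ξ = 0) (hc : HasCompactSupport G) :
    ∃ m : 𝓢(ℝ, ℂ), ∀ x, deriv m x = 𝓕 G x := by
  set c : ℂ := -(2 * Real.pi * Complex.I) with hcdef
  have hc0 : c ≠ 0 := by simp [hcdef, Real.pi_ne_zero]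
  have hsm : ContDiff ℝ ∞ (fun ξ : ℝ => ξ⁻¹ • (c⁻¹ * G ξ)) := by
    refine contDiff_iff_contDiffAt.2 fun ξ => ?_
    rcases eq_or_ne ξ 0 with rfl | hξ
    · refine (contDiffAt_const (c := (0 : ℂ))).congr_of_eventuallyEq ?_
      filter_upwards [Metric.ball_mem_nhds (0 : ℝ) hδ] with y hy
      rw [Metric.mem_ball, dist_zero_right, Real.norm_eq_abs] at hy
      rw [h0 y hy, mul_zero, smul_zero]
    · exact (contDiffAt_id.inv hξ).smul (contDiffAt_const.mul (G.smooth ⊤).contDiffAt)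
  have hcs : HasCompactSupport (fun ξ : ℝ => ξ⁻¹ • (c⁻¹ * G ξ)) := by
    refine hc.mono' fun ξ hξ => subset_tsupport _ fun h => hξ ?_
    simp [h]
  set Q : 𝓢(ℝ, ℂ) := hcs.toSchwartzMap hsm with hQ
  refine ⟨𝓕 Q, fun x => ?_⟩
  have h1 := congrArg (fun f : 𝓢(ℝ, ℂ) => f x) (SchwartzMap.lineDerivOp_fourier_eq Q (1 : ℝ))
  rw [SchwartzMap.lineDerivOp_apply_eq_fderiv, fderiv_apply_one_eq_deriv] at h1
  rw [h1]
  congr 2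
  ext ξ
  have ht : Function.HasTemperateGrowth (fun y : ℝ => (inner ℝ y (1 : ℝ) : ℝ)) := by fun_prop
  rw [smul_apply, SchwartzMap.smulLeftCLM_apply_apply ht]
  change c • ((inner ℝ ξ (1 : ℝ) : ℝ) • (ξ⁻¹ • (c⁻¹ * G ξ))) = G ξ
  rcases eq_or_ne ξ 0 with rfl | hξ
  · rw [h0 0 (by simpa using hδ)]
    simp
  · have : (ξ : ℂ) ≠ 0 := Complex.ofReal_ne_zero.2 hξ
    simp only [RCLike.inner_apply, conj_trivial, one_mul, smul_eq_mul, Complex.real_smul,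
      Complex.ofReal_inv]
    field_simp

/-! ### The Littlewood–Paley decomposition of a Besov distribution -/

namespace DyadicPartition

variable (Φ : DyadicPartition)

theorem hasCompactSupport_of_abs_le {f : ℝ → ℝ} {R : ℝ} (h : ∀ ξ, f ξ ≠ 0 → |ξ| ≤ R) :
    HasCompactSupport (fun ξ => (f ξ : ℂ)) := by
  refine HasCompactSupport.of_support_subset_isCompact (isCompact_Icc (a := -R) (b := R))
    fun ξ hξ => abs_le.1 (h ξ fun h0 => hξ ?_)
  simp [h0]

/-- The low-frequency cut-off `χ` as a Schwartz function. -/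
noncomputable def low : 𝓢(ℝ, ℂ) :=
  (hasCompactSupport_of_abs_le Φ.χ_support).toSchwartzMap
    (Complex.ofRealCLM.contDiff.comp Φ.χ_smooth)

/-- The dyadic bump `φ` as a Schwartz function. -/
noncomputable def bump : 𝓢(ℝ, ℂ) :=
  (hasCompactSupport_of_abs_le fun ξ h => (Φ.φ_support ξ h).2).toSchwartzMap
    (Complex.ofRealCLM.contDiff.comp Φ.φ_smooth)

theorem low_apply (ξ : ℝ) : Φ.low ξ = (Φ.χ ξ : ℂ) := rfl

theorem χ_eq_zero {ξ : ℝ} (h : 4 / 3 < |ξ|) : Φ.χ ξ = 0 := by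
  by_contra hne
  exact absurd (Φ.χ_support ξ hne) (not_le.2 h)

theorem χ_eq_one {ξ : ℝ} (h : |ξ| < 3 / 4) : Φ.χ ξ = 1 := by
  have h0 : ∀ j : ℕ, Φ.φ (ξ / 2 ^ j) = 0 := fun j => by
    by_contra hne
    have h1 := (Φ.φ_support _ hne).1
    have h2 : |ξ / 2 ^ j| ≤ |ξ| := by
      rw [abs_div, abs_of_pos (by positivity : (0 : ℝ) < 2 ^ j)]
      exact div_le_self (abs_nonneg _) (one_le_pow₀ one_le_two)
    linarith
  have h1 := Φ.sum_one ξ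
  simp only [h0] at h1
  have := h1.unique hasSum_zero
  linarith

/-- The partial sums of the partition of unity are dilations of `χ`. -/
theorem χ_add_sum (J : ℕ) (ξ : ℝ) :
    Φ.χ ξ + ∑ j ∈ Finset.range J, Φ.φ (ξ / 2 ^ j) = Φ.χ (ξ / 2 ^ J) := by
  have h1 := Φ.sum_one ξ
  have h2 := Φ.sum_one (ξ / 2 ^ J)
  have h3 := (hasSum_nat_add_iff' J).2 h1
  have e : (fun j : ℕ => Φ.φ (ξ / 2 ^ (j + J))) = fun j : ℕ => Φ.φ (ξ / 2 ^ J / 2 ^ j) := by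
    ext j
    rw [pow_add, div_div, mul_comm]
  rw [e] at h3
  have := h3.unique h2
  linarith

/-- A symbol supported in an annulus and equal to `1` on the support of `φ(·/2)`. -/
noncomputable def annulus : 𝓢(ℝ, ℂ) :=
  HasCompactSupport.toSchwartzMap (f := fun ξ => ((Φ.χ (ξ / 8) - Φ.χ ξ : ℝ) : ℂ))
    (hasCompactSupport_of_abs_le (R := 32 / 3) fun ξ h => by
      by_contra! hc
      refine h ?_
      rw [Φ.χ_eq_zero (ξ := ξ) (by linarith), Φ.χ_eq_zero (ξ := ξ / 8), sub_zero]
      rw [abs_div, abs_of_pos (by norm_num : (0 : ℝ) < 8)]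
      linarith)
    (Complex.ofRealCLM.contDiff.comp
      ((Φ.χ_smooth.comp (contDiff_id.div_const 8)).sub Φ.χ_smooth))

theorem annulus_apply (ξ : ℝ) : Φ.annulus ξ = ((Φ.χ (ξ / 8) - Φ.χ ξ : ℝ) : ℂ) := rfl

theorem hasCompactSupport_annulus : HasCompactSupport Φ.annulus := by
  refine HasCompactSupport.of_support_subset_isCompact
    (isCompact_Icc (a := -(32 / 3)) (b := 32 / 3)) fun ξ hξ => abs_le.1 ?_
  by_contra! hc
  refine hξ ?_
  rw [annulus_apply, Φ.χ_eq_zero (ξ := ξ) (by linarith), Φ.χ_eq_zero (ξ := ξ / 8), sub_zero,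
    Complex.ofReal_zero]
  rw [abs_div, abs_of_pos (by norm_num : (0 : ℝ) < 8)]
  linarith

theorem annulus_eq_zero {ξ : ℝ} (h : |ξ| < 3 / 4) : Φ.annulus ξ = 0 := by
  rw [annulus_apply, Φ.χ_eq_one h, Φ.χ_eq_one, sub_self, Complex.ofReal_zero]
  rw [abs_div, abs_of_pos (by norm_num : (0 : ℝ) < 8)]
  linarith [abs_nonneg ξ]

end DyadicPartition

theorem exists_essBdd_of_linftyNorm_lt {u : 𝓢'(ℝ, ℂ)} {A : ℝ}
    (h : linftyNorm u < ENNReal.ofReal A) :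
    ∃ W : ℝ → ℂ, EssBdd W A ∧ ∀ h : 𝓢(ℝ, ℂ), u h = ∫ x, h x * W x := by
  unfold linftyNorm at h
  simp only [iInf_lt_iff] at h
  obtain ⟨f, hf, hfA⟩ := h
  have hA : 0 < A := by
    by_contra! hA
    rw [ENNReal.ofReal_of_nonpos hA] at hfA
    exact absurd hfA (by simp)
  refine ⟨f, ⟨Lp.aestronglyMeasurable f, ?_⟩, fun h => ?_⟩
  · have h1 : ∀ᵐ x, ‖f x‖ₑ ≤ ‖f‖ₑ := by
      have e : ‖f‖ₑ = eLpNormEssSup f volume := by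
        rw [Lp.enorm_def, eLpNorm_exponent_top]
      rw [e]
      exact ae_le_eLpNormEssSup
    filter_upwards [h1] with x hx
    have h2 := hx.trans hfA.le
    rw [← ofReal_norm, ENNReal.ofReal_le_ofReal_iff hA.le] at h2
    exact h2
  · rw [← hf, Lp.toTemperedDistribution_apply]
    rfl

/-- A block with symbol `σ` is reproduced by the convolution with a kernel whose symbol equals `1`
on the support of `σ`. -/
theorem multiplier_eq_integral_kconv {u : 𝓢'(ℝ, ℂ)} {σ : ℝ → ℂ} {G : 𝓢(ℝ, ℂ)} {ρ A : ℝ}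
    (hρ : 0 < ρ) (hσ : σ.HasTemperateGrowth) (hGe : ∀ ξ, G (-ξ) = G ξ)
    (hG : ∀ ξ, σ ξ ≠ 0 → G (ξ / ρ) = 1) {W : ℝ → ℂ} (hW : EssBdd W A)
    (hu : ∀ h : 𝓢(ℝ, ℂ), TemperedDistribution.fourierMultiplierCLM ℂ σ u h = ∫ x, h x * W x)
    (h : 𝓢(ℝ, ℂ)) :
    TemperedDistribution.fourierMultiplierCLM ℂ σ u h =
      ∫ x, h x * kconv ((𝓕 G).dilate ρ hρ) W x := by
  have e : σ * (fun ξ => G (ξ / ρ)) = σ := by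
    ext ξ
    rw [Pi.mul_apply]
    by_cases h0 : σ ξ = 0
    · rw [h0, zero_mul]
    · rw [hG ξ h0, mul_one]
  have h1 := TemperedDistribution.fourierMultiplierCLM_fourierMultiplierCLM_apply hσ
    (G.temperate_comp_div hρ) u
  rw [e] at h1
  rw [← h1, TemperedDistribution.fourierMultiplierCLM_apply_apply, hu,
    integral_mul_kconv ((𝓕 G).dilate ρ hρ).integrable _ h.integrable hW]
  · simp only [fourier_smul_fourierInv G h hρ]
  · intro z
    rw [SchwartzMap.dilate_apply, SchwartzMap.dilate_apply, mul_neg,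
      SchwartzMap.fourier_neg_of_even hGe]

theorem kconv_hasDerivAt_dilate {k k' : 𝓢(ℝ, ℂ)} (hk : ∀ x, deriv k x = k' x) {ρ : ℝ} (hρ : 0 < ρ)
    {W : ℝ → ℂ} {A : ℝ} (hW : EssBdd W A) (x : ℝ) :
    HasDerivAt (kconv (k.dilate ρ hρ) W) (ρ * kconv (k'.dilate ρ hρ) W x) x := by
  refine (kconv_hasDerivAt (k.dilate ρ hρ) hW x).congr_deriv ?_
  have e : SchwartzMap.derivCLM ℂ ℂ k = k' := by
    ext x
    rw [SchwartzMap.derivCLM_apply, hk]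
  simp only [kconv, ← integral_const_mul, SchwartzMap.deriv_dilate, e, mul_assoc]

theorem norm_kconv_dilate_le (k : 𝓢(ℝ, ℂ)) {ρ : ℝ} (hρ : 0 < ρ)
    {W : ℝ → ℂ} {A : ℝ} (hW : EssBdd W A) (x : ℝ) :
    ‖kconv (k.dilate ρ hρ) W x‖ ≤ (∫ z, ‖k z‖) * A := by
  rw [← SchwartzMap.integral_norm_dilate hρ]
  exact norm_kconv_le hW (k.dilate ρ hρ).integrable x

/-- The low-frequency truncation `h ↦ (χ(2^{-J}·) ĥ)^∨` of a test function. -/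
noncomputable def lowPass (Φ : DyadicPartition) (J : ℕ) (h : 𝓢(ℝ, ℂ)) : 𝓢(ℝ, ℂ) :=
  𝓕 (SchwartzMap.smulLeftCLM ℂ (fun ξ => Φ.low (ξ / 2 ^ J)) (𝓕⁻ h))

/-- `w` is a sequence of smooth functions representing the Littlewood–Paley blocks of `u`: the
sum of the first `J + 1` of them is the low-frequency truncation of `u`, and they satisfy the
bounds that a `C^γ`-norm below `A` gives by Bernstein's inequalities. The derivative of `w n` costs
a factor `2^n`, and an antiderivative gains one (for `n ≥ 1`). -/
structure IsBlockDecomposition (Φ : DyadicPartition) (C γ A : ℝ) (u : 𝓢'(ℝ, ℂ))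
    (w : ℕ → ℝ → ℂ) : Prop where
  bound : ∀ n x, ‖w n x‖ ≤ C * A * 2 ^ (-((n : ℝ) * γ))
  hasDerivAt : ∀ n, ∃ w' : ℝ → ℂ, Continuous w' ∧ (∀ x, HasDerivAt (w n) (w' x) x) ∧
    ∀ x, ‖w' x‖ ≤ C * A * 2 ^ (n : ℝ) * 2 ^ (-((n : ℝ) * γ))
  antideriv : ∀ n, n ≠ 0 → ∃ v : ℝ → ℂ, (∀ x, HasDerivAt v (w n x) x) ∧
    ∀ x, ‖v x‖ ≤ C * A * 2 ^ (-(n : ℝ)) * 2 ^ (-((n : ℝ) * γ))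
  sum : ∀ J h, u (lowPass Φ J h) = ∑ n ∈ Finset.range (J + 1), ∫ x, h x * w n x

theorem IsBlockDecomposition.continuous {Φ : DyadicPartition} {C γ A : ℝ} {u : 𝓢'(ℝ, ℂ)}
    {w : ℕ → ℝ → ℂ} (h : IsBlockDecomposition Φ C γ A u w) (n : ℕ) : Continuous (w n) := by
  obtain ⟨w', -, hd, -⟩ := h.hasDerivAt n
  exact continuous_iff_continuousAt.2 fun x => (hd x).continuousAt

/-- Bernstein's inequalities: each block is convolved with a dilated kernel whose symbol is `1` on its
frequency support. Derivative and antiderivative fall on the kernel; the antiderivative exists for the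
blocks supported away from the zero frequency. -/
theorem exists_isBlockDecomposition (Φ : DyadicPartition) (γ : ℝ) :
    ∃ C : ℝ, 0 ≤ C ∧ ∀ (u : 𝓢'(ℝ, ℂ)) (A : ℝ), besovNorm Φ γ u < ENNReal.ofReal A →
      ∃ w, IsBlockDecomposition Φ C γ A u w := by
  set K : 𝓢(ℝ, ℂ) := 𝓕 Φ.low with hK
  set L : 𝓢(ℝ, ℂ) := 𝓕 Φ.annulus with hL
  obtain ⟨m, hm⟩ := exists_deriv_eq_fourier (by norm_num : (0 : ℝ) < 3 / 4)
    (fun ξ => Φ.annulus_eq_zero) Φ.hasCompactSupport_annulus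
  set K' := SchwartzMap.derivCLM ℂ ℂ K with hK'
  set L' := SchwartzMap.derivCLM ℂ ℂ L with hL'
  have i0 : ∀ k : 𝓢(ℝ, ℂ), 0 ≤ ∫ z, ‖k z‖ := fun k => integral_nonneg fun z => norm_nonneg _
  set S : ℝ := (∫ z, ‖K z‖) + 2 * (∫ z, ‖K' z‖) + (∫ z, ‖L z‖) + (∫ z, ‖L' z‖) +
    4 * ∫ z, ‖m z‖ with hS
  have hS0 : 0 ≤ S := by
    have := i0 K; have := i0 K'; have := i0 L; have := i0 L'; have := i0 m
    positivity
  refine ⟨2 ^ γ * S, by positivity, fun u A hA => ?_⟩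
  have hA0 : 0 < A := by
    by_contra! hA0
    rw [ENNReal.ofReal_of_nonpos hA0] at hA
    exact absurd hA (by simp)
  -- representatives of the blocks
  have hlin : ∀ {a : ℝ} {v : 𝓢'(ℝ, ℂ)}, ENNReal.ofReal (2 ^ a) * linftyNorm v < ENNReal.ofReal A →
      linftyNorm v < ENNReal.ofReal (2 ^ (-a) * A) := by
    intro a v h
    have h2 : (0 : ℝ) < 2 ^ a := by positivity
    rw [Real.rpow_neg (by norm_num), ← div_eq_inv_mul, ENNReal.ofReal_div_of_pos h2]
    rw [ENNReal.lt_div_iff_mul_lt (Or.inl (by simpa using h2)) (Or.inl ENNReal.ofReal_ne_top),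
      mul_comm]
    exact h
  obtain ⟨W₀, hW₀, hW₀u⟩ := exists_essBdd_of_linftyNorm_lt (hlin ((le_max_left _ _).trans_lt hA))
  have hj : ∀ j : ℕ, ∃ W : ℝ → ℂ, EssBdd W (2 ^ (-((j : ℝ) * γ)) * A) ∧ ∀ h : 𝓢(ℝ, ℂ),
      TemperedDistribution.fourierMultiplierCLM ℂ (fun ξ : ℝ => (Φ.φ (ξ / 2 ^ j) : ℂ)) u h =
        ∫ x, h x * W x := fun j =>
    exists_essBdd_of_linftyNorm_lt (hlin (((le_iSup (fun j : ℕ =>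
      ENNReal.ofReal ((2 : ℝ) ^ ((j : ℝ) * γ)) * linftyNorm
        (TemperedDistribution.fourierMultiplierCLM ℂ (fun ξ : ℝ => (Φ.φ (ξ / 2 ^ j) : ℂ)) u)) j).trans
        (le_max_right _ _)).trans_lt hA))
  choose W hW hWu using hj
  have hρ : ∀ j : ℕ, (0 : ℝ) < 2 ^ j / 2 := fun j => by positivity
  have hbase : ∀ j : ℕ, 2 ^ (-((j : ℝ) * γ)) * A = 2 ^ γ * A * 2 ^ (-(((j + 1 : ℕ) : ℝ) * γ)) :=
      fun j => by
    have : (2 : ℝ) ^ γ * 2 ^ (-(((j + 1 : ℕ) : ℝ) * γ)) = 2 ^ (-((j : ℝ) * γ)) := by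
      rw [← Real.rpow_add two_pos]
      push_cast
      ring_nf
    rw [← this]
    ring
  have hlowe : ∀ ξ, Φ.low (-ξ) = Φ.low ξ := fun ξ => by
    rw [Φ.low_apply, Φ.low_apply, Φ.χ_even]
  have hanne : ∀ ξ, Φ.annulus (-ξ) = Φ.annulus ξ := fun ξ => by
    rw [Φ.annulus_apply, Φ.annulus_apply, Φ.χ_even, neg_div, Φ.χ_even]
  have hpow : ∀ j : ℕ, (2 : ℝ) ^ (((j + 1 : ℕ) : ℝ)) = 4 * (2 ^ j / 2) := fun j => by
    rw [Real.rpow_natCast, pow_succ]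
    ring
  let w : ℕ → ℝ → ℂ := fun n => Nat.casesOn n (kconv (K.dilate 2 two_pos) W₀)
    fun j => kconv (L.dilate (2 ^ j / 2) (hρ j)) (W j)
  have hχt : Function.HasTemperateGrowth (fun ξ : ℝ => (Φ.χ ξ : ℂ)) := Φ.low.hasTemperateGrowth
  have hφt : ∀ j : ℕ, Function.HasTemperateGrowth (fun ξ : ℝ => (Φ.φ (ξ / 2 ^ j) : ℂ)) :=
    fun j => Φ.bump.temperate_comp_div (by positivity : (0 : ℝ) < 2 ^ j)
  have hK0 := i0 K
  have hK'0 := i0 K'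
  have hL0 := i0 L
  have hL'0 := i0 L'
  have hm0 := i0 m
  refine ⟨w, ⟨?_, ?_, ?_, ?_⟩⟩
  · rintro (_ | j) x
    · refine (norm_kconv_dilate_le K two_pos hW₀ x).trans ?_
      simp only [neg_neg, Nat.cast_zero, zero_mul, neg_zero, Real.rpow_zero, mul_one]
      rw [mul_assoc (2 ^ γ), mul_left_comm]
      gcongr
      linarith
    · refine (norm_kconv_dilate_le L (hρ j) (hW j) x).trans ?_
      rw [hbase]
      calc _ ≤ S * (2 ^ γ * A * 2 ^ (-(((j + 1 : ℕ) : ℝ) * γ))) := by gcongr; linarith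
        _ = _ := by ring
  · rintro (_ | j)
    · refine ⟨fun x => ((2 : ℝ) : ℂ) * kconv (K'.dilate 2 two_pos) W₀ x,
        continuous_const.mul (kconv_continuous _ hW₀),
        kconv_hasDerivAt_dilate (fun x => (SchwartzMap.derivCLM_apply ℂ K x).symm) two_pos hW₀,
        fun x => ?_⟩
      have h1 := norm_kconv_dilate_le K' two_pos hW₀ x
      rw [norm_mul, Complex.norm_real, Real.norm_eq_abs, abs_of_pos two_pos]
      simp only [neg_neg, Nat.cast_zero, zero_mul, neg_zero, Real.rpow_zero, mul_one] at h1 ⊢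
      calc _ ≤ 2 * ((∫ z, ‖K' z‖) * (2 ^ γ * A)) := by gcongr
        _ = (2 * ∫ z, ‖K' z‖) * (2 ^ γ * A) := by ring
        _ ≤ S * (2 ^ γ * A) := by gcongr; linarith
        _ = _ := by ring
    · refine ⟨fun x => ((2 ^ j / 2 : ℝ) : ℂ) * kconv (L'.dilate _ (hρ j)) (W j) x,
        continuous_const.mul (kconv_continuous _ (hW j)),
        kconv_hasDerivAt_dilate (fun x => (SchwartzMap.derivCLM_apply ℂ L x).symm) (hρ j) (hW j),
        fun x => ?_⟩
      have h1 := norm_kconv_dilate_le L' (hρ j) (hW j) x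
      rw [norm_mul, Complex.norm_real, Real.norm_eq_abs, abs_of_pos (hρ j), hpow]
      rw [hbase] at h1
      have hr := hρ j
      calc _ ≤ (2 ^ j / 2) * ((∫ z, ‖L' z‖) * (2 ^ γ * A * 2 ^ (-(((j + 1 : ℕ) : ℝ) * γ)))) := by
            gcongr
        _ ≤ (4 * (2 ^ j / 2)) * (S * (2 ^ γ * A * 2 ^ (-(((j + 1 : ℕ) : ℝ) * γ)))) := by
            gcongr <;> linarith
        _ = _ := by ring
  · rintro (_ | j) hn
    · exact absurd rfl hn
    · have hr := hρ j
      have hrc : ((2 ^ j / 2 : ℝ) : ℂ) ≠ 0 := Complex.ofReal_ne_zero.2 hr.ne'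
      refine ⟨fun x => ((2 ^ j / 2 : ℝ) : ℂ)⁻¹ * kconv (m.dilate _ (hρ j)) (W j) x,
        fun x => ?_, fun x => ?_⟩
      · refine ((kconv_hasDerivAt_dilate hm (hρ j) (hW j) x).const_mul _).congr_deriv ?_
        rw [inv_mul_cancel_left₀ hrc]
      · have h1 := norm_kconv_dilate_le m (hρ j) (hW j) x
        rw [norm_mul, norm_inv, Complex.norm_real, Real.norm_eq_abs, abs_of_pos (hρ j),
          Real.rpow_neg (by norm_num) (((j + 1 : ℕ) : ℝ)), hpow]
        rw [hbase] at h1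
        calc _ ≤ (2 ^ j / 2)⁻¹ * ((∫ z, ‖m z‖) * (2 ^ γ * A * 2 ^ (-(((j + 1 : ℕ) : ℝ) * γ)))) := by
              gcongr
          _ = (4 * (2 ^ j / 2))⁻¹ * ((4 * ∫ z, ‖m z‖) *
                (2 ^ γ * A * 2 ^ (-(((j + 1 : ℕ) : ℝ) * γ)))) := by
              rw [mul_inv]
              ring
          _ ≤ (4 * (2 ^ j / 2))⁻¹ * (S * (2 ^ γ * A * 2 ^ (-(((j + 1 : ℕ) : ℝ) * γ)))) := by
              gcongr
              linarith
          _ = _ := by ring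
  · intro J h
    have h0 : TemperedDistribution.fourierMultiplierCLM ℂ (fun ξ : ℝ => (Φ.χ ξ : ℂ)) u h =
        ∫ x, h x * w 0 x := by
      refine multiplier_eq_integral_kconv two_pos hχt hlowe (fun ξ hξ => ?_) hW₀ hW₀u h
      have h1 := Φ.χ_support ξ fun h => hξ (by rw [h, Complex.ofReal_zero])
      rw [Φ.low_apply, Φ.χ_eq_one, Complex.ofReal_one]
      rw [abs_div, abs_two]
      linarith
    have h1 : ∀ j : ℕ, TemperedDistribution.fourierMultiplierCLM ℂ
        (fun ξ : ℝ => (Φ.φ (ξ / 2 ^ j) : ℂ)) u h = ∫ x, h x * w (j + 1) x := by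
      intro j
      refine multiplier_eq_integral_kconv (hρ j) (hφt j) hanne (fun ξ hξ => ?_) (hW j) (hWu j) h
      obtain ⟨h1, h2⟩ := Φ.φ_support _ fun h => hξ (by rw [h, Complex.ofReal_zero])
      have h2j : (0 : ℝ) < 2 ^ j := by positivity
      rw [abs_div, abs_of_pos h2j] at h1 h2
      have e1 : |ξ / (2 ^ j / 2)| = 2 * (|ξ| / 2 ^ j) := by
        rw [abs_div, abs_of_pos (hρ j)]
        field_simp
      rw [Φ.annulus_apply, Φ.χ_eq_one, Φ.χ_eq_zero, sub_zero, Complex.ofReal_one]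
      · rw [e1]
        linarith
      · rw [abs_div, e1, abs_of_pos (by norm_num : (0 : ℝ) < 8)]
        linarith
    have e : (fun ξ : ℝ => Φ.low (ξ / 2 ^ J)) = fun ξ : ℝ => ((Φ.χ ξ : ℂ) +
        ∑ j ∈ Finset.range J, (Φ.φ (ξ / 2 ^ j) : ℂ)) := by
      ext ξ
      rw [Φ.low_apply, ← Φ.χ_add_sum]
      push_cast
      rfl
    have e2 : lowPass Φ J h = 𝓕 (SchwartzMap.smulLeftCLM ℂ (fun ξ : ℝ => (Φ.χ ξ : ℂ)) (𝓕⁻ h)) +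
        ∑ j ∈ Finset.range J,
          𝓕 (SchwartzMap.smulLeftCLM ℂ (fun ξ : ℝ => (Φ.φ (ξ / 2 ^ j) : ℂ)) (𝓕⁻ h)) := by
      have ht : Function.HasTemperateGrowth
          (fun ξ : ℝ => ∑ j ∈ Finset.range J, (Φ.φ (ξ / 2 ^ j) : ℂ)) :=
        Function.HasTemperateGrowth.sum fun j _ => hφt j
      have e3 := SchwartzMap.smulLeftCLM_add (F := ℂ) hχt ht
      have e4 := SchwartzMap.smulLeftCLM_sum (F := ℂ) (s := Finset.range J)
        (g := fun (j : ℕ) (ξ : ℝ) => (Φ.φ (ξ / 2 ^ j) : ℂ)) fun j _ => hφt j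
      have e5 : (fun ξ : ℝ => ((Φ.χ ξ : ℂ) + ∑ j ∈ Finset.range J, (Φ.φ (ξ / 2 ^ j) : ℂ))) =
        (fun ξ : ℝ => (Φ.χ ξ : ℂ)) + fun ξ : ℝ => ∑ j ∈ Finset.range J, (Φ.φ (ξ / 2 ^ j) : ℂ) := rfl
      rw [lowPass, e, e5, e3, e4]
      have e6 : ∀ f : 𝓢(ℝ, ℂ), 𝓕 f = FourierTransform.fourierCLM ℂ 𝓢(ℝ, ℂ) f := fun f => rfl
      simp only [e6, add_apply, sum_apply, map_add, map_sum]
    rw [e2, map_add, map_sum, Finset.sum_range_succ', add_comm]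
    simp only [← h1, ← h0]
    rfl

/-! ### Bounded functions as the sum of their Littlewood–Paley blocks -/

theorem low_neg (Φ : DyadicPartition) (ξ : ℝ) : Φ.low (-ξ) = Φ.low ξ := by
  rw [Φ.low_apply, Φ.low_apply, Φ.χ_even]

theorem integral_fourier_low (Φ : DyadicPartition) : ∫ z, 𝓕 Φ.low z = 1 := by
  have h := SchwartzMap.fourierInv_apply_eq_integral (𝓕 Φ.low) 0
  rw [FourierTransform.fourierInv_fourier_eq, Φ.low_apply, Φ.χ_eq_one (by norm_num)] at h
  simpa using h.symm

theorem lowPass_apply (Φ : DyadicPartition) (J : ℕ) (h : 𝓢(ℝ, ℂ)) (x : ℝ) :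
    lowPass Φ J h x =
      kconv ((𝓕 Φ.low).dilate (2 ^ J) (by positivity)) h x :=
  fourier_smul_fourierInv Φ.low h (by positivity) x

/-- Dilations of a Schwartz function of integral `1` form an approximate identity. -/
theorem tendsto_kconv_dilate {K : 𝓢(ℝ, ℂ)} (hK : ∫ z, K z = 1) {f : ℝ → ℂ} {M : ℝ}
    (hf : Continuous f) (hM : ∀ x, ‖f x‖ ≤ M) (x : ℝ) :
    Tendsto (fun J : ℕ => kconv (K.dilate (2 ^ J) (by positivity)) f x) atTop (𝓝 (f x)) := by
  have e : ∀ J : ℕ, kconv (K.dilate (2 ^ J) (by positivity)) f x =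
      ∫ z, K z * f (x - z / 2 ^ J) := fun J => by
    have h2 : (0 : ℝ) < 2 ^ J := by positivity
    have h1 := Measure.integral_comp_mul_left (fun z => K z * f (x - z / 2 ^ J)) (2 ^ J)
    rw [abs_of_pos (inv_pos.2 h2), eq_inv_smul_iff₀ h2.ne'] at h1
    rw [kconv_eq_integral, ← h1, ← integral_smul]
    refine integral_congr_ae (Eventually.of_forall fun z => ?_)
    simp only [SchwartzMap.dilate_apply, Complex.real_smul, mul_div_cancel_left₀ z h2.ne', mul_assoc]
  simp only [e]
  have e2 : f x = ∫ z, K z * f x := by rw [integral_mul_const, hK, one_mul]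
  rw [e2]
  refine tendsto_integral_of_dominated_convergence (fun z => ‖K z‖ * M) (fun J => ?_)
    (K.integrable.norm.mul_const M) (fun J => Eventually.of_forall fun z => ?_)
    (Eventually.of_forall fun z => ?_)
  · exact (K.continuous.mul (hf.comp (by fun_prop))).aestronglyMeasurable
  · rw [norm_mul]
    gcongr
    exact hM _
  · refine Tendsto.const_mul _ ((hf.tendsto x).comp ?_)
    have : Tendsto (fun J : ℕ => x - z * (1 / 2 : ℝ) ^ J) atTop (𝓝 (x - z * 0)) :=
      ((tendsto_pow_atTop_nhds_zero_of_lt_one (by norm_num) (by norm_num)).const_mul z).const_sub x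
    rw [mul_zero, sub_zero] at this
    refine this.congr fun J => ?_
    rw [one_div, inv_pow, div_eq_mul_inv]

/-- The low-frequency truncations of a bounded continuous function converge to it, weakly. -/
theorem tendsto_integral_lowPass_mul (Φ : DyadicPartition) {f : ℝ → ℂ} {M : ℝ}
    (hf : Continuous f) (hM : ∀ x, ‖f x‖ ≤ M) (h : 𝓢(ℝ, ℂ)) :
    Tendsto (fun J => ∫ x, lowPass Φ J h x * f x) atTop (𝓝 (∫ x, h x * f x)) := by
  have hE := EssBdd.of_continuous hf hM
  have e : ∀ J : ℕ, ∫ x, lowPass Φ J h x * f x =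
      ∫ x, h x * kconv ((𝓕 Φ.low).dilate (2 ^ J) (by positivity)) f x := fun J => by
    rw [integral_mul_kconv (SchwartzMap.integrable _) _ h.integrable hE]
    · simp only [lowPass_apply]
    · intro z
      rw [SchwartzMap.dilate_apply, SchwartzMap.dilate_apply, mul_neg,
        SchwartzMap.fourier_neg_of_even (low_neg Φ)]
  simp only [e]
  refine tendsto_integral_of_dominated_convergence
    (fun x => ‖h x‖ * ((∫ z, ‖𝓕 Φ.low z‖) * M)) (fun J => ?_)
    (h.integrable.norm.mul_const _) (fun J => Eventually.of_forall fun x => ?_)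
    (Eventually.of_forall fun x => ?_)
  · exact (h.continuous.mul (kconv_continuous _ hE)).aestronglyMeasurable
  · rw [norm_mul]
    gcongr
    exact norm_kconv_dilate_le _ _ hE x
  · exact (tendsto_kconv_dilate (integral_fourier_low Φ) hf hM x).const_mul _

theorem eq_of_forall_integral_schwartz_mul {f g : ℝ → ℂ} (hf : Continuous f) (hg : Continuous g)
    (h : ∀ k : 𝓢(ℝ, ℂ), ∫ x, k x * f x = ∫ x, k x * g x) : f = g := by
  refine Measure.eq_of_ae_eq (μ := volume) ?_ hf hg
  refine ae_eq_of_integral_contDiff_smul_eq hf.locallyIntegrable hg.locallyIntegrable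
    fun k hk hc => ?_
  have hc' : HasCompactSupport (fun x => (k x : ℂ)) := hc.comp_left (g := Complex.ofReal) rfl
  have hk' : ContDiff ℝ ∞ (fun x => (k x : ℂ)) := Complex.ofRealCLM.contDiff.comp hk
  simp only [Complex.real_smul]
  exact h (hc'.toSchwartzMap hk')

theorem hasSum_integral_mul {v : ℕ → ℝ → ℂ} {a : ℕ → ℝ} (ha : Summable a)
    (hv : ∀ n, Continuous (v n)) (hva : ∀ n x, ‖v n x‖ ≤ a n) {k : ℝ → ℂ} (hk : Integrable k) :
    HasSum (fun n => ∫ x, k x * v n x) (∫ x, k x * ∑' n, v n x) := by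
  simp only [← tsum_mul_left]
  have hE : ∀ n, EssBdd (v n) (a n) := fun n => .of_continuous (hv n) (hva n)
  have hi : ∀ n, Integrable (fun x => k x * v n x) := fun n => (hE n).integrable_mul hk
  refine hasSum_integral_of_summable_integral_norm hi ?_
  refine Summable.of_nonneg_of_le (fun n => integral_nonneg fun x => norm_nonneg _) (fun n => ?_)
    (ha.mul_left (∫ x, ‖k x‖))
  rw [← integral_mul_const]
  refine integral_mono (hi n).norm (hk.norm.mul_const _) fun x => ?_
  simp only [norm_mul]
  gcongr
  exact hva n x

/-- A bounded continuous function is determined by its low-frequency truncations: it is the sum of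
any absolutely convergent series whose partial sums represent them. -/
theorem eq_tsum_of_integral_lowPass (Φ : DyadicPartition) {f : ℝ → ℂ} {M : ℝ}
    (hf : Continuous f) (hM : ∀ x, ‖f x‖ ≤ M) {v : ℕ → ℝ → ℂ} {a : ℕ → ℝ} (ha : Summable a)
    (hv : ∀ n, Continuous (v n)) (hva : ∀ n x, ‖v n x‖ ≤ a n)
    (h : ∀ J (k : 𝓢(ℝ, ℂ)), ∫ x, lowPass Φ J k x * f x =
      ∑ n ∈ Finset.range (J + 1), ∫ x, k x * v n x) :
    f = fun x => ∑' n, v n x := by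
  refine eq_of_forall_integral_schwartz_mul hf (continuous_tsum hv ha hva) fun k => ?_
  refine tendsto_nhds_unique (tendsto_integral_lowPass_mul Φ hf hM k) ?_
  simp only [h]
  exact (hasSum_integral_mul ha hv hva k.integrable).tendsto_sum_nat.comp (tendsto_add_atTop_nat 1)

theorem HolderBd.tsum {a : ℝ} {H b : ℕ → ℝ} {v : ℕ → ℝ → ℂ} (hH : Summable H)
    (hv : ∀ n, HolderBd a (H n) (v n)) (hb : Summable b) (hvb : ∀ n x, ‖v n x‖ ≤ b n) :
    HolderBd a (∑' n, H n) (fun x => ∑' n, v n x) := by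
  intro x y
  have hs : ∀ x, Summable fun n => v n x := fun x => .of_norm_bounded hb fun n => hvb n x
  dsimp only
  rw [← (hs x).tsum_sub (hs y)]
  exact tsum_of_norm_bounded (hH.hasSum.mul_right _) fun n => hv n x y

theorem summable_two_rpow_neg {θ : ℝ} (hθ : 0 < θ) :
    Summable fun n : ℕ => (2 : ℝ) ^ (-((n : ℝ) * θ)) := by
  have h : (2 : ℝ) ^ (-θ) < 1 := Real.rpow_lt_one_of_one_lt_of_neg one_lt_two (by linarith)
  refine (summable_geometric_of_lt_one (by positivity) h).congr fun n => ?_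
  rw [← Real.rpow_natCast, ← Real.rpow_mul (by norm_num)]
  ring_nf

/-- A bound by `X min(1, y)` interpolates to one by `X y^θ`. -/
theorem le_mul_rpow_of_le {a X y θ : ℝ} (hθ0 : 0 ≤ θ) (hθ1 : θ ≤ 1) (hX : 0 ≤ X) (hy : 0 ≤ y)
    (h1 : a ≤ X) (h2 : a ≤ X * y) : a ≤ X * y ^ θ := by
  rcases le_total y 1 with h | h
  · refine h2.trans ?_
    gcongr
    simpa using Real.rpow_le_rpow_of_exponent_ge' hy h hθ0 hθ1
  · refine h1.trans (le_mul_of_one_le_right hX (Real.one_le_rpow h hθ0))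

theorem norm_ofReal_le_of_memLp {f : ℝ → ℝ} (hf : Continuous f)
    (hb : MemLp f ∞ (volume : Measure ℝ)) : ∃ M, ∀ x, ‖(f x : ℂ)‖ ≤ M := by
  have h1 : ∀ᵐ x, ‖f x‖ ≤ (eLpNorm f ∞ volume).toReal := by
    filter_upwards [ae_le_eLpNormEssSup (f := f) (μ := volume)] with x hx
    rw [← toReal_enorm]
    exact ENNReal.toReal_mono hb.2.ne (by rwa [eLpNorm_exponent_top])
  refine ⟨(eLpNorm f ∞ volume).toReal, fun x => ?_⟩
  rw [Complex.norm_real]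
  have hcl : IsClosed {x | ‖f x‖ ≤ (eLpNorm f ∞ volume).toReal} :=
    isClosed_le hf.norm continuous_const
  have hd : Dense {x | ‖f x‖ ≤ (eLpNorm f ∞ volume).toReal} := Measure.dense_of_ae h1
  have := hcl.closure_eq ▸ hd x
  exact this

/-- A function of positive regularity is the sum of its Littlewood–Paley blocks. -/
theorem IsBlockDecomposition.eq_tsum {Φ : DyadicPartition} {C γ A : ℝ} (hγ : 0 < γ) {f : ℝ → ℝ}
    (hf : Continuous f) (hb : MemLp f ∞ (volume : Measure ℝ)) {w : ℕ → ℝ → ℂ}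
    (hw : IsBlockDecomposition Φ C γ A (funDist f) w) (x : ℝ) : (f x : ℂ) = ∑' n, w n x := by
  obtain ⟨M, hM⟩ := norm_ofReal_le_of_memLp hf hb
  refine congrFun (eq_tsum_of_integral_lowPass Φ (f := fun x => (f x : ℂ))
    (Complex.continuous_ofReal.comp hf) hM ((summable_two_rpow_neg hγ).mul_left (C * A))
    hw.continuous hw.bound fun J k => ?_) x
  rw [← hw.sum, funDist_apply hb]

theorem nonneg_of_lt_ofReal {x : ℝ≥0∞} {A : ℝ} (h : x < ENNReal.ofReal A) : 0 ≤ A := by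
  by_contra! hA
  rw [ENNReal.ofReal_of_nonpos hA.le] at h
  exact absurd h (by simp)

/-- A function in `C^γ` is bounded, and Hölder continuous of every order below `γ`. -/
theorem exists_holder_bound (Φ : DyadicPartition) {γ θ : ℝ} (hθ : 0 < θ) (hθγ : θ < γ)
    (hθ1 : θ ≤ 1) : ∃ C : ℝ, 0 ≤ C ∧ ∀ (f : ℝ → ℝ) (A : ℝ), Continuous f →
      MemLp f ∞ (volume : Measure ℝ) → besovNorm Φ γ (funDist f) < ENNReal.ofReal A →
      (∀ x, ‖(f x : ℂ)‖ ≤ C * A) ∧ HolderBd θ (C * A) (fun x => (f x : ℂ)) := by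
  obtain ⟨C, hC, hdec⟩ := exists_isBlockDecomposition Φ γ
  have hs1 := summable_two_rpow_neg (θ := γ) (by linarith)
  have hs2 := summable_two_rpow_neg (θ := γ - θ) (by linarith)
  have hp1 : 0 ≤ ∑' n : ℕ, (2 : ℝ) ^ (-((n : ℝ) * γ)) := tsum_nonneg fun n => by positivity
  have hp2 : 0 ≤ ∑' n : ℕ, (2 : ℝ) ^ (-((n : ℝ) * (γ - θ))) := tsum_nonneg fun n => by positivity
  refine ⟨C * (∑' n : ℕ, (2 : ℝ) ^ (-((n : ℝ) * γ))) +
    2 * C * ∑' n : ℕ, (2 : ℝ) ^ (-((n : ℝ) * (γ - θ))), by positivity, fun f A hf hb hA => ?_⟩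
  obtain ⟨w, hw⟩ := hdec _ A hA
  have hA0 := nonneg_of_lt_ofReal hA
  have e := funext (hw.eq_tsum (by linarith) hf hb)
  have hH : ∀ n : ℕ, HolderBd θ (2 * C * A * 2 ^ (-((n : ℝ) * (γ - θ)))) (w n) := fun n x y => by
    obtain ⟨w', -, hd, hw'⟩ := hw.hasDerivAt n
    have h1 := HolderBd.of_hasDerivAt hd hw' x y
    have h2 := norm_sub_le_of_le (hw.bound n x) (hw.bound n y)
    rw [Real.rpow_one] at h1
    have h3 := le_mul_rpow_of_le (a := ‖w n x - w n y‖) (X := 2 * (C * A * 2 ^ (-((n : ℝ) * γ))))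
      (y := 2 ^ (n : ℝ) * |x - y|) hθ.le hθ1 (by positivity) (by positivity) (by linarith) (by
        refine h1.trans ?_
        have : 0 ≤ C * A * 2 ^ (-((n : ℝ) * γ)) * (2 ^ (n : ℝ) * |x - y|) := by positivity
        linarith)
    refine h3.trans (le_of_eq ?_)
    rw [Real.mul_rpow (by positivity) (abs_nonneg _), ← Real.rpow_mul (by norm_num)]
    have : (2 : ℝ) ^ (-((n : ℝ) * (γ - θ))) = 2 ^ (-((n : ℝ) * γ)) * 2 ^ ((n : ℝ) * θ) := by
      rw [← Real.rpow_add two_pos]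
      ring_nf
    rw [this]
    ring
  rw [e]
  constructor
  · intro x
    rw [hw.eq_tsum (by linarith) hf hb]
    refine (tsum_of_norm_bounded (hs1.mul_left (C * A)).hasSum fun n => hw.bound n x).trans ?_
    rw [tsum_mul_left]
    have : 0 ≤ 2 * C * (∑' n : ℕ, (2 : ℝ) ^ (-((n : ℝ) * (γ - θ)))) * A := by positivity
    linarith
  · intro x y
    refine (HolderBd.tsum (hs2.mul_left (2 * C * A)) hH (hs1.mul_left (C * A)) hw.bound x y).trans ?_
    rw [tsum_mul_left]
    have : 0 ≤ C * (∑' n : ℕ, (2 : ℝ) ^ (-((n : ℝ) * γ))) * A := by positivity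
    refine mul_le_mul_of_nonneg_right ?_ (by positivity)
    linarith

/-- A function in `C^{1+ν}` is differentiable with a bounded derivative. -/
theorem exists_deriv_bound (Φ : DyadicPartition) {ν : ℝ} (hν : 0 < ν) :
    ∃ C : ℝ, 0 ≤ C ∧ ∀ (f : ℝ → ℝ) (A : ℝ), Continuous f →
      MemLp f ∞ (volume : Measure ℝ) → besovNorm Φ (1 + ν) (funDist f) < ENNReal.ofReal A →
      ∃ f' : ℝ → ℂ, (∀ x, HasDerivAt (fun x => (f x : ℂ)) (f' x) x) ∧ ∀ x, ‖f' x‖ ≤ C * A := by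
  obtain ⟨C, hC, hdec⟩ := exists_isBlockDecomposition Φ (1 + ν)
  have hs := summable_two_rpow_neg hν
  have hs1 := summable_two_rpow_neg (θ := 1 + ν) (by linarith)
  have hp : 0 ≤ ∑' n : ℕ, (2 : ℝ) ^ (-((n : ℝ) * ν)) := tsum_nonneg fun n => by positivity
  refine ⟨C * ∑' n : ℕ, (2 : ℝ) ^ (-((n : ℝ) * ν)), by positivity, fun f A hf hb hA => ?_⟩
  obtain ⟨w, hw⟩ := hdec _ A hA
  have e := funext (hw.eq_tsum (by linarith) hf hb)
  choose w' hw'c hw'd hw'b using hw.hasDerivAt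
  have hb' : ∀ n x, ‖w' n x‖ ≤ C * A * 2 ^ (-((n : ℝ) * ν)) := fun n x => by
    refine (hw'b n x).trans (le_of_eq ?_)
    rw [mul_assoc, ← Real.rpow_add two_pos]
    ring_nf
  rw [e]
  refine ⟨fun x => ∑' n, w' n x, hasDerivAt_tsum (y₀ := 0) (hs.mul_left (C * A)) hw'd hb'
    (.of_norm_bounded (hs1.mul_left (C * A)) fun n => hw.bound n 0), fun x => ?_⟩
  refine (tsum_of_norm_bounded (hs.mul_left (C * A)).hasSum fun n => hb' n x).trans (le_of_eq ?_)
  rw [tsum_mul_left]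
  ring

theorem besovNorm_le_of_le (Φ : DyadicPartition) {γ γ' : ℝ} (h : γ ≤ γ') (u : 𝓢'(ℝ, ℂ)) :
    besovNorm Φ γ u ≤ ENNReal.ofReal (2 ^ (γ' - γ)) * besovNorm Φ γ' u := by
  have h1 : (1 : ℝ) ≤ 2 ^ (γ' - γ) := Real.one_le_rpow one_le_two (by linarith)
  refine max_le ?_ (iSup_le fun j => ?_)
  · have e : ENNReal.ofReal ((2 : ℝ) ^ (-γ)) =
        ENNReal.ofReal (2 ^ (γ' - γ)) * ENNReal.ofReal ((2 : ℝ) ^ (-γ')) := by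
      rw [← ENNReal.ofReal_mul (by positivity), ← Real.rpow_add two_pos]
      ring_nf
    rw [e, mul_assoc]
    gcongr
    exact le_max_left _ _
  · have h2 : ENNReal.ofReal ((2 : ℝ) ^ ((j : ℝ) * γ)) ≤
        ENNReal.ofReal ((2 : ℝ) ^ ((j : ℝ) * γ')) :=
      ENNReal.ofReal_le_ofReal (Real.rpow_le_rpow_of_exponent_le one_le_two (by gcongr))
    have h3 : (1 : ℝ≥0∞) ≤ ENNReal.ofReal (2 ^ (γ' - γ)) := by
      rwa [← ENNReal.ofReal_one, ENNReal.ofReal_le_ofReal_iff (by positivity)]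
    refine le_trans ?_ (le_mul_of_one_le_left zero_le h3)
    refine le_trans ?_ (le_max_right _ _)
    refine le_trans ?_ (le_iSup (fun j : ℕ => ENNReal.ofReal ((2 : ℝ) ^ ((j : ℝ) * γ')) *
      linftyNorm (TemperedDistribution.fourierMultiplierCLM ℂ
        (fun ξ : ℝ => (Φ.φ (ξ / 2 ^ j) : ℂ)) u)) j)
    gcongr

/-! ### The regularised drift -/

theorem heatSchwartz_eq_heat {t : ℝ} (ht : 0 < t) (h : 𝓢(ℝ, ℂ)) :
    (heatSchwartz t h : ℝ → ℂ) = heat t h :=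
  funext fun x => heatSchwartz_apply ht h x

theorem heatSchwartz_lowPass (Φ : DyadicPartition) (J : ℕ) {t : ℝ} (ht : 0 < t) (h : 𝓢(ℝ, ℂ)) :
    heatSchwartz t (lowPass Φ J h) = lowPass Φ J (heatSchwartz t h) := by
  obtain ⟨M, hM⟩ : ∃ M, ∀ x, ‖h x‖ ≤ M :=
    ⟨_, fun x => SchwartzMap.norm_le_seminorm ℝ h x⟩
  have hE := EssBdd.of_continuous h.continuous hM
  ext x
  rw [heatSchwartz_eq_heat ht, lowPass_apply, heatSchwartz_eq_heat ht,
    funext (lowPass_apply Φ J h), heat, heat,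
    kconv_assoc (integrable_ofReal_heatKernel ht) (SchwartzMap.integrable _) hE,
    kconv_assoc (SchwartzMap.integrable _) (integrable_ofReal_heatKernel ht) hE,
    kconv_comm (fun z => (heatKernel t z : ℂ))]

theorem heat_tsum {t : ℝ} (ht : 0 < t) {v : ℕ → ℝ → ℂ} {a : ℕ → ℝ} (ha : Summable a)
    (hv : ∀ n, Continuous (v n)) (hva : ∀ n x, ‖v n x‖ ≤ a n) (x : ℝ) :
    heat t (fun y => ∑' n, v n y) x = ∑' n, heat t (v n) x :=
  (hasSum_integral_mul ha hv hva ((integrable_ofReal_heatKernel ht).comp_sub_left x)).tsum_eq.symm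

theorem integral_heatSchwartz_mul {t M : ℝ} (ht : 0 < t) (h : 𝓢(ℝ, ℂ)) {f : ℝ → ℂ}
    (hf : EssBdd f M) : ∫ x, heatSchwartz t h x * f x = ∫ x, h x * heat t f x := by
  rw [heat, integral_mul_kconv (integrable_ofReal_heatKernel ht) (fun z => by rw [heatKernel_neg])
    h.integrable hf]
  simp only [heatSchwartz_eq_heat ht]
  rfl

/-- Smoothing of the blocks of a distribution in `C^{-b}`. The block `w n`, `n ≥ 1`, is the derivative
of a function that is smaller by a factor `2^{-n}`, and this derivative can be moved to the heat
kernel at the cost of `r^{-1/2}`; interpolating this with the trivial bound costs only `r^{-c/2}` and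
leaves a factor that is summable in `n` if `b < c`. The block `w 0` has no antiderivative of that kind,
and for it the bound `r ≤ T + 1` is used. -/
theorem IsBlockDecomposition.norm_heat_block_le {Φ : DyadicPartition} {C b A T c : ℝ} (hC : 0 ≤ C)
    (hA : 0 ≤ A) (hT : 0 ≤ T) (hc : 0 ≤ c) (hc1 : c ≤ 1) {u : 𝓢'(ℝ, ℂ)} {w : ℕ → ℝ → ℂ}
    (hw : IsBlockDecomposition Φ C (-b) A u w) (n : ℕ) {r : ℝ} (hr : r ∈ Ioc 0 (T + 1)) (x : ℝ) :
    ‖heat r (w n) x‖ ≤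
      2 * C * (T + 1) ^ (c / 2) * A * 2 ^ (-((n : ℝ) * (c - b))) * r ^ (-(c / 2)) := by
  have hT1 : (1 : ℝ) ≤ (T + 1) ^ (c / 2) := Real.one_le_rpow (by linarith) (by linarith)
  have hr0 : 0 < r := hr.1
  have hEw := EssBdd.of_continuous (hw.continuous n) (hw.bound n)
  have hb := norm_heat_le hr.1 hEw x
  rcases eq_or_ne n 0 with rfl | hn
  · simp only [Nat.cast_zero, zero_mul, neg_zero, Real.rpow_zero, mul_one] at hb ⊢
    have h1 : 1 ≤ (T + 1) ^ (c / 2) * r ^ (-(c / 2)) := by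
      rw [Real.rpow_neg hr0.le, ← div_eq_mul_inv, one_le_div (by positivity)]
      exact Real.rpow_le_rpow hr0.le hr.2 (by linarith)
    have h2 : 0 ≤ C * A := by positivity
    calc _ ≤ 2 * (C * A) * 1 := by linarith
      _ ≤ 2 * (C * A) * ((T + 1) ^ (c / 2) * r ^ (-(c / 2))) := by gcongr
      _ = _ := by ring
  · obtain ⟨v, hv, hvb⟩ := hw.antideriv n hn
    have hEv : EssBdd v _ := .of_continuous
      (continuous_iff_continuousAt.2 fun x => (hv x).continuousAt) hvb
    have e : heat r (w n) x = heatD r v x :=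
      (hasDerivAt_heat_right hr.1 hEv hv (hw.bound n) x).unique (hasDerivAt_heat hr.1 hEv x)
    have h2 := norm_heatD_le hr.1 hEv x
    rw [← e] at h2
    have hX : 0 ≤ C * A * 2 ^ (-((n : ℝ) * -b)) := by positivity
    have h3 := le_mul_rpow_of_le (X := 2 * (C * A * 2 ^ (-((n : ℝ) * -b))))
      (y := 2 ^ (-(n : ℝ)) * r ^ (-(1 / 2) : ℝ)) hc hc1 (by positivity) (by positivity)
      (by linarith) (h2.trans (le_of_eq (by ring)))
    refine h3.trans ?_
    have e1 : (2 ^ (-(n : ℝ)) * r ^ (-(1 / 2) : ℝ)) ^ c = 2 ^ (-((n : ℝ) * c)) * r ^ (-(c / 2)) := by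
      rw [Real.mul_rpow (by positivity) (by positivity), ← Real.rpow_mul (by norm_num),
        ← Real.rpow_mul hr0.le]
      ring_nf
    have e2 : (2 : ℝ) ^ (-((n : ℝ) * (c - b))) = 2 ^ (-((n : ℝ) * -b)) * 2 ^ (-((n : ℝ) * c)) := by
      rw [← Real.rpow_add two_pos]
      ring_nf
    rw [e1, e2]
    have h4 : 0 ≤ 2 * (C * A * 2 ^ (-((n : ℝ) * -b))) * (2 ^ (-((n : ℝ) * c)) * r ^ (-(c / 2))) := by
      positivity
    calc _ ≤ (T + 1) ^ (c / 2) *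
          (2 * (C * A * 2 ^ (-((n : ℝ) * -b))) * (2 ^ (-((n : ℝ) * c)) * r ^ (-(c / 2)))) :=
          le_mul_of_one_le_left h4 hT1
      _ = _ := by ring

/-- The size of `P_{1/N} u` for `u ∈ C^{-b}`, measured in the scale of the heat semigroup and, with
a loss of powers of `N`, in the supremum and Lipschitz norms. -/
theorem exists_regularised_bound (Φ : DyadicPartition) {T b c : ℝ} (hT : 0 ≤ T) (hbc : b < c)
    (hc : 0 ≤ c) (hc1 : c ≤ 1) : ∃ C : ℝ, 0 ≤ C ∧ ∀ (u : 𝓢'(ℝ, ℂ)) (A : ℝ),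
      besovNorm Φ (-b) u < ENNReal.ofReal A → ∀ (N : ℝ) (d : ℝ → ℝ), 1 ≤ N →
      IsBoundedFun (heatSemigroup (1 / N) u) d →
      (∀ x, ‖(d x : ℂ)‖ ≤ C * A * N ^ (c / 2)) ∧
      HolderBd 1 (C * A * N ^ ((c + 1) / 2)) (fun x => (d x : ℂ)) ∧
      ∀ s ∈ Ioc 0 T, ∀ x, ‖heat s (fun x => (d x : ℂ)) x‖ ≤ C * A * s ^ (-(c / 2)) := by
  obtain ⟨C, hC, hdec⟩ := exists_isBlockDecomposition Φ (-b)
  have hs := summable_two_rpow_neg (θ := c - b) (by linarith)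
  set S : ℝ := ∑' n : ℕ, (2 : ℝ) ^ (-((n : ℝ) * (c - b))) with hS
  have hS0 : 0 ≤ S := tsum_nonneg fun n => by positivity
  set K : ℝ := 2 * C * (T + 1) ^ (c / 2) with hK
  have hK0 : 0 ≤ K := by positivity
  refine ⟨4 * (K * S), by positivity, fun u A hA N d hN hd => ?_⟩
  obtain ⟨w, hw⟩ := hdec _ A hA
  have hA0 := nonneg_of_lt_ofReal hA
  have hN0 : 0 < N := by linarith
  have hδ : 0 < 1 / N := by positivity
  have hδ1 : 1 / N ≤ 1 := by rw [div_le_one hN0]; exact hN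
  have hEw : ∀ n, EssBdd (w n) _ := fun n => EssBdd.of_continuous (hw.continuous n) (hw.bound n)
  have hheat : ∀ n, ∀ r ∈ Ioc 0 (T + 1), ∀ x, ‖heat r (w n) x‖ ≤
      K * A * 2 ^ (-((n : ℝ) * (c - b))) * r ^ (-(c / 2)) := fun n r hr x =>
    hw.norm_heat_block_le hC hA0 hT hc hc1 n hr x
  have hNp : ∀ p : ℝ, (1 / N) ^ (-p) = N ^ p := fun p => by
    rw [one_div, Real.inv_rpow hN0.le, Real.rpow_neg hN0.le, inv_inv]
  have hmem : 1 / N ∈ Ioc 0 (T + 1) := ⟨hδ, by linarith⟩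
  have hv : ∀ n x, ‖heat (1 / N) (w n) x‖ ≤
      K * A * N ^ (c / 2) * 2 ^ (-((n : ℝ) * (c - b))) := fun n x => by
    refine (hheat n _ hmem x).trans (le_of_eq ?_)
    rw [hNp]
    ring
  have hvc : ∀ n, Continuous (heat (1 / N) (w n)) := fun n => continuous_heat hδ (hEw n)
  have hsum := hs.mul_left (K * A * N ^ (c / 2))
  obtain ⟨M, hM⟩ := norm_ofReal_le_of_memLp hd.cont hd.bdd
  have e : (fun x => (d x : ℂ)) = fun x => ∑' n, heat (1 / N) (w n) x := by
    refine eq_tsum_of_integral_lowPass Φ (f := fun x => (d x : ℂ))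
      (Complex.continuous_ofReal.comp hd.cont) hM hsum hvc hv fun J k => ?_
    rw [← funDist_apply hd.bdd, hd.eq, heatSemigroup_apply, heatSchwartz_lowPass Φ J hδ, hw.sum]
    exact Finset.sum_congr rfl fun n _ => integral_heatSchwartz_mul hδ k (hEw n)
  have hle : K * S * A ≤ 4 * (K * S) * A := by
    have : 0 ≤ K * S * A := by positivity
    linarith
  refine ⟨fun x => ?_, ?_, fun s hs' x => ?_⟩
  · rw [congrFun e x]
    refine (tsum_of_norm_bounded hsum.hasSum fun n => hv n x).trans ?_
    rw [tsum_mul_left]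
    calc _ = K * S * A * N ^ (c / 2) := by ring
      _ ≤ _ := by gcongr
  · have hL : ∀ n : ℕ, HolderBd 1 (4 * (K * A) * N ^ ((c + 1) / 2) * 2 ^ (-((n : ℝ) * (c - b))))
        (heat (1 / N) (w n)) := fun n => by
      refine HolderBd.of_hasDerivAt (fun x => hasDerivAt_heat hδ (hEw n) x) fun x => ?_
      refine (heatD_le_of_heat_le (hEw n) hc1 (hheat n) hmem x).trans (le_of_eq ?_)
      rw [hNp]
      ring
    rw [e]
    have h1 := HolderBd.tsum (hs.mul_left (4 * (K * A) * N ^ ((c + 1) / 2))) hL hsum hv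
    rw [tsum_mul_left] at h1
    convert h1 using 1
    ring
  · rw [e, heat_tsum hs'.1 hsum hvc hv]
    have hr : s + 1 / N ∈ Ioc 0 (T + 1) := ⟨by linarith [hs'.1], by linarith [hs'.2]⟩
    have h1 : ∀ n, ‖heat s (heat (1 / N) (w n)) x‖ ≤
        K * A * s ^ (-(c / 2)) * 2 ^ (-((n : ℝ) * (c - b))) := fun n => by
      rw [heat_heat hs'.1 hδ (hEw n)]
      refine (hheat n _ hr x).trans ?_
      have : (s + 1 / N) ^ (-(c / 2)) ≤ s ^ (-(c / 2)) :=
        Real.rpow_le_rpow_of_nonpos hs'.1 (by linarith) (by linarith)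
      calc _ ≤ K * A * 2 ^ (-((n : ℝ) * (c - b))) * s ^ (-(c / 2)) := by gcongr
        _ = _ := by ring
    refine (tsum_of_norm_bounded (hs.mul_left _).hasSum h1).trans ?_
    rw [tsum_mul_left]
    have := hs'.1
    calc _ = K * S * A * s ^ (-(c / 2)) := by ring
      _ ≤ _ := by gcongr

/-! ### From the weak mild formulation to a pointwise Duhamel formula -/

/-- The translated heat kernel `y ↦ p_ε(y - x)`, a test function. -/
noncomputable def heatTest (ε : ℝ) (hε : 0 < ε) (x : ℝ) : 𝓢(ℝ, ℂ) :=
  SchwartzMap.compSubConstCLM ℂ x (heatKernelSchwartz ε hε)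

theorem heatTest_apply {ε : ℝ} (hε : 0 < ε) (x y : ℝ) :
    heatTest ε hε x y = (heatKernel ε (x - y) : ℂ) := by
  rw [← heatKernel_neg, neg_sub]
  rfl

theorem funDist_heatTest {f : ℝ → ℝ} (hf : MemLp f ∞ (volume : Measure ℝ)) {ε : ℝ} (hε : 0 < ε)
    (x : ℝ) : funDist f (heatTest ε hε x) = heat ε (fun y => (f y : ℂ)) x := by
  rw [funDist_apply hf]
  simp only [heatTest_apply]
  rfl

theorem heatSchwartz_heatTest {t ε : ℝ} (ht : 0 < t) (hε : 0 < ε) (x : ℝ) :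
    heatSchwartz t (heatTest ε hε x) = heatTest (t + ε) (add_pos ht hε) x := by
  ext y
  have h := congrFun (kconv_heatKernel ht hε) (y - x)
  rw [heatTest_apply, heatSchwartz_apply ht, ← heatKernel_neg (t + ε), neg_sub, ← h,
    kconv_eq_integral,
    ← integral_sub_left_eq_self _ _ y]
  refine integral_congr_ae (Eventually.of_forall fun z => ?_)
  simp only [heatTest_apply, sub_sub_cancel]
  rw [← heatKernel_neg ε]
  congr 3
  ring

theorem heatSemigroup_funDist_heatTest {f : ℝ → ℝ} (hf : MemLp f ∞ (volume : Measure ℝ))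
    {t ε : ℝ} (ht : 0 < t) (hε : 0 < ε) (x : ℝ) :
    heatSemigroup t (funDist f) (heatTest ε hε x) = heat (t + ε) (fun y => (f y : ℂ)) x := by
  rw [heatSemigroup_apply, heatSchwartz_heatTest ht, funDist_heatTest hf]

theorem heatSemigroup_derivCLM_funDist_heatTest {f : ℝ → ℝ}
    (hf : MemLp f ∞ (volume : Measure ℝ)) {t ε : ℝ} (ht : 0 < t) (hε : 0 < ε) (x : ℝ) :
    heatSemigroup t (TemperedDistribution.derivCLM ℂ (funDist f)) (heatTest ε hε x) =
      heatD (t + ε) (fun y => (f y : ℂ)) x := by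
  rw [heatSemigroup_apply, heatSchwartz_heatTest ht, TemperedDistribution.derivCLM_apply_apply,
    funDist_apply hf, heatD, kconv]
  refine integral_congr_ae (Eventually.of_forall fun y => ?_)
  have e : (heatTest (t + ε) (add_pos ht hε) x : ℝ → ℂ) =
      fun y => (fun z => (heatKernel (t + ε) z : ℂ)) (x - y) :=
    funext fun y => heatTest_apply _ x y
  simp only [neg_apply, SchwartzMap.derivCLM_apply]
  rw [e, deriv_comp_const_sub (f := fun z => (heatKernel (t + ε) z : ℂ)), neg_neg]

theorem heatSemigroup_zero (u : 𝓢'(ℝ, ℂ)) : heatSemigroup 0 u = u := by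
  ext f
  rw [heatSemigroup_apply, heatSchwartz, dif_neg (lt_irrefl 0)]
  rfl

theorem tendsto_heat {a H M : ℝ} {f : ℝ → ℂ} (ha : 0 < a) (ha2 : a ≤ 2) (hf : EssBdd f M)
    (hH : HolderBd a H f) (x : ℝ) :
    Tendsto (fun n : ℕ => heat (1 / ((n : ℝ) + 1)) f x) atTop (𝓝 (f x)) := by
  rw [tendsto_iff_norm_sub_tendsto_zero]
  refine squeeze_zero (fun n => norm_nonneg _)
    (fun n => norm_heat_sub_self_le (by positivity) ha.le ha2 hf hH x) ?_
  have h := (tendsto_one_div_add_atTop_nhds_zero_nat (𝕜 := ℝ)).rpow_const (p := a / 2)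
    (Or.inr (by positivity))
  rw [Real.zero_rpow (by positivity)] at h
  simpa using h.const_mul (2 * H)

theorem tendsto_heat_add {t M : ℝ} {f : ℝ → ℂ} (ht : 0 < t) (hf : EssBdd f M) (x : ℝ) :
    Tendsto (fun n : ℕ => heat (t + 1 / ((n : ℝ) + 1)) f x) atTop (𝓝 (heat t f x)) := by
  have h := tendsto_heat one_pos one_le_two (essBdd_heat ht hf)
    (HolderBd.of_hasDerivAt (hasDerivAt_heat ht hf) (norm_heatD_le ht hf)) x
  refine h.congr fun n => ?_
  rw [heat_heat (by positivity) ht hf, add_comm]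

theorem tendsto_heatD_add {t M : ℝ} {f : ℝ → ℂ} (ht : 0 < t) (hf : EssBdd f M) (x : ℝ) :
    Tendsto (fun n : ℕ => heatD (t + 1 / ((n : ℝ) + 1)) f x) atTop (𝓝 (heatD t f x)) := by
  have h2 : 0 < t / 2 := by linarith
  have h := tendsto_heat one_pos one_le_two (essBdd_heatD ht hf)
    (HolderBd.of_hasDerivAt (hasDerivAt_heatD ht hf)
      (norm_heatD_le h2 (essBdd_heatD h2 hf))) x
  refine h.congr fun n => ?_
  rw [heat_heatD (by positivity) ht hf, add_comm]

theorem memLp_top_of_continuous {f : ℝ → ℝ} (hf : Continuous f) {M : ℝ}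
    (hM : ∀ x, ‖(f x : ℂ)‖ ≤ M) : MemLp f ∞ (volume : Measure ℝ) :=
  memLp_top_of_bound hf.aestronglyMeasurable M
    (Eventually.of_forall fun x => by simpa only [Complex.norm_real] using hM x)

theorem IsMildSolution.eq_initial {Φ : DyadicPartition} {T β : ℝ} {F ρ₀ : ℝ → ℝ}
    {d ρ : ℝ → ℝ → ℝ} (h : IsMildSolution Φ T β F ρ₀ d ρ) (hT : 0 ≤ T) (hρ₀ : Continuous ρ₀)
    (hb : MemLp ρ₀ ∞ (volume : Measure ℝ)) : ρ 0 = ρ₀ := by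
  have h0 : (0 : ℝ) ∈ Icc 0 T := ⟨le_rfl, hT⟩
  have e : (fun x => (ρ 0 x : ℂ)) = fun x => (ρ₀ x : ℂ) := by
    refine eq_of_forall_integral_schwartz_mul (Complex.continuous_ofReal.comp (h.cont 0 h0))
      (Complex.continuous_ofReal.comp hρ₀) fun k => ?_
    have := h.mild 0 h0 k
    rwa [intervalIntegral.integral_same, sub_zero, heatSemigroup_zero, funDist_apply (h.bdd 0 h0),
      funDist_apply hb] at this
  exact funext fun x => Complex.ofReal_injective (congrFun e x)

/-- The mild formulation, tested against the heat kernel at time `ε → 0`, is the Duhamel formula.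
The nonlinearity `q s` stands for `F̃(ρ(s)) d(s)`. -/
theorem IsMildSolution.duhamel {Φ : DyadicPartition} {T β : ℝ} {F ρ₀ : ℝ → ℝ}
    {d ρ : ℝ → ℝ → ℝ} (h : IsMildSolution Φ T β F ρ₀ d ρ) (hρ₀ : Continuous ρ₀)
    (hb : MemLp ρ₀ ∞ (volume : Measure ℝ)) {a m G : ℝ} (ha : 0 < a) (ha2 : a ≤ 2)
    (hm : ∀ t ∈ Icc 0 T, (∀ x, ‖(ρ t x : ℂ)‖ ≤ m) ∧ HolderBd a m (fun x => (ρ t x : ℂ)))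
    {q : ℝ → ℝ → ℝ} (hq : ∀ s x, q s x = (ρ s x * F (ρ s x)) * d s x)
    (hqc : ∀ t ∈ Icc 0 T, Continuous (q t)) (hqG : ∀ t ∈ Icc 0 T, ∀ x, ‖(q t x : ℂ)‖ ≤ G)
    {t : ℝ} (ht : t ∈ Ioc 0 T) (x : ℝ) :
    IntervalIntegrable (fun s => heatD (t - s) (fun y => (q s y : ℂ)) x) volume 0 t ∧
      (ρ t x : ℂ) = heat t (fun y => (ρ₀ y : ℂ)) x -
        ∫ s in (0 : ℝ)..t, heatD (t - s) (fun y => (q s y : ℂ)) x := by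
  have htI : t ∈ Icc 0 T := ⟨ht.1.le, ht.2⟩
  have hq' : ∀ s, (fun x => (ρ s x * F (ρ s x)) * d s x) = q s := fun s =>
    funext fun x => (hq s x).symm
  have hint := h.integrable t htI
  have hmild := h.mild t htI
  simp only [hq'] at hint hmild
  have hsI : ∀ s ∈ Ioo 0 t, s ∈ Icc 0 T := fun s hs => ⟨hs.1.le, hs.2.le.trans ht.2⟩
  have hqE : ∀ s ∈ Ioo 0 t, EssBdd (fun y => (q s y : ℂ)) G := fun s hs =>
    .of_continuous (Complex.continuous_ofReal.comp (hqc s (hsI s hs))) (hqG s (hsI s hs))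
  have hε : ∀ n : ℕ, (0 : ℝ) < 1 / ((n : ℝ) + 1) := fun n => by positivity
  -- the endpoint `s = t`, where the heat semigroup degenerates, has measure zero
  have hae : ∀ᵐ s : ℝ, s ∈ uIoc 0 t → s ∈ Ioo 0 t := by
    have : ∀ᵐ s : ℝ, s ≠ t := by simp [ae_iff]
    filter_upwards [this] with s hs hs2
    rw [uIoc_of_le ht.1.le] at hs2
    exact ⟨hs2.1, lt_of_le_of_ne hs2.2 hs⟩
  have hae' : ∀ᵐ s : ℝ ∂(volume.restrict (uIoc 0 t)), s ∈ Ioo 0 t :=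
    (ae_restrict_iff' measurableSet_uIoc).2 hae
  have hcongr : ∀ n : ℕ, ∀ s ∈ Ioo 0 t,
      heatSemigroup (t - s) (TemperedDistribution.derivCLM ℂ (funDist (q s)))
        (heatTest _ (hε n) x) = heatD (t - s + 1 / ((n : ℝ) + 1)) (fun y => (q s y : ℂ)) x :=
    fun n s hs => heatSemigroup_derivCLM_funDist_heatTest
      (memLp_top_of_continuous (hqc s (hsI s hs)) (hqG s (hsI s hs))) (sub_pos.2 hs.2) (hε n) x
  have hmeas : ∀ n : ℕ, AEStronglyMeasurable
      (fun s => heatD (t - s + 1 / ((n : ℝ) + 1)) (fun y => (q s y : ℂ)) x)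
      (volume.restrict (uIoc 0 t)) := fun n => by
    refine (hint (heatTest _ (hε n) x)).def'.aestronglyMeasurable.congr ?_
    filter_upwards [hae'] with s hs
    exact hcongr n s hs
  have hlim : ∀ s ∈ Ioo 0 t, Tendsto
      (fun n : ℕ => heatD (t - s + 1 / ((n : ℝ) + 1)) (fun y => (q s y : ℂ)) x) atTop
      (𝓝 (heatD (t - s) (fun y => (q s y : ℂ)) x)) := fun s hs =>
    tendsto_heatD_add (sub_pos.2 hs.2) (hqE s hs) x
  have hbi : IntervalIntegrable (fun s => 2 * G * (t - s) ^ (-(1 / 2) : ℝ)) volume 0 t :=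
    (intervalIntegrable_sub_rpow (by norm_num) t).const_mul _
  constructor
  · refine hbi.mono_fun (aestronglyMeasurable_of_tendsto_ae atTop hmeas ?_) ?_
    · filter_upwards [hae'] with s hs using hlim s hs
    · filter_upwards [hae'] with s hs
      exact (norm_heatD_le (sub_pos.2 hs.2) (hqE s hs) x).trans (le_abs_self _)
  · have e : ∀ n : ℕ, heat (1 / ((n : ℝ) + 1)) (fun y => (ρ t y : ℂ)) x =
        heat (t + 1 / ((n : ℝ) + 1)) (fun y => (ρ₀ y : ℂ)) x -
          ∫ s in (0 : ℝ)..t, heatD (t - s + 1 / ((n : ℝ) + 1)) (fun y => (q s y : ℂ)) x := by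
      intro n
      have h1 := hmild (heatTest _ (hε n) x)
      rw [funDist_heatTest (h.bdd t htI), heatSemigroup_funDist_heatTest hb ht.1] at h1
      rw [h1]
      congr 1
      refine intervalIntegral.integral_congr_ae ?_
      filter_upwards [hae] with s hs hs2
      exact hcongr n s (hs hs2)
    obtain ⟨M₀, hM₀⟩ := norm_ofReal_le_of_memLp hρ₀ hb
    have hE₀ : EssBdd (fun y => (ρ₀ y : ℂ)) M₀ :=
      .of_continuous (Complex.continuous_ofReal.comp hρ₀) hM₀
    have l1 := tendsto_heat (f := fun y => (ρ t y : ℂ)) ha ha2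
      (.of_continuous (Complex.continuous_ofReal.comp (h.cont t htI)) (hm t htI).1) (hm t htI).2 x
    simp only [e] at l1
    refine tendsto_nhds_unique l1 ((tendsto_heat_add ht.1 hE₀ x).sub ?_)
    refine intervalIntegral.tendsto_integral_filter_of_dominated_convergence
      (fun s => 2 * G * (t - s) ^ (-(1 / 2) : ℝ)) (Eventually.of_forall hmeas)
      (Eventually.of_forall fun n => ?_) hbi ?_
    · filter_upwards [hae] with s hs hs2
      have h1 := sub_pos.2 (hs hs2).2
      have hG := (hqE s (hs hs2)).nonneg
      refine (norm_heatD_le (by linarith [hε n]) (hqE s (hs hs2)) x).trans ?_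
      refine mul_le_mul_of_nonneg_left ?_ (by positivity)
      exact Real.rpow_le_rpow_of_nonpos h1 (by linarith [hε n]) (by norm_num)
    · filter_upwards [hae] with s hs hs2 using hlim s (hs hs2)

/-! ### Bounds that are uniform in time -/

theorem lt_ofReal_toReal_add_one {x : ℝ≥0∞} (hx : x < ⊤) : x < ENNReal.ofReal (x.toReal + 1) := by
  rw [ENNReal.lt_ofReal_iff_toReal_lt hx.ne]
  linarith

theorem linftyNorm_add_le (u v : 𝓢'(ℝ, ℂ)) : linftyNorm (u + v) ≤ linftyNorm u + linftyNorm v := by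
  unfold linftyNorm
  simp only [ENNReal.iInf_add, ENNReal.add_iInf]
  refine le_iInf fun f => le_iInf fun hf => le_iInf fun g => le_iInf fun hg => ?_
  refine iInf_le_of_le (g + f) (iInf_le_of_le ?_ (enorm_add_le g f))
  have := map_add (Lp.toTemperedDistributionCLM ℂ (volume : Measure ℝ) ∞) g f
  rw [← hf, ← hg]
  exact this

theorem besovNorm_add_le (Φ : DyadicPartition) (γ : ℝ) (u v : 𝓢'(ℝ, ℂ)) :
    besovNorm Φ γ (u + v) ≤ besovNorm Φ γ u + besovNorm Φ γ v := by
  refine max_le ?_ (iSup_le fun j => ?_)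
  · rw [map_add]
    refine (mul_le_mul_right (linftyNorm_add_le _ _) _).trans ?_
    rw [mul_add]
    exact add_le_add (le_max_left _ _) (le_max_left _ _)
  · rw [map_add]
    refine (mul_le_mul_right (linftyNorm_add_le _ _) _).trans ?_
    rw [mul_add]
    have h : ∀ u : 𝓢'(ℝ, ℂ), ENNReal.ofReal ((2 : ℝ) ^ ((j : ℝ) * γ)) *
        linftyNorm (TemperedDistribution.fourierMultiplierCLM ℂ
          (fun ξ : ℝ => (Φ.φ (ξ / 2 ^ j) : ℂ)) u) ≤ besovNorm Φ γ u := fun u =>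
      (le_iSup (fun j : ℕ => ENNReal.ofReal ((2 : ℝ) ^ ((j : ℝ) * γ)) *
        linftyNorm (TemperedDistribution.fourierMultiplierCLM ℂ
          (fun ξ : ℝ => (Φ.φ (ξ / 2 ^ j) : ℂ)) u)) j).trans (le_max_right _ _)
    exact add_le_add (h u) (h v)

theorem MemHolderT.normCT_lt_top {Φ : DyadicPartition} {T κ γ : ℝ} {u : ℝ → 𝓢'(ℝ, ℂ)}
    (h : MemHolderT Φ T κ γ u) (hT : 0 ≤ T) (hκ : 0 ≤ κ) : normCT Φ T γ u < ⊤ := by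
  obtain ⟨K, hK⟩ := h.holder
  have h0 : (0 : ℝ) ∈ Icc 0 T := ⟨le_rfl, hT⟩
  have hle : normCT Φ T γ u ≤ K * ENNReal.ofReal (T ^ κ) + besovNorm Φ γ (u 0) := by
    refine iSup₂_le fun t ht => ?_
    have h1 := besovNorm_add_le Φ γ (u t - u 0) (u 0)
    rw [sub_add_cancel] at h1
    refine h1.trans (add_le_add_left ((hK t ht 0 h0).trans ?_) _)
    have : |t - 0| ^ κ ≤ T ^ κ := by
      rw [sub_zero, abs_of_nonneg ht.1]
      exact Real.rpow_le_rpow ht.1 ht.2 hκ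
    gcongr
  exact hle.trans_lt (ENNReal.add_lt_top.2
    ⟨ENNReal.mul_lt_top ENNReal.coe_lt_top ENNReal.ofReal_lt_top, h.finite 0 h0⟩)

theorem funDist_sub {f g : ℝ → ℝ} (hf : MemLp f ∞ (volume : Measure ℝ))
    (hg : MemLp g ∞ (volume : Measure ℝ)) :
    funDist (fun x => f x - g x) = funDist f - funDist g := by
  have hE : ∀ {f : ℝ → ℝ}, MemLp f ∞ (volume : Measure ℝ) → ∀ k : 𝓢(ℝ, ℂ),
      Integrable (fun x => k x * (f x : ℂ)) := fun {f} hf k => by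
    have h1 : MemLp (fun x => (f x : ℂ)) ∞ (volume : Measure ℝ) := hf.ofReal
    exact k.integrable.mul_of_top_left h1
  ext k
  have h1 : funDist (fun x => f x - g x) k = funDist f k - funDist g k := by
    rw [funDist_apply (f := fun x => f x - g x) (hf.sub hg), funDist_apply hf, funDist_apply hg,
      ← integral_sub (hE hf k) (hE hg k)]
    refine integral_congr_ae (Eventually.of_forall fun x => ?_)
    simp only [Complex.ofReal_sub, mul_sub]
  exact h1

theorem HolderBd.mono {a H H' : ℝ} {f : ℝ → ℂ} (h : HolderBd a H f) (hH : H ≤ H') :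
    HolderBd a H' f := fun x y => (h x y).trans (by gcongr)

/-- A mild solution is bounded in the Hölder space of order `β`, uniformly in time. -/
theorem IsMildSolution.exists_forall_holder {Φ : DyadicPartition} {T β : ℝ} {F ρ₀ : ℝ → ℝ}
    {d ρ : ℝ → ℝ → ℝ} (h : IsMildSolution Φ T β F ρ₀ d ρ) (hβ : 0 < β) (hβ1 : β ≤ 1) :
    ∃ m, ∀ t ∈ Icc 0 T, (∀ x, ‖(ρ t x : ℂ)‖ ≤ m) ∧ HolderBd β m (fun x => (ρ t x : ℂ)) := by
  obtain ⟨α, hα, hmem⟩ := h.mem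
  obtain ⟨C, hC, hb⟩ := exists_holder_bound Φ hβ hα hβ1
  suffices ∃ m, ∀ t ∈ Icc 0 T, t ∈ Icc 0 T →
      (∀ x, ‖(ρ t x : ℂ)‖ ≤ m) ∧ HolderBd β m (fun x => (ρ t x : ℂ)) by
    obtain ⟨m, hm⟩ := this
    exact ⟨m, fun t ht => hm t ht ht⟩
  refine isCompact_Icc.induction_on (p := fun S => ∃ m, ∀ t ∈ S, t ∈ Icc 0 T →
      (∀ x, ‖(ρ t x : ℂ)‖ ≤ m) ∧ HolderBd β m (fun x => (ρ t x : ℂ))) ⟨0, by simp⟩ ?_ ?_ ?_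
  · rintro S S' hS ⟨m, hm⟩
    exact ⟨m, fun t ht => hm t (hS ht)⟩
  · rintro S S' ⟨m, hm⟩ ⟨m', hm'⟩
    refine ⟨max m m', ?_⟩
    rintro t (ht | ht) htI
    · exact ⟨fun x => ((hm t ht htI).1 x).trans (le_max_left _ _),
        (hm t ht htI).2.mono (le_max_left _ _)⟩
    · exact ⟨fun x => ((hm' t ht htI).1 x).trans (le_max_right _ _),
        (hm' t ht htI).2.mono (le_max_right _ _)⟩
  · intro t ht
    obtain ⟨h1, h2⟩ := hb (ρ t) _ (h.cont t ht) (h.bdd t ht)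
      (lt_ofReal_toReal_add_one (hmem.finite t ht))
    set m := C * ((besovNorm Φ α (funDist (ρ t))).toReal + 1)
    have hev : ∀ᶠ s in 𝓝[Icc 0 T] t,
        besovNorm Φ α (funDist (ρ s) - funDist (ρ t)) < ENNReal.ofReal 1 :=
      (hmem.cont t ht).eventually (gt_mem_nhds (by simp))
    refine ⟨_, hev, m + C * 1, fun s hs hsI => ?_⟩
    have hs' : besovNorm Φ α (funDist (ρ s) - funDist (ρ t)) < ENNReal.ofReal 1 := hs
    rw [← funDist_sub (h.bdd s hsI) (h.bdd t ht)] at hs'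
    obtain ⟨h3, h4⟩ := hb _ 1 ((h.cont s hsI).sub (h.cont t ht)) ((h.bdd s hsI).sub (h.bdd t ht)) hs'
    have e : ∀ x, (ρ s x : ℂ) = ρ t x + ((ρ s x - ρ t x : ℝ) : ℂ) := fun x => by
      push_cast
      ring
    refine ⟨fun x => ?_, fun x y => ?_⟩
    · rw [e]
      exact norm_add_le_of_le (h1 x) (h3 x)
    · dsimp only
      rw [e x, e y, add_sub_add_comm, add_mul]
      exact norm_add_le_of_le (h2 x y) (h4 x y)

/-- A mild solution is continuous in time with values in the bounded functions. -/
theorem IsMildSolution.eventually_norm_sub_le {Φ : DyadicPartition} {T β : ℝ} {F ρ₀ : ℝ → ℝ}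
    {d ρ : ℝ → ℝ → ℝ} (h : IsMildSolution Φ T β F ρ₀ d ρ) (hβ : 0 < β) (hβ1 : β ≤ 1) {ε : ℝ}
    (hε : 0 < ε) {t : ℝ} (ht : t ∈ Icc 0 T) :
    ∀ᶠ s in 𝓝[Icc 0 T] t, ∀ x, |ρ s x - ρ t x| ≤ ε := by
  obtain ⟨α, hα, hmem⟩ := h.mem
  obtain ⟨C, hC, hb⟩ := exists_holder_bound Φ hβ hα hβ1
  have hA : 0 < ε / (C + 1) := by positivity
  filter_upwards [(hmem.cont t ht).eventually (gt_mem_nhds (ENNReal.ofReal_pos.2 hA)),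
    self_mem_nhdsWithin] with s hs hsI x
  rw [← funDist_sub (h.bdd s hsI) (h.bdd t ht)] at hs
  have h3 := (hb _ _ ((h.cont s hsI).sub (h.cont t ht)) ((h.bdd s hsI).sub (h.bdd t ht)) hs).1 x
  rw [Complex.norm_real, Real.norm_eq_abs] at h3
  refine h3.trans ?_
  rw [mul_div_assoc', div_le_iff₀ (by linarith)]
  nlinarith

/-! ### The derivative of the solution -/

theorem IsAdmissibleNonlinearity.exists_lipschitz {F : ℝ → ℝ} (hF : IsAdmissibleNonlinearity F) :
    ∃ L : ℝ, 0 ≤ L ∧ ∀ x y, |x * F x - y * F y| ≤ L * |x - y| := by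
  obtain ⟨C, hC⟩ := hF.reg_tilde.bdd
  refine ⟨C, (abs_nonneg _).trans (hC 0), fun x y => ?_⟩
  have := convex_univ.norm_image_sub_le_of_norm_deriv_le (𝕜 := ℝ) (f := fun x => x * F x)
    (fun x _ => hF.reg_tilde.diff x) (fun x _ => hC x) (mem_univ y) (mem_univ x)
  exact this

theorem HolderBd.of_le {a b m : ℝ} {f : ℝ → ℂ} (hb : 0 ≤ b) (hba : b ≤ a) (ha : 0 < a)
    (hf : ∀ x, ‖f x‖ ≤ m) (hH : HolderBd a m f) : HolderBd b (2 * m) f := by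
  intro x y
  have hm : 0 ≤ m := (norm_nonneg _).trans (hf 0)
  have h := le_mul_rpow_of_le (a := ‖f x - f y‖) (X := 2 * m) (y := |x - y| ^ a) (θ := b / a)
    (by positivity) ((div_le_one ha).2 hba) (by positivity) (by positivity)
    (by linarith [norm_sub_le_of_le (hf x) (hf y)])
    ((hH x y).trans (by nlinarith [Real.rpow_nonneg (abs_nonneg (x - y)) a]))
  rwa [← Real.rpow_mul (abs_nonneg _), mul_div_cancel₀ _ ha.ne'] at h

/-- Interpolation between the supremum and Lipschitz bounds of the regularised drift. -/
theorem HolderBd.of_scaled_bounds {B N p δ : ℝ} {f : ℝ → ℂ} (hB : 0 ≤ B) (hN : 0 < N)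
    (hδ0 : 0 ≤ δ) (hδ1 : δ ≤ 1) (hf : ∀ x, ‖f x‖ ≤ B * N ^ (p / 2))
    (hH : HolderBd 1 (B * N ^ ((p + 1) / 2)) f) : HolderBd δ (2 * B * N ^ ((p + δ) / 2)) f := by
  intro x y
  have e1 : N ^ ((p + 1) / 2) = N ^ (p / 2) * N ^ (1 / 2 : ℝ) := by
    rw [← Real.rpow_add hN]
    ring_nf
  have e2 : N ^ ((p + δ) / 2) = N ^ (p / 2) * N ^ (1 / 2 * δ) := by
    rw [← Real.rpow_add hN]
    ring_nf
  have h1 := hH x y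
  rw [Real.rpow_one, e1] at h1
  have h := le_mul_rpow_of_le (a := ‖f x - f y‖) (X := 2 * (B * N ^ (p / 2)))
    (y := N ^ (1 / 2 : ℝ) * |x - y|) hδ0 hδ1 (by positivity) (by positivity)
    (by linarith [norm_sub_le_of_le (hf x) (hf y)]) (by
      have : 0 ≤ B * N ^ (p / 2) * (N ^ (1 / 2 : ℝ) * |x - y|) := by positivity
      linarith)
  rw [Real.mul_rpow (by positivity) (abs_nonneg _), ← Real.rpow_mul hN.le] at h
  rw [e2]
  exact h.trans (le_of_eq (by ring))

/-- The derivative of a mild solution is that of `P_t ρ₀` up to a Hölder continuous remainder `D`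
bounded by a power of `N`. The a priori bound is used with the Hölder exponent `β` for the solution
and a regularity `-c`, `βhat < c < β`, for the drift. -/
theorem exists_remainder_bound (Φ : DyadicPartition) {β βhat η T L : ℝ} {F : ℝ → ℝ} (hβ2 : β < 1 / 2)
    (h0 : 0 < βhat) (h1 : βhat < β) (hη : 0 < η) (hT : 0 < T) (hF : Continuous F) (hL0 : 0 ≤ L)
    (hL : ∀ x y, |x * F x - y * F y| ≤ L * |x - y|) :
    ∃ c : ℝ≥0∞ → ℝ≥0∞ → ℝ≥0, ∀ (ρ₀ : ℝ → ℝ) (b : ℝ → 𝓢'(ℝ, ℂ)), Continuous ρ₀ →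
      MemLp ρ₀ ∞ (volume : Measure ℝ) → besovNorm Φ (max (1 / 2) η) (funDist ρ₀) < ⊤ →
      normCT Φ T (-βhat) b < ⊤ → ∀ (N : ℝ) (bN ρN : ℝ → ℝ → ℝ), 1 ≤ N →
      (∀ t ∈ Icc (0 : ℝ) T, IsBoundedFun (regDrift b N t) (bN t)) →
      IsMildSolution Φ T β F ρ₀ bN ρN → ∀ t ∈ Ioc 0 T, ∃ (D : ℝ → ℂ) (H e : ℝ), 0 < e ∧
        (∀ x, HasDerivAt (fun x => (ρN t x : ℂ)) (heatD t (fun y => (ρ₀ y : ℂ)) x - D x) x) ∧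
        (∀ x, ‖D x‖ ≤ c (besovNorm Φ (max (1 / 2) η) (funDist ρ₀)) (normCT Φ T (-βhat) b) *
          N ^ ((η + βhat) / 2)) ∧ HolderBd e H D := by
  -- `δ` leaves room for `c + δ ≤ η + βhat` and for `c < β`
  set δ : ℝ := min (η / 2) ((β - βhat) / 2) with hδ
  have hδ0 : 0 < δ := lt_min (by linarith) (by linarith)
  have hδη : δ ≤ η / 2 := min_le_left _ _
  have hδβ : δ ≤ (β - βhat) / 2 := min_le_right _ _
  set c : ℝ := βhat + δ with hc
  have hβ : 0 < β := by linarith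
  obtain ⟨Ch, hCh, hh⟩ := exists_holder_bound Φ hβ (lt_of_lt_of_le hβ2 (le_max_left _ η))
    (by linarith)
  obtain ⟨Cb, hCb, hb⟩ := exists_regularised_bound Φ (T := T) (b := βhat) (c := c) hT.le
    (by linarith) (by linarith) (by linarith)
  have hap := fun B : ℝ≥0∞ => exists_holder_apriori (T := T) (a := β) (c := c) (L := L)
    (K := Cb * (B.toReal + 1)) hT (by linarith) (by linarith) hβ2 hL0 (by positivity)
  choose Ca hCa hCab using hap
  -- the norms are increased by `1` because the bounds of the blocks need a strict inequality
  refine ⟨fun A B => Real.toNNReal (16 / δ * (4 * (L * (Ca B * (Ch * (A.toReal + 1)))) *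
    (Cb * (B.toReal + 1))) * T ^ (δ / 2)), fun ρ₀ b hρ₀ hρ₀b hA hB N bN ρN hN hbN hρ t ht => ?_⟩
  set A := besovNorm Φ (max (1 / 2) η) (funDist ρ₀)
  set B := normCT Φ T (-βhat) b
  have hN0 : 0 < N := by linarith
  set K := Cb * (B.toReal + 1) with hK
  set R := Ch * (A.toReal + 1) with hR
  set m := Ca B * R with hm
  have hCaB := hCa B
  have hK0 : 0 ≤ K := by positivity
  have hR0 : 0 ≤ R := by positivity
  have hm0 : 0 ≤ m := by positivity
  obtain ⟨hR1, hR2⟩ := hh ρ₀ _ hρ₀ hρ₀b (lt_ofReal_toReal_add_one hA)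
  -- the drift
  have hdr := fun (s : ℝ) (hs : s ∈ Icc 0 T) => hb (b s) (B.toReal + 1)
    ((le_iSup₂ (f := fun t (_ : t ∈ Icc (0 : ℝ) T) => besovNorm Φ (-βhat) (b t)) s hs).trans_lt
      (lt_ofReal_toReal_add_one hB)) N (bN s) hN (hbN s hs)
  have hdc : ∀ s ∈ Icc 0 T, Continuous (fun x => (bN s x : ℂ)) := fun s hs =>
    Complex.continuous_ofReal.comp (hbN s hs).cont
  -- the nonlinearity
  set f : ℝ → ℝ → ℂ := fun s x => ((ρN s x * F (ρN s x) : ℝ) : ℂ) with hf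
  have hfc : ∀ s ∈ Icc 0 T, Continuous (f s) := fun s hs =>
    Complex.continuous_ofReal.comp ((hρ.cont s hs).mul (hF.comp (hρ.cont s hs)))
  have hfd : ∀ s x y, ‖f s x - f s y‖ ≤ L * ‖(ρN s x : ℂ) - ρN s y‖ := fun s x y => by
    rw [hf, ← Complex.ofReal_sub, ← Complex.ofReal_sub, Complex.norm_real, Complex.norm_real]
    exact hL _ _
  have hfb : ∀ s x, ‖f s x‖ ≤ L * ‖(ρN s x : ℂ)‖ := fun s x => by
    rw [hf, Complex.norm_real, Complex.norm_real]
    simpa using hL (ρN s x) 0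
  -- the Duhamel formula
  obtain ⟨m₀, hm₀⟩ := hρ.exists_forall_holder hβ (by linarith)
  set q : ℝ → ℝ → ℝ := fun s x => (ρN s x * F (ρN s x)) * bN s x with hq
  have hqf : ∀ s, (fun y => (q s y : ℂ)) = fun y => f s y * (bN s y : ℂ) := fun s =>
    funext fun y => Complex.ofReal_mul _ _
  have hduh := fun (t : ℝ) (ht : t ∈ Ioc 0 T) (x : ℝ) =>
    hρ.duhamel hρ₀ hρ₀b hβ (by linarith) hm₀ (q := q)
      (G := L * m₀ * (Cb * (B.toReal + 1) * N ^ (c / 2))) (fun s x => rfl)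
      (fun s hs => ((hρ.cont s hs).mul (hF.comp (hρ.cont s hs))).mul (hbN s hs).cont)
      (fun s hs x => by
        rw [congrFun (hqf s) x]
        have hm₀0 : 0 ≤ m₀ := (norm_nonneg _).trans ((hm₀ s hs).1 0)
        refine norm_mul_le_of_le ((hfb s x).trans ?_) ((hdr s hs).1 x)
        gcongr
        exact (hm₀ s hs).1 x) ht x
  simp only [hqf] at hduh
  have hini := hρ.eq_initial hT.le hρ₀ hρ₀b
  -- the a priori bound
  have hmain := hCab B (fun s x => (ρN s x : ℂ)) f (fun s x => (bN s x : ℂ)) R (K * N ^ (c / 2))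
    (K * N ^ ((c + 1) / 2)) m₀ (by rw [hini]; exact hR1) (by rw [hini]; exact hR2)
    (by rw [hini]; exact Complex.continuous_ofReal.comp hρ₀) hfc (fun s _ => hfb s)
    (fun s _ => hfd s) hdc (fun s hs => (hdr s hs).1) (fun s hs => (hdr s hs).2.1)
    (fun s hs => (hdr s hs).2.2) hm₀ (fun t ht x => (hduh t ht x).1)
    (fun t ht x => by rw [hini]; exact (hduh t ht x).2)
  have hsI : ∀ s ∈ Ioo 0 t, s ∈ Icc 0 T := fun s hs => ⟨hs.1.le, hs.2.le.trans ht.2⟩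
  have hfm : ∀ s ∈ Icc 0 T, ∀ x, ‖f s x‖ ≤ L * m := fun s hs x =>
    (hfb s x).trans (mul_le_mul_of_nonneg_left ((hmain s hs).1 x) hL0)
  have hfH : ∀ s ∈ Icc 0 T, HolderBd β (L * m) (f s) := fun s hs x y => by
    refine (hfd s x y).trans ?_
    rw [mul_assoc]
    exact mul_le_mul_of_nonneg_left ((hmain s hs).2 x y) hL0
  have hNle : ∀ p, p ≤ η + βhat → N ^ (p / 2) ≤ N ^ ((η + βhat) / 2) := fun p hp =>
    Real.rpow_le_rpow_of_exponent_le hN (by linarith)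
  have hqH : ∀ s ∈ Ioo 0 t, HolderBd δ (4 * (L * m) * K * N ^ ((η + βhat) / 2))
      (fun y => f s y * (bN s y : ℂ)) := fun s hs => by
    have hs' := hsI s hs
    refine (HolderBd.mul (hfm s hs') (hdr s hs').1
      (HolderBd.of_le hδ0.le (by linarith) hβ (hfm s hs') (hfH s hs'))
      (HolderBd.of_scaled_bounds hK0 hN0 hδ0.le (by linarith) (hdr s hs').1 (hdr s hs').2.1)).mono ?_
    have hLm : 0 ≤ L * m := by positivity
    calc _ = 2 * (L * m) * K * N ^ ((c + δ) / 2) + 2 * (L * m) * K * N ^ (c / 2) := by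
          rw [hK]
          ring
      _ ≤ 2 * (L * m) * K * N ^ ((η + βhat) / 2) + 2 * (L * m) * K * N ^ ((η + βhat) / 2) := by
          gcongr ?_ + ?_
          · exact mul_le_mul_of_nonneg_left (hNle _ (by linarith)) (by positivity)
          · exact mul_le_mul_of_nonneg_left (hNle _ (by linarith)) (by positivity)
      _ = _ := by ring
  obtain ⟨D, H, hD1, hD2, hD3⟩ := exists_hasDerivAt_duhamel hδ0 (by linarith) ht.1
    (g := fun s y => f s y * (bN s y : ℂ))
    (fun s hs => EssBdd.mul (.of_continuous (hfc s (hsI s hs)) (hfm s (hsI s hs)))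
      (.of_continuous (hdc s (hsI s hs)) (hdr s (hsI s hs)).1)) hqH (fun x => (hduh t ht x).1)
  refine ⟨D, H, δ / 2, by linarith, fun x => ?_, fun x => ?_, hD3⟩
  · rw [funext fun x => (hduh t ht x).2]
    exact (hasDerivAt_heat ht.1 (.of_continuous (Complex.continuous_ofReal.comp hρ₀) hR1) x).sub
      (hD1 x)
  · refine (hD2 x).trans ?_
    have ht0 := ht.1
    have hTt : t ^ (δ / 2) ≤ T ^ (δ / 2) := Real.rpow_le_rpow ht0.le ht.2 (by linarith)
    calc _ ≤ 16 / δ * (4 * (L * m) * K * N ^ ((η + βhat) / 2)) * T ^ (δ / 2) := by gcongr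
      _ = 16 / δ * (4 * (L * m) * K) * T ^ (δ / 2) * N ^ ((η + βhat) / 2) := by ring
      _ ≤ _ := by
        gcongr
        exact Real.le_coe_toNNReal _

/-! ### Measurability in time -/

open Classical in
/-- The class in `L^∞(ℝ)` of a function, by convention `0` if it does not have one. -/
noncomputable def essClass (f : ℝ → ℝ) : Lp ℝ ∞ (volume : Measure ℝ) :=
  if h : MemLp f ∞ (volume : Measure ℝ) then h.toLp f else 0

theorem essClass_ae_eq {f : ℝ → ℝ} (hf : MemLp f ∞ (volume : Measure ℝ)) :
    essClass f =ᵐ[volume] f := by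
  rw [essClass, dif_pos hf]
  exact hf.coeFn_toLp

theorem norm_essClass_le {f : ℝ → ℝ} (hf : MemLp f ∞ (volume : Measure ℝ)) {C : ℝ}
    (h : ∀ x, |f x| ≤ C) : ‖essClass f‖ ≤ C := by
  have hC : 0 ≤ C := (abs_nonneg _).trans (h 0)
  rw [essClass, dif_pos hf, Lp.norm_toLp, eLpNorm_exponent_top]
  exact ENNReal.toReal_le_of_le_ofReal hC
    (eLpNormEssSup_le_of_ae_bound (Eventually.of_forall h))

theorem norm_essClass_sub_le {f g : ℝ → ℝ} (hf : MemLp f ∞ (volume : Measure ℝ))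
    (hg : MemLp g ∞ (volume : Measure ℝ)) {C : ℝ} (h : ∀ x, |f x - g x| ≤ C) :
    ‖essClass f - essClass g‖ ≤ C := by
  have e : essClass f - essClass g = essClass (f - g) := by
    rw [essClass, essClass, essClass, dif_pos hf, dif_pos hg, dif_pos (hf.sub hg),
      MemLp.toLp_sub hf hg]
  rw [e]
  exact norm_essClass_le (hf.sub hg) h

theorem abs_slope_sub_deriv_le {f : ℝ → ℝ} (hf : Differentiable ℝ f) {H e h : ℝ} (hH : 0 ≤ H)
    (he : 0 ≤ e) (hh : 0 < h)
    (hd : ∀ x y, |deriv f x - deriv f y| ≤ H * (|x - y| + |x - y| ^ e)) (x : ℝ) :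
    |h⁻¹ * (f (x + h) - f x) - deriv f x| ≤ H * (h + h ^ e) := by
  obtain ⟨c, hc, hce⟩ := exists_hasDerivAt_eq_slope f (deriv f) (lt_add_of_pos_right x hh)
    hf.continuous.continuousOn fun y _ => (hf y).hasDerivAt
  rw [add_sub_cancel_left, div_eq_inv_mul] at hce
  rw [← hce]
  refine (hd c x).trans ?_
  have h1 : |c - x| ≤ h := by
    rw [abs_of_pos (by linarith [hc.1])]
    linarith [hc.2]
  gcongr

/-- The map `t ↦ ∂_x ρ(t)` is measurable with values in `L^∞(ℝ)`, as the pointwise limit of the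
difference quotients in space, which are continuous in time. A modulus of continuity of `∂_x ρ(t)` is
needed for the limit to hold in the norm of `L^∞(ℝ)`, which is not separable. -/
theorem aestronglyMeasurable_essClass_deriv {T : ℝ} {ρ : ℝ → ℝ → ℝ}
    (hb : ∀ t ∈ Icc 0 T, MemLp (ρ t) ∞ (volume : Measure ℝ))
    (hc : ∀ t ∈ Icc 0 T, ∀ ε > 0, ∀ᶠ s in 𝓝[Icc 0 T] t, ∀ x, |ρ s x - ρ t x| ≤ ε)
    (hd : ∀ t ∈ Icc 0 T, Differentiable ℝ (ρ t))
    (hdb : ∀ t ∈ Icc 0 T, MemLp (deriv (ρ t)) ∞ (volume : Measure ℝ))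
    (hdH : ∀ t ∈ Ioc 0 T, ∃ H e : ℝ, 0 ≤ H ∧ 0 < e ∧
      ∀ x y, |deriv (ρ t) x - deriv (ρ t) y| ≤ H * (|x - y| + |x - y| ^ e)) :
    AEStronglyMeasurable (fun t => essClass (deriv (ρ t))) (volume.restrict (Icc (0 : ℝ) T)) := by
  have hh : ∀ n : ℕ, (0 : ℝ) < 1 / ((n : ℝ) + 1) := fun n => by positivity
  have hmem : ∀ n : ℕ, ∀ t ∈ Icc 0 T, MemLp (fun x => (1 / ((n : ℝ) + 1))⁻¹ *
      (ρ t (x + 1 / ((n : ℝ) + 1)) - ρ t x)) ∞ (volume : Measure ℝ) := fun n t ht =>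
    (((hb t ht).comp_measurePreserving (measurePreserving_add_right volume _)).sub
      (hb t ht)).const_mul _
  refine aestronglyMeasurable_of_tendsto_ae atTop
    (f := fun (n : ℕ) t => essClass (fun x => (1 / ((n : ℝ) + 1))⁻¹ *
      (ρ t (x + 1 / ((n : ℝ) + 1)) - ρ t x))) (fun n => ?_) ?_
  · refine ContinuousOn.aestronglyMeasurable (fun t ht => ?_) measurableSet_Icc
    refine Metric.tendsto_nhds.2 fun ε hε => ?_
    set k := (1 / ((n : ℝ) + 1))⁻¹ with hk
    have hk0 : 0 < k := inv_pos.2 (hh n)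
    filter_upwards [hc t ht (ε / (4 * k)) (by positivity), self_mem_nhdsWithin] with s hs hsI
    rw [dist_eq_norm]
    refine (norm_essClass_sub_le (hmem n s hsI) (hmem n t ht) (C := ε / 2) fun x => ?_).trans_lt
      (by linarith)
    rw [← mul_sub, abs_mul, abs_of_pos hk0, sub_sub_sub_comm]
    have h1 := (abs_sub _ _).trans (add_le_add (hs (x + 1 / ((n : ℝ) + 1))) (hs x))
    calc _ ≤ k * (ε / (4 * k) + ε / (4 * k)) := by gcongr
      _ = ε / 2 := by field_simp; ring
  · have h0 : ∀ᵐ t ∂(volume.restrict (Icc (0 : ℝ) T)), t ∈ Ioc 0 T := by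
      rw [Measure.restrict_congr_set Ioc_ae_eq_Icc.symm]
      exact ae_restrict_mem measurableSet_Ioc
    filter_upwards [h0] with t ht
    have htI : t ∈ Icc 0 T := ⟨ht.1.le, ht.2⟩
    obtain ⟨H, e, hH, he, hHe⟩ := hdH t ht
    rw [tendsto_iff_norm_sub_tendsto_zero]
    refine squeeze_zero (fun n => norm_nonneg _) (fun n => norm_essClass_sub_le (hmem n t htI)
      (hdb t htI) (abs_slope_sub_deriv_le (hd t htI) hH he.le (hh n) hHe)) ?_
    have h1 := tendsto_one_div_add_atTop_nhds_zero_nat (𝕜 := ℝ)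
    have h2 := h1.rpow_const (p := e) (Or.inr he.le)
    rw [Real.zero_rpow he.ne'] at h2
    simpa using (h1.add h2).const_mul H

theorem hasDerivAt_re {f : ℝ → ℝ} {f' : ℂ} {x : ℝ} (h : HasDerivAt (fun x => (f x : ℂ)) f' x) :
    HasDerivAt f f'.re x :=
  Complex.reCLM.hasFDerivAt.comp_hasDerivAt x h

theorem lemma5p4 (Φ : DyadicPartition) :
    -- `c₇` depends on `ν` and on `‖ρ₀‖_{C^{1+ν}}`
    ∃ c₇ : ℝ → ℝ≥0∞ → ℝ≥0,
    ∀ (β βhat : ℝ) (F : ℝ → ℝ), 0 < β → β < 1 / 2 → 0 < βhat → βhat < β →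
      IsAdmissibleNonlinearity F →
    -- `c₈` depends on `β`, `βhat`, `F`, and on `η`, `T`, `‖ρ₀‖_{C^{1/2 ∨ η}}`,
    -- `sup_N ‖b^N‖_{C_T C^{-β}}`, `‖b‖_{C_T C^{-βhat}}`
    ∃ c₈ : ℝ → ℝ → ℝ≥0∞ → ℝ≥0∞ → ℝ≥0∞ → ℝ≥0,
    ∀ (ν T : ℝ) (ρ₀ : ℝ → ℝ) (b : ℝ → 𝓢'(ℝ, ℂ)), 0 < ν → β - βhat < ν → 0 < T →
      IsAdmissibleDensity Φ ν ρ₀ → MemHolderT Φ T (1 / 2) (-βhat) b →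
    ∀ (N : ℝ) (bN ρN : ℝ → ℝ → ℝ), 1 ≤ N →
      (∀ t ∈ Icc (0 : ℝ) T, IsBoundedFun (regDrift b N t) (bN t)) →
      IsMildSolution Φ T β F ρ₀ bN ρN →
    (∀ t ∈ Icc (0 : ℝ) T, Differentiable ℝ (ρN t)) ∧
    ∃ g : ℝ → Lp ℝ ∞ (volume : Measure ℝ),
      (∀ t ∈ Icc (0 : ℝ) T, g t =ᵐ[volume] deriv (ρN t)) ∧
      MemLp g ∞ (volume.restrict (Icc (0 : ℝ) T)) ∧
      ∀ η ∈ Ioo (0 : ℝ) ν,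
        eLpNorm g ∞ (volume.restrict (Icc (0 : ℝ) T)) ≤
          ENNReal.ofReal (c₇ ν (besovNorm Φ (1 + ν) (funDist ρ₀)) +
            c₈ η T (besovNorm Φ (max (1 / 2) η) (funDist ρ₀))
                (⨆ (M : ℝ) (_ : 1 ≤ M), normCT Φ T (-β) (regDrift b M))
                (normCT Φ T (-βhat) b)
              * N ^ ((η + βhat) / 2)) := by
  -- for `ν ≤ 0` the constant is arbitrary
  have h7 : ∀ ν : ℝ, ∃ C : ℝ, 0 < ν → ∀ (f : ℝ → ℝ) (A : ℝ), Continuous f →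
      MemLp f ∞ (volume : Measure ℝ) → besovNorm Φ (1 + ν) (funDist f) < ENNReal.ofReal A →
      ∃ f' : ℝ → ℂ, (∀ x, HasDerivAt (fun x => (f x : ℂ)) (f' x) x) ∧ ∀ x, ‖f' x‖ ≤ C * A :=
      fun ν => by
    by_cases hν : 0 < ν
    · obtain ⟨C, -, hC⟩ := exists_deriv_bound Φ hν
      exact ⟨C, fun _ => hC⟩
    · exact ⟨0, fun h => absurd h hν⟩
  choose C₇ hC₇ using h7
  refine ⟨fun ν A => (C₇ ν * (A.toReal + 1)).toNNReal,
    fun β βhat F hβ hβ2 h0 h1 hF => ?_⟩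
  obtain ⟨L, hL0, hL⟩ := hF.exists_lipschitz
  have h8 := fun (η T : ℝ) (h : 0 < η ∧ 0 < T) =>
    exists_remainder_bound Φ hβ2 h0 h1 h.1 h.2 hF.reg.diff.continuous hL0 hL
  choose! c₈ hc₈ using h8
  refine ⟨fun η T A _ B => c₈ η T A B, fun ν T ρ₀ b hν hβν hT hρ₀ hb N bN ρN hN hbN hρ => ?_⟩
  have hB := hb.normCT_lt_top hT.le (by norm_num)
  have hA : ∀ η ∈ Ioo (0 : ℝ) ν, besovNorm Φ (max (1 / 2) η) (funDist ρ₀) < ⊤ := fun η hη =>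
    (besovNorm_le_of_le Φ (max_le (by linarith) (by linarith [hη.2])) _).trans_lt
      (ENNReal.mul_lt_top ENNReal.ofReal_lt_top hρ₀.reg)
  have hrem := fun (η : ℝ) (hη : η ∈ Ioo (0 : ℝ) ν) =>
    hc₈ η T ⟨hη.1, hT⟩ ρ₀ b hρ₀.cont hρ₀.bdd (hA η hη) hB N bN ρN hN hbN hρ
  obtain ⟨f', hf', hf'b⟩ := hC₇ ν hν ρ₀ _ hρ₀.cont hρ₀.bdd (lt_ofReal_toReal_add_one hρ₀.reg)
  set c7 : ℝ≥0 := (C₇ ν * ((besovNorm Φ (1 + ν) (funDist ρ₀)).toReal + 1)).toNNReal with hc7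
  have hf'c : ∀ x, ‖f' x‖ ≤ c7 := fun x => (hf'b x).trans (Real.le_coe_toNNReal _)
  -- at `t = 0`, where the Duhamel formula is not available, the solution is `ρ₀` itself
  have hini := hρ.eq_initial hT.le hρ₀.cont hρ₀.bdd
  obtain ⟨M₀, hM₀⟩ := norm_ofReal_le_of_memLp hρ₀.cont hρ₀.bdd
  have hE₀ : EssBdd (fun y => (ρ₀ y : ℂ)) M₀ :=
    .of_continuous (Complex.continuous_ofReal.comp hρ₀.cont) hM₀
  have hf'E : EssBdd f' c7 := by
    refine ⟨?_, Eventually.of_forall hf'c⟩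
    rw [show f' = deriv (fun y => (ρ₀ y : ℂ)) from funext fun x => (hf' x).deriv.symm]
    exact (measurable_deriv _).aestronglyMeasurable
  -- the derivative is put on `ρ₀`, so that the bound does not degenerate as `t → 0`
  have hheatD : ∀ t, 0 < t → ∀ x, ‖heatD t (fun y => (ρ₀ y : ℂ)) x‖ ≤ c7 := fun t ht x => by
    rw [(hasDerivAt_heat ht hE₀ x).unique (hasDerivAt_heat_right ht hE₀ hf' hf'c x)]
    exact norm_heat_le ht hf'E x
  have hν2 : ν / 2 ∈ Ioo (0 : ℝ) ν := ⟨by linarith, by linarith⟩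
  have hdiff : ∀ t ∈ Icc (0 : ℝ) T, Differentiable ℝ (ρN t) := fun t ht x => by
    rcases ht.1.eq_or_lt with rfl | ht0
    · rw [hini]
      exact (hasDerivAt_re (hf' x)).differentiableAt
    · obtain ⟨D, H, e, he, hD, -⟩ := hrem _ hν2 t ⟨ht0, ht.2⟩
      exact (hasDerivAt_re (hD x)).differentiableAt
  set R : ℝ → ℝ := fun η => c7 + c₈ η T (besovNorm Φ (max (1 / 2) η) (funDist ρ₀))
    (normCT Φ T (-βhat) b) * N ^ ((η + βhat) / 2) with hR
  have hbound : ∀ η ∈ Ioo (0 : ℝ) ν, ∀ t ∈ Icc (0 : ℝ) T, ∀ x, |deriv (ρN t) x| ≤ R η :=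
      fun η hη t ht x => by
    have hN0 : 0 ≤ N := by linarith
    rcases ht.1.eq_or_lt with rfl | ht0
    · rw [hini, (hasDerivAt_re (hf' x)).deriv]
      have : 0 ≤ (c₈ η T (besovNorm Φ (max (1 / 2) η) (funDist ρ₀))
        (normCT Φ T (-βhat) b) : ℝ) * N ^ ((η + βhat) / 2) := by positivity
      exact ((Complex.abs_re_le_norm _).trans (hf'c x)).trans (le_add_of_nonneg_right this)
    · obtain ⟨D, H, e, he, hD, hDb, -⟩ := hrem _ hη t ⟨ht0, ht.2⟩
      rw [(hasDerivAt_re (hD x)).deriv]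
      exact (Complex.abs_re_le_norm _).trans (norm_sub_le_of_le (hheatD t ht0 x) (hDb x))
  have hdmem : ∀ t ∈ Icc (0 : ℝ) T, MemLp (deriv (ρN t)) ∞ (volume : Measure ℝ) := fun t ht =>
    memLp_top_of_bound (measurable_deriv _).aestronglyMeasurable (R (ν / 2))
      (Eventually.of_forall (hbound _ hν2 t ht))
  have hmeas : AEStronglyMeasurable (fun t => essClass (deriv (ρN t)))
      (volume.restrict (Icc (0 : ℝ) T)) := by
    refine aestronglyMeasurable_essClass_deriv hρ.bdd
      (fun t ht ε hε => hρ.eventually_norm_sub_le hβ (by linarith) hε ht) hdiff hdmem fun t ht => ?_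
    obtain ⟨D, H, e, he, hD, -, hDH⟩ := hrem _ hν2 t ht
    have hLip := HolderBd.of_hasDerivAt (hasDerivAt_heatD ht.1 hE₀)
      (norm_heatD_le (half_pos ht.1) (essBdd_heatD (half_pos ht.1) hE₀))
    refine ⟨max _ H, e, le_max_of_le_left hLip.nonneg, he, fun x y => ?_⟩
    rw [(hasDerivAt_re (hD x)).deriv, (hasDerivAt_re (hD y)).deriv, ← Complex.sub_re,
      sub_sub_sub_comm]
    refine (Complex.abs_re_le_norm _).trans
      ((norm_sub_le_of_le (hLip x y) (hDH x y)).trans ?_)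
    rw [Real.rpow_one, mul_add]
    gcongr
    · exact le_max_left _ _
    · exact le_max_right _ _
  have hnorm : ∀ η ∈ Ioo (0 : ℝ) ν, ∀ᵐ t ∂(volume.restrict (Icc (0 : ℝ) T)),
      ‖essClass (deriv (ρN t))‖ ≤ R η := fun η hη => by
    filter_upwards [ae_restrict_mem measurableSet_Icc] with t ht
    exact norm_essClass_le (hdmem t ht) (hbound η hη t ht)
  refine ⟨hdiff, fun t => essClass (deriv (ρN t)), fun t ht => essClass_ae_eq (hdmem t ht),
    memLp_top_of_bound hmeas (R (ν / 2)) (hnorm _ hν2), fun η hη => ?_⟩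
  rw [eLpNorm_exponent_top]
  exact eLpNormEssSup_le_of_ae_bound (hnorm η hη)
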